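/- Let $\mathcal V$ be a symmetric monoidal closed category with all small limits and colimits, with tensor product $\otimes$, unit $I$ and symmetry $s$. A *skew monoidal tensored $\mathcal V$-category* $\langle\mathcal M,\odot,R\rangle$ is a left $\mathcal V$-actegory $\mathcal M$ (action $V\otimes M$, with invertible associator $a$ and unitor $l$) such that every functor $-\otimes M:\mathcal V\to\mathcal M$ has a right adjoint $\mathcal M(M,-)$ (with counit $\mathrm{ev}$), together with a functor $\odot:\mathcal M\times\mathcal M\to\mathcal M$ with strengths $\Gamma_{V,M,N}:V\otimes(M\odot N)\to(V\otimes M)\odot N$ and $\Gamma'_{V,M,N}:V\otimes(M\odot N)\to M\odot(V\otimes N)$ making it a 2-variable morphism of $\mathcal V$-actegories, an object $R$, and transformations of actegory morphisms $\gamma_{L,M,N}:L\odot(M\odot N)\to(L\odot M)\odot N$, $\eta_M:M\to R\odot M$, $\varepsilon_M:M\odot R\to M$ satisfying the five (right) skew monoidal category axioms. It is *r2-exact* if $\mathcal M$ has reflexive coequalizers, all functors $V\otimes-$ and $M\odot-$ preserve them, and $\Gamma'$ is invertible. A *skew monoidal $\mathcal V$-functor* is a functor $K$ with a coherent natural strength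 $V\otimes KM\to K(V\otimes M)$, a natural transformation $K_{M,N}:KM\odot KN\to K(M\odot N)$ that is $\mathcal V$-natural in both variables, and a morphism $K_0:R'\to KR$, satisfying the associativity and the two unit axioms; it is *strong* if all $K_{M,N}$ and $K_0$ are invertible. Together with the skew monoidal $\mathcal V$-natural transformations these form a 2-category. Let $\langle\mathcal M,\odot,R\rangle$ be an r2-exact skew monoidal tensored $\mathcal V$-category. Put $\mu_{M,N}=(\varepsilon_M\odot N)\circ\gamma_{M,R,N}$ and let $T=\langle R\odot-,\mu_{R,-},\eta\rangle$ be the canonical monad. Its category of algebras $\mathcal M^T$ is a $\mathcal V$-actegory via $V\otimes\langle M,\alpha\rangle=\langle V\otimes M,(V\otimes\alpha)\circ\Gamma'^{-1}_{V,R,M}\rangle$. For $T$-algebras $\langle M,\alpha\rangle$, $\langle N,\beta\rangle$ let $\pi_{M,N}:M\odot N\to M\,\overline\odot\,N$ be a (chosen) coequalizer of $\mu_{M,N},\,M\odot\beta:M\odot(R\odot N)\to M\odot N$, with the $T$-algebra structure $\psi$ determined by $\psi\circ(R\odot\pi_{M,N})=\pi_{M,N}\circ(\alpha\odot N)\circ\gamma_{R,M,N}$.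 Let $E=\mathcal M(R,R)$ be the endomorphism monoid of $R$ in $\mathcal V$, and ${}_E\mathcal M$ the category of $E$-objects (algebras of the monad $E\otimes-$), a $\mathcal V$-actegory via the isomorphisms $V\otimes(E\otimes M)\cong E\otimes(V\otimes M)$ induced by $s$. Put $\sigma_N=(\mathrm{ev}_{R,R}\odot N)\circ\Gamma_{E,R,N}\circ(E\otimes\eta_N)$ and $\rho=\mu_{M,N}\circ(M\odot\sigma_N)\circ\Gamma'_{E,M,N}$. For $E$-objects $\langle M,\lambda_M\rangle$, $\langle N,\lambda_N\rangle$ let $q_{M,N}:M\odot N\to M\odot_qN$ be a (chosen) coequalizer of $\rho,\ (M\odot\lambda_N)\circ\Gamma'_{E,M,N}:E\otimes(M\odot N)\to M\odot N$, with the $E$-action induced by $(\lambda_M\odot N)\circ\Gamma_{E,M,N}$. Then: 1. ${}_E\mathcal M$ has a unique structure of skew monoidal tensored $\mathcal V$-category with product $\odot_q$ and unit $\langle R,\mathrm{ev}_{R,R}\rangle$ for which the forgetful functor $\phi:{}_E\mathcal M\to\mathcal M$, with identity strength, with $\phi_{M,N}=q_{M,N}$ and with $\phi_0=1_R$, is a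 skew monoidal $\mathcal V$-functor; this structure is r2-exact. 2. $\mathcal M^T$ has a unique structure of skew monoidal tensored $\mathcal V$-category with product $\overline\odot$ and unit $\langle R,\varepsilon_R\rangle$ for which the forgetful functor $G:\mathcal M^T\to\mathcal M$, with identity strength, with $G_{M,N}=\pi_{M,N}$ and with $G_0=1_R$, is a skew monoidal $\mathcal V$-functor. In the same way, with ${}_E\mathcal M$ in place of $\mathcal M$ and its canonical monad $T_q$ in place of $T$, the category $({}_E\mathcal M)^{T_q}$ has a unique such structure, with skew monoidal forgetful $\mathcal V$-functor $G^q:({}_E\mathcal M)^{T_q}\to{}_E\mathcal M$. 3. The functor $\bar\phi:({}_E\mathcal M)^{T_q}\to\mathcal M^T$ that lifts $\phi$, $\langle A,\beta\rangle\mapsto\langle\phi A,\ \phi\beta\circ q_{R,A}\rangle$, carries a structure of skew monoidal $\mathcal V$-functor for which $$G\circ\bar\phi=\phi\circ G^q$$ holds strictly as an equality of skew monoidal $\mathcal V$-functors. With this structure $\bar\phi$ is an equivalence of skew monoidal $\mathcal V$-categories (an equivalence in the 2-category above); in particular it is a strong skew monoidal functor. -/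

import Mathlib

open CategoryTheory MonoidalCategory Limits
open MonoidalLeftAction

universe v u v₁ u₁ v₂ u₂ v₃ u₃

namespace SkewActegory

section Enrichment

/-- A `V`-actegory `M` is *hommed* if every functor `- ⊙ A : V ⥤ M` has a right adjoint
`M(A, -) : M ⥤ V`; hommed `V`-actegories are the same thing as tensored `V`-categories. -/
class Hommed (V : Type u) [Category.{v} V] [MonoidalCategory V]
    (M : Type u₁) [Category.{v₁} M] [MonoidalLeftAction V M] where
  /-- the `V`-valued hom functor `M(A, -)` -/
  ihom : M → M ⥤ V
  /-- the tensor-hom adjunction `M(X ⊙ A, B) ≅ V(X, M(A, B))` -/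
  adj (A : M) : actionRight V A ⊣ ihom A

variable {V : Type u} [Category.{v} V] [MonoidalCategory V]
  {M : Type u₁} [Category.{v₁} M] [MonoidalLeftAction V M] [Hommed V M]

variable (V) in
/-- The evaluation `M(A, B) ⊙ A ⟶ B`. -/
def ev (A B : M) : (Hommed.ihom (V := V) A).obj B ⊙ₗ A ⟶ B :=
  (Hommed.adj (V := V) A).counit.app B

/-- The transpose `X ⟶ M(A, B)` of a morphism `X ⊙ A ⟶ B`. -/
def curry {X : V} {A B : M} (f : X ⊙ₗ A ⟶ B) : X ⟶ (Hommed.ihom (V := V) A).obj B :=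
  (Hommed.adj (V := V) A).homEquiv X B f

lemma curry_ev {X : V} {A B : M} (f : X ⊙ₗ A ⟶ B) : curry f ⊵ₗ A ≫ ev V A B = f :=
  ((Hommed.adj (V := V) A).homEquiv_counit _ _ _).symm.trans
    (((Hommed.adj (V := V) A).homEquiv X B).symm_apply_apply f)

lemma hom_ext_ev {X : V} {A B : M} {f g : X ⟶ (Hommed.ihom (V := V) A).obj B}
    (h : f ⊵ₗ A ≫ ev V A B = g ⊵ₗ A ≫ ev V A B) : f = g :=
  ((Hommed.adj (V := V) A).homEquiv X B).symm.injective
    (((Hommed.adj (V := V) A).homEquiv_counit _ _ _).trans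
      (h.trans ((Hommed.adj (V := V) A).homEquiv_counit _ _ _).symm))

variable (V) in
/-- The endomorphism monoid `E = M(R, R)` of `R`, as an object of `V`. -/
abbrev endObj (R : M) : V := (Hommed.ihom (V := V) R).obj R

variable (V) in
/-- The composition `E ⊗ E ⟶ E`: the transpose of `(E ⊗ E) ⊙ R ≅ E ⊙ (E ⊙ R) ⟶ E ⊙ R ⟶ R`. -/
def endMul (R : M) : endObj V R ⊗ endObj V R ⟶ endObj V R :=
  curry ((αₗ (endObj V R) (endObj V R) R).hom ≫ endObj V R ⊴ₗ ev V R R ≫ ev V R R)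

variable (V) in
/-- The identity `I ⟶ E`: the transpose of `I ⊙ R ≅ R`. -/
def endOne (R : M) : 𝟙_ V ⟶ endObj V R := curry (λₗ R).hom

lemma endMul_ev (R : M) : endMul V R ⊵ₗ R ≫ ev V R R =
    (αₗ (endObj V R) (endObj V R) R).hom ≫ endObj V R ⊴ₗ ev V R R ≫ ev V R R := curry_ev _

lemma endOne_ev (R : M) : endOne V R ⊵ₗ R ≫ ev V R R = (λₗ R).hom := curry_ev _

lemma endOne_mul (R : M) : endOne V R ▷ endObj V R ≫ endMul V R = (λ_ (endObj V R)).hom := by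
  apply hom_ext_ev
  rw [comp_actionHomLeft, Category.assoc, endMul_ev,
    whiskerRight_actionHomLeft, leftUnitor_actionHom]
  simp only [Category.assoc, Iso.inv_hom_id_assoc, Iso.cancel_iso_hom_left]
  rw [← action_exchange_assoc, endOne_ev]
  simp

lemma endMul_one (R : M) : endObj V R ◁ endOne V R ≫ endMul V R = (ρ_ (endObj V R)).hom := by
  apply hom_ext_ev
  rw [comp_actionHomLeft, Category.assoc, endMul_ev,
    whiskerLeft_actionHomLeft, rightUnitor_actionHom]
  simp only [Category.assoc, Iso.inv_hom_id_assoc, Iso.cancel_iso_hom_left]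
  rw [← actionHomRight_comp_assoc, endOne_ev]

lemma endMul_assoc (R : M) : endMul V R ▷ endObj V R ≫ endMul V R =
    (α_ _ _ _).hom ≫ endObj V R ◁ endMul V R ≫ endMul V R := by
  apply hom_ext_ev
  simp only [comp_actionHomLeft, Category.assoc, endMul_ev]
  rw [whiskerRight_actionHomLeft, whiskerLeft_actionHomLeft]
  simp only [Category.assoc, Iso.inv_hom_id_assoc]
  rw [← action_exchange_assoc, endMul_ev,
    ← actionHomRight_comp_assoc, endMul_ev]
  have := associator_actionHom (endObj V R) (endObj V R) (endObj V R) R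
  simp only [actionHomRight_comp, Category.assoc] 
  rw [reassoc_of% this]
  simp

variable (V) in
/-- The monad `E ⊙ -` on `M` induced by the monoid `E = M(R, R)`. -/
@[simps]
def endMonad (R : M) : Monad M where
  obj A := endObj V R ⊙ₗ A
  map f := endObj V R ⊴ₗ f
  η :=
    { app := fun A => (λₗ A).inv ≫ endOne V R ⊵ₗ A
      naturality := fun A B f => by
        simp [← action_exchange] }
  μ :=
    { app := fun A => (αₗ _ _ A).inv ≫ endMul V R ⊵ₗ A
      naturality := fun A B f => by
        simp [← action_exchange] }
  left_unit A := by
    have := congrArg (fun f => (λₗ _).inv ≫ (αₗ _ _ _).inv ≫ f ⊵ₗ A) (endOne_mul (V := V) R)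
    simpa using this
  right_unit A := by
    have := congrArg (fun f => endObj V R ⊴ₗ (λₗ A).inv ≫ (αₗ _ _ _).inv ≫ f ⊵ₗ A)
      (endMul_one (V := V) R)
    simpa using this
  assoc A := by
    have h₁ := congrArg (fun f => f ⊵ₗ A) (endMul_assoc (V := V) R)
    simp only [comp_actionHomLeft,
      whiskerLeft_actionHomLeft, Category.assoc] at h₁
    have h₃ : (α_ (endObj V R) (endObj V R) (endObj V R)).hom ⊵ₗ A ≫
        (αₗ (endObj V R) (endObj V R ⊗ endObj V R) A).hom =
        (αₗ (endObj V R ⊗ endObj V R) (endObj V R) A).hom ≫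
          (αₗ (endObj V R) (endObj V R) (endObj V R ⊙ₗ A)).hom ≫
            endObj V R ⊴ₗ (αₗ (endObj V R) (endObj V R) A).inv := by
      rw [← cancel_mono (endObj V R ⊴ₗ (αₗ (endObj V R) (endObj V R) A).hom)]
      simp
    rw [reassoc_of% h₃] at h₁
    rw [← cancel_epi (αₗ (endObj V R) (endObj V R) (endObj V R ⊙ₗ A)).hom,
      ← cancel_epi (αₗ (endObj V R ⊗ endObj V R) (endObj V R) A).hom]
    simpa using h₁.symm

variable (V) in
/-- The category `_E M` of `E`-objects in `M`, where `E = M(R, R)`: the algebras of `E ⊙ -`. -/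
abbrev EObj (R : M) : Type max u₁ v₁ := (endMonad V R).Algebra

/-- The action `E ⊙ A ⟶ A` of an `E`-object. -/
def eAct {R : M} (A : EObj V R) : endObj V R ⊙ₗ A.A ⟶ A.A := A.a

lemma one_eAct {R : M} (A : EObj V R) :
    (λₗ A.A).inv ≫ endOne V R ⊵ₗ A.A ≫ eAct A = 𝟙 A.A := by
  rw [← Category.assoc]; exact A.unit

lemma mul_eAct {R : M} (A : EObj V R) :
    (αₗ _ _ A.A).inv ≫ endMul V R ⊵ₗ A.A ≫ eAct A = endObj V R ⊴ₗ eAct A ≫ eAct A := by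
  rw [← Category.assoc]; exact A.assoc

/-- Constructor for `E`-objects. -/
def mkEObj {R : M} (A : M) (a : endObj V R ⊙ₗ A ⟶ A)
    (h₁ : (λₗ A).inv ≫ endOne V R ⊵ₗ A ≫ a = 𝟙 A)
    (h₂ : (αₗ _ _ A).inv ≫ endMul V R ⊵ₗ A ≫ a = endObj V R ⊴ₗ a ≫ a) : EObj V R where
  A := A
  a := a
  unit := by rw [← Category.assoc] at h₁; exact h₁
  assoc := by rw [← Category.assoc] at h₂; exact h₂

variable (V) in
/-- The `E`-object `⟨R, ev_{R,R}⟩`. -/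
def eUnit (R : M) : EObj V R :=
  mkEObj R (ev V R R) (by rw [endOne_ev, Iso.inv_hom_id])
    (by rw [endMul_ev, Iso.inv_hom_id_assoc])

end Enrichment

section MonadStrength

/-- An invertible strength `X ⊙ T A ≅ T (X ⊙ A)` making the monad `T` on the `V`-actegory `M`
a monad in the 2-category of `V`-actegories and strong morphisms. -/
structure MonadStrength (V : Type u) [Category.{v} V] [MonoidalCategory V]
    {M : Type u₁} [Category.{v₁} M] [MonoidalLeftAction V M] (T : Monad M) where
  iso (X : V) (A : M) : X ⊙ₗ T.obj A ≅ T.obj (X ⊙ₗ A)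
  naturality_left {X Y : V} (f : X ⟶ Y) (A : M) :
    f ⊵ₗ T.obj A ≫ (iso Y A).hom = (iso X A).hom ≫ T.map (f ⊵ₗ A)
  naturality_right (X : V) {A B : M} (g : A ⟶ B) :
    X ⊴ₗ T.map g ≫ (iso X B).hom = (iso X A).hom ≫ T.map (X ⊴ₗ g)
  assoc (X Y : V) (A : M) :
    (αₗ X Y (T.obj A)).inv ≫ (iso (X ⊗ Y) A).hom =
      X ⊴ₗ (iso Y A).hom ≫ (iso X (Y ⊙ₗ A)).hom ≫ T.map (αₗ X Y A).inv
  unitor (A : M) : (λₗ (T.obj A)).inv ≫ (iso (𝟙_ V) A).hom = T.map (λₗ A).inv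
  unit (X : V) (A : M) : X ⊴ₗ T.η.app A ≫ (iso X A).hom = T.η.app (X ⊙ₗ A)
  mul (X : V) (A : M) :
    X ⊴ₗ T.μ.app A ≫ (iso X A).hom =
      (iso X (T.obj A)).hom ≫ T.map (iso X A).hom ≫ T.μ.app (X ⊙ₗ A)

variable {V : Type u} [Category.{v} V] [MonoidalCategory V]
  {M : Type u₁} [Category.{v₁} M] [MonoidalLeftAction V M] {T : Monad M}

namespace MonadStrength

variable (σ : MonadStrength V T)

lemma inv_naturality_left {X Y : V} (f : X ⟶ Y) (A : M) :
    T.map (f ⊵ₗ A) ≫ (σ.iso Y A).inv = (σ.iso X A).inv ≫ f ⊵ₗ T.obj A := by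
  rw [Iso.comp_inv_eq, Category.assoc, σ.naturality_left, Iso.inv_hom_id_assoc]

lemma inv_naturality_right (X : V) {A B : M} (g : A ⟶ B) :
    T.map (X ⊴ₗ g) ≫ (σ.iso X B).inv = (σ.iso X A).inv ≫ X ⊴ₗ T.map g := by
  rw [Iso.comp_inv_eq, Category.assoc, σ.naturality_right, Iso.inv_hom_id_assoc]

lemma inv_assoc (X Y : V) (A : M) :
    T.map (αₗ X Y A).hom ≫ (σ.iso X (Y ⊙ₗ A)).inv ≫ X ⊴ₗ (σ.iso Y A).inv =
      (σ.iso (X ⊗ Y) A).inv ≫ (αₗ X Y (T.obj A)).hom := by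
  rw [← cancel_epi (σ.iso (X ⊗ Y) A).hom, ← cancel_epi (αₗ X Y (T.obj A)).inv, reassoc_of% σ.assoc,
    ← T.map_comp_assoc]
  simp

lemma inv_unitor (A : M) :
    (σ.iso (𝟙_ V) A).inv ≫ (λₗ (T.obj A)).hom = T.map (λₗ A).hom := by
  rw [Iso.inv_comp_eq, ← cancel_epi (λₗ (T.obj A)).inv, reassoc_of% σ.unitor, ← T.map_comp]
  simp

/-- The action of `X : V` on a `T`-algebra `⟨A, a⟩` is `X ⊙ A` with algebra structure
`T (X ⊙ A) ≅ X ⊙ T A ⟶ X ⊙ A`. -/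
@[simps]
def actObj (X : V) (A : T.Algebra) : T.Algebra where
  A := X ⊙ₗ A.A
  a := (σ.iso X A.A).inv ≫ X ⊴ₗ A.a
  unit := by
    rw [← σ.unit, Category.assoc, Iso.hom_inv_id_assoc, ← actionHomRight_comp, A.unit]
    exact actionHomRight_id _ _
  assoc := by
    have h' : (T.map (σ.iso X A.A).hom) ≫ T.map (σ.iso X A.A).inv = 𝟙 _ := by
      rw [← T.map_comp, Iso.hom_inv_id, T.map_id]
    rw [← cancel_epi (T.map (σ.iso X A.A).hom), ← cancel_epi (σ.iso X (T.obj A.A)).hom,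
      ← reassoc_of% σ.mul, Iso.hom_inv_id_assoc, ← actionHomRight_comp, A.assoc, T.map_comp,
      Category.assoc, reassoc_of% h', ← reassoc_of% σ.naturality_right, Iso.hom_inv_id_assoc,
      actionHomRight_comp]

/-- The `V`-actegory of algebras of a strong monad. The forgetful functor to `M` is a strict
morphism of actegories. -/
abbrev algebraAction : MonoidalLeftAction V T.Algebra where
  actionObj X A := σ.actObj X A
  actionHomLeft {X Y} f A :=
    { f := f ⊵ₗ A.A
      h := by
        dsimp only [actObj]
        rw [reassoc_of% (σ.inv_naturality_left f A.A), Category.assoc, action_exchange] }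
  actionHomRight X {A B} g :=
    { f := X ⊴ₗ g.f
      h := by
        dsimp only [actObj]
        rw [reassoc_of% (σ.inv_naturality_right X g.f), Category.assoc, ← actionHomRight_comp,
          ← actionHomRight_comp, g.h] }
  actionHom {X Y A B} f g :=
    { f := f ⊙ₗₘ g.f
      h := by
        dsimp only [actObj]
        rw [actionHom_def, T.map_comp, Category.assoc,
          reassoc_of% (σ.inv_naturality_right Y g.f), reassoc_of% (σ.inv_naturality_left f A.A),
          Category.assoc, ← actionHomRight_comp, g.h, actionHomRight_comp,
          action_exchange_assoc] }
  actionAssocIso X Y A := Monad.Algebra.isoMk (αₗ X Y A.A) (by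
    dsimp only [actObj]
    rw [actionHomRight_comp, reassoc_of% (σ.inv_assoc X Y A.A)]
    simp)
  actionUnitIso A := Monad.Algebra.isoMk (λₗ A.A) (by
    dsimp only [actObj]
    rw [← σ.inv_unitor A.A]
    simp)
  actionHom_def f g := Monad.Algebra.Hom.ext (actionHom_def f g.f)
  actionHomRight_id X A := Monad.Algebra.Hom.ext (actionHomRight_id X A.A)
  id_actionHomLeft X A := Monad.Algebra.Hom.ext (id_actionHomLeft X A.A)
  actionHom_comp f₁ f₂ g₁ g₂ := Monad.Algebra.Hom.ext (actionHom_comp f₁ f₂ g₁.f g₂.f)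
  actionAssocIso_hom_naturality f g h :=
    Monad.Algebra.Hom.ext (actionAssocIso_hom_naturality f g h.f)
  actionUnitIso_hom_naturality f := Monad.Algebra.Hom.ext (actionUnitIso_hom_naturality f.f)
  whiskerLeft_actionHomLeft X _ _ f A :=
    Monad.Algebra.Hom.ext (whiskerLeft_actionHomLeft X f A.A)
  whiskerRight_actionHomLeft X f A :=
    Monad.Algebra.Hom.ext (whiskerRight_actionHomLeft X f A.A)
  associator_actionHom X Y Z A := Monad.Algebra.Hom.ext (associator_actionHom X Y Z A.A)
  leftUnitor_actionHom X A := Monad.Algebra.Hom.ext (leftUnitor_actionHom X A.A)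
  rightUnitor_actionHom X A := Monad.Algebra.Hom.ext (rightUnitor_actionHom X A.A)

end MonadStrength

end MonadStrength


section EndStrength

variable {V : Type u} [Category.{v} V] [MonoidalCategory V]
  {M : Type u₁} [Category.{v₁} M] [MonoidalLeftAction V M]

lemma associator_hom_act (X Y Z : V) (A : M) : (α_ X Y Z).hom ⊵ₗ A =
    (αₗ (X ⊗ Y) Z A).hom ≫ (αₗ X Y (Z ⊙ₗ A)).hom ≫ X ⊴ₗ (αₗ Y Z A).inv ≫
      (αₗ X (Y ⊗ Z) A).inv := by
  rw [← associator_actionHom_assoc]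
  simp

lemma associator_inv_act (X Y Z : V) (A : M) : (α_ X Y Z).inv ⊵ₗ A =
    (αₗ X (Y ⊗ Z) A).hom ≫ X ⊴ₗ (αₗ Y Z A).hom ≫ (αₗ X Y (Z ⊙ₗ A)).inv ≫
      (αₗ (X ⊗ Y) Z A).inv := by
  rw [← cancel_epi ((α_ X Y Z).hom ⊵ₗ A), hom_inv_actionHomLeft, associator_hom_act]
  simp

variable [SymmetricCategory V]

/-- The isomorphism `X ⊙ (Y ⊙ A) ≅ Y ⊙ (X ⊙ A)` induced by the symmetry of `V`. -/
@[simps]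
def actSwap (X Y : V) (A : M) : X ⊙ₗ Y ⊙ₗ A ≅ Y ⊙ₗ X ⊙ₗ A where
  hom := (αₗ X Y A).inv ≫ (β_ X Y).hom ⊵ₗ A ≫ (αₗ Y X A).hom
  inv := (αₗ Y X A).inv ≫ (β_ X Y).inv ⊵ₗ A ≫ (αₗ X Y A).hom

lemma actSwap_nat_left {X X' : V} (f : X ⟶ X') (Y : V) (A : M) :
    f ⊵ₗ (Y ⊙ₗ A) ≫ (actSwap X' Y A).hom = (actSwap X Y A).hom ≫ Y ⊴ₗ f ⊵ₗ A := by
  have h := congrArg (fun t => t ⊵ₗ A) (BraidedCategory.braiding_naturality_left f Y)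
  simp only [comp_actionHomLeft, whiskerLeft_actionHomLeft] at h
  simp only [actSwap_hom, actionHomLeft_action, Category.assoc, Iso.hom_inv_id_assoc]
  rw [reassoc_of% h]
  simp

lemma actSwap_nat_mid (X : V) {Y Y' : V} (f : Y ⟶ Y') (A : M) :
    X ⊴ₗ f ⊵ₗ A ≫ (actSwap X Y' A).hom = (actSwap X Y A).hom ≫ f ⊵ₗ (X ⊙ₗ A) := by
  have h := congrArg (fun t => (αₗ _ _ _).inv ≫ t ⊵ₗ A)
    (BraidedCategory.braiding_naturality_right X f)
  simp only [comp_actionHomLeft, whiskerLeft_actionHomLeft, whiskerRight_actionHomLeft,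
    Category.assoc, Iso.inv_hom_id_assoc] at h
  rw [actSwap_hom, reassoc_of% h]
  simp

lemma actSwap_nat_right (X Y : V) {A B : M} (g : A ⟶ B) :
    X ⊴ₗ Y ⊴ₗ g ≫ (actSwap X Y B).hom = (actSwap X Y A).hom ≫ Y ⊴ₗ X ⊴ₗ g := by
  have h := actionAssocIso_inv_naturality (𝟙 X) (𝟙 Y) g
  have h' := action_exchange (β_ X Y).hom g
  simp only [id_actionHom, id_tensorHom_id] at h
  simp only [tensor_actionHomRight, Category.assoc] at h'
  rw [← cancel_epi (αₗ X Y A).hom]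
  simp only [actSwap_hom, Category.assoc, Iso.hom_inv_id_assoc]
  rw [reassoc_of% h']
  simp

lemma actSwap_tensor_left (X Y Z : V) (A : M) :
    (αₗ X Y (Z ⊙ₗ A)).inv ≫ (actSwap (X ⊗ Y) Z A).hom =
      X ⊴ₗ (actSwap Y Z A).hom ≫ (actSwap X Z (Y ⊙ₗ A)).hom ≫ Z ⊴ₗ (αₗ X Y A).inv := by
  have h := congrArg (fun t => t ⊵ₗ A) (BraidedCategory.braiding_tensor_left_hom X Y Z)
  simp only [comp_actionHomLeft, whiskerLeft_actionHomLeft, associator_hom_act,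
    associator_inv_act, Category.assoc] at h
  simp only [actSwap_hom]
  rw [h]
  simp

lemma actSwap_tensor_mid (X Y Z : V) (A : M) :
    X ⊴ₗ (αₗ Y Z A).inv ≫ (actSwap X (Y ⊗ Z) A).hom =
      (actSwap X Y (Z ⊙ₗ A)).hom ≫ Y ⊴ₗ (actSwap X Z A).hom ≫ (αₗ Y Z (X ⊙ₗ A)).inv := by
  have h := congrArg (fun t => t ⊵ₗ A) (BraidedCategory.braiding_tensor_right_hom X Y Z)
  simp only [comp_actionHomLeft, whiskerLeft_actionHomLeft, associator_hom_act,
    associator_inv_act, Category.assoc] at h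
  simp only [actSwap_hom]
  rw [h]
  simp

lemma actSwap_unit_left (Y : V) (A : M) :
    (λₗ (Y ⊙ₗ A)).inv ≫ (actSwap (𝟙_ V) Y A).hom = Y ⊴ₗ (λₗ A).inv := by
  rw [actSwap_hom, braiding_tensorUnit_left, comp_actionHomLeft, leftUnitor_actionHom]
  have h : (ρ_ Y).inv ⊵ₗ A = Y ⊴ₗ (λₗ A).inv ≫ (αₗ Y (𝟙_ V) A).inv := by
    rw [← cancel_epi ((ρ_ Y).hom ⊵ₗ A), hom_inv_actionHomLeft, rightUnitor_actionHom]
    simp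
  rw [h]
  simp

lemma actSwap_unit_mid (X : V) (A : M) :
    X ⊴ₗ (λₗ A).inv ≫ (actSwap X (𝟙_ V) A).hom = (λₗ (X ⊙ₗ A)).inv := by
  rw [actSwap_hom, braiding_tensorUnit_right, comp_actionHomLeft, rightUnitor_actionHom]
  have h : (λ_ X).inv ⊵ₗ A = (λₗ (X ⊙ₗ A)).inv ≫ (αₗ (𝟙_ V) X A).inv := by
    rw [← cancel_epi ((λ_ X).hom ⊵ₗ A), hom_inv_actionHomLeft, leftUnitor_actionHom]
    simp
  rw [h]
  simp

variable (V) in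
/-- The strength of the monad `E ⊙ -`, given by the symmetry of `V`. -/
@[simps]
def endStrength [Hommed V M] (R : M) : MonadStrength V (endMonad V R) where
  iso X A := actSwap X (endObj V R) A
  naturality_left f A := actSwap_nat_left f _ A
  naturality_right X _ _ g := actSwap_nat_right X _ g
  assoc X Y A := actSwap_tensor_left X Y _ A
  unitor A := actSwap_unit_left _ A
  unit X A := by
    have h := actSwap_nat_mid X (endOne V R) A
    change X ⊴ₗ ((λₗ A).inv ≫ endOne V R ⊵ₗ A) ≫ (actSwap X (endObj V R) A).hom =
      (λₗ (X ⊙ₗ A)).inv ≫ endOne V R ⊵ₗ (X ⊙ₗ A)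
    rw [actionHomRight_comp, Category.assoc, h, reassoc_of% (actSwap_unit_mid (V := V) X A)]
  mul X A := by
    have h := actSwap_nat_mid X (endMul V R) A
    change X ⊴ₗ ((αₗ _ _ A).inv ≫ endMul V R ⊵ₗ A) ≫ (actSwap X (endObj V R) A).hom =
      (actSwap X (endObj V R) (endObj V R ⊙ₗ A)).hom ≫
        endObj V R ⊴ₗ (actSwap X (endObj V R) A).hom ≫
          (αₗ _ _ (X ⊙ₗ A)).inv ≫ endMul V R ⊵ₗ (X ⊙ₗ A)
    rw [actionHomRight_comp, Category.assoc, h,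
      reassoc_of% (actSwap_tensor_mid (V := V) X (endObj V R) (endObj V R) A)]

/-- The category `_E M` of `E`-objects as a `V`-actegory. -/
instance [Hommed V M] (R : M) : MonoidalLeftAction V (endMonad V R).Algebra :=
  (endStrength V R).algebraAction

end EndStrength


section SkewMonoidal

lemma epi_map_map_coequalizer {C : Type u₁} [Category.{v₁} C] (F : C ⥤ C)
    [Monad.PreservesColimitOfIsReflexivePair F] {A B : C} (f g : A ⟶ B) [IsReflexivePair f g]
    [HasCoequalizer f g] : Epi (F.map (F.map (coequalizer.π f g))) := by
  have : IsReflexivePair (F.map f) (F.map g) :=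
    IsReflexivePair.mk' (F.map (commonSection f g))
      (by rw [← F.map_comp, section_comp_left, F.map_id])
      (by rw [← F.map_comp, section_comp_right, F.map_id])
  exact epi_of_isColimit_cofork (isColimitCoforkMapOfIsColimit F _
    (isColimitOfHasCoequalizerOfPreservesColimit F f g))

/-- A (right) skew monoidal structure on the `V`-actegory `M`, with skew tensor product
`A, B ↦ t A B` on objects and skew unit `R`. Here `X ⊙ₗ A` is the action of `X : V`, with
associator `(αₗ X Y A).inv : X ⊙ (Y ⊙ A) ≅ (X ⊗ Y) ⊙ A` and unitor `(λₗ A).inv : A ≅ I ⊙ A`. -/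
@[ext]
structure SkewMonoidalActegory (V : Type u) [Category.{v} V] [MonoidalCategory V]
    [SymmetricCategory V] {M : Type u₁} [Category.{v₁} M] [MonoidalLeftAction V M]
    (t : M → M → M) (R : M) where
  /-- the functor `A ⊙ -` on morphisms -/
  wl (A : M) {B B' : M} (g : B ⟶ B') : t A B ⟶ t A B'
  /-- the functor `- ⊙ B` on morphisms -/
  wr {A A' : M} (f : A ⟶ A') (B : M) : t A B ⟶ t A' B
  wl_id (A B : M) : wl A (𝟙 B) = 𝟙 (t A B)
  wl_comp (A : M) {B B' B'' : M} (g : B ⟶ B') (g' : B' ⟶ B'') : wl A (g ≫ g') = wl A g ≫ wl A g'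
  wr_id (A B : M) : wr (𝟙 A) B = 𝟙 (t A B)
  wr_comp {A A' A'' : M} (f : A ⟶ A') (f' : A' ⟶ A'') (B : M) : wr (f ≫ f') B = wr f B ≫ wr f' B
  exchange {A A' B B' : M} (f : A ⟶ A') (g : B ⟶ B') : wl A g ≫ wr f B' = wr f B ≫ wl A' g
  /-- the strength in the first variable -/
  Γ (X : V) (A B : M) : X ⊙ₗ t A B ⟶ t (X ⊙ₗ A) B
  /-- the strength in the second variable -/
  Γ' (X : V) (A B : M) : X ⊙ₗ t A B ⟶ t A (X ⊙ₗ B)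
  /-- the associator -/
  γ (A B C : M) : t A (t B C) ⟶ t (t A B) C
  /-- the left unitor -/
  η (A : M) : A ⟶ t R A
  /-- the right unitor -/
  ε (A : M) : t A R ⟶ A
  Γ_nat₁ {X Y : V} (x : X ⟶ Y) (A B : M) : x ⊵ₗ t A B ≫ Γ Y A B = Γ X A B ≫ wr (x ⊵ₗ A) B
  Γ_nat₂ (X : V) {A A' : M} (f : A ⟶ A') (B : M) : X ⊴ₗ wr f B ≫ Γ X A' B = Γ X A B ≫ wr (X ⊴ₗ f) B
  Γ_nat₃ (X : V) (A : M) {B B' : M} (g : B ⟶ B') :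
    X ⊴ₗ wl A g ≫ Γ X A B' = Γ X A B ≫ wl (X ⊙ₗ A) g
  Γ'_nat₁ {X Y : V} (x : X ⟶ Y) (A B : M) : x ⊵ₗ t A B ≫ Γ' Y A B = Γ' X A B ≫ wl A (x ⊵ₗ B)
  Γ'_nat₂ (X : V) {A A' : M} (f : A ⟶ A') (B : M) :
    X ⊴ₗ wr f B ≫ Γ' X A' B = Γ' X A B ≫ wr f (X ⊙ₗ B)
  Γ'_nat₃ (X : V) (A : M) {B B' : M} (g : B ⟶ B') :
    X ⊴ₗ wl A g ≫ Γ' X A B' = Γ' X A B ≫ wl A (X ⊴ₗ g)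
  γ_nat₁ {A A' : M} (f : A ⟶ A') (B C : M) : wr f (t B C) ≫ γ A' B C = γ A B C ≫ wr (wr f B) C
  γ_nat₂ (A : M) {B B' : M} (f : B ⟶ B') (C : M) :
    wl A (wr f C) ≫ γ A B' C = γ A B C ≫ wr (wl A f) C
  γ_nat₃ (A B : M) {C C' : M} (f : C ⟶ C') : wl A (wl B f) ≫ γ A B C' = γ A B C ≫ wl (t A B) f
  η_nat {A B : M} (f : A ⟶ B) : f ≫ η B = η A ≫ wl R f
  ε_nat {A B : M} (f : A ⟶ B) : wr f R ≫ ε B = ε A ≫ f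
  -- the skew monoidal category axioms
  pentagon (A B C D : M) :
    wl A (γ B C D) ≫ γ A (t B C) D ≫ wr (γ A B C) D = γ A B (t C D) ≫ γ (t A B) C D
  η_γ (A B : M) : η (t A B) ≫ γ R A B = wr (η A) B
  γ_ε (A B : M) : γ A B R ≫ ε (t A B) = wl A (ε B)
  η_γ_ε (A B : M) : wl A (η B) ≫ γ A R B ≫ wr (ε A) B = 𝟙 (t A B)
  η_ε : η R ≫ ε R = 𝟙 R
  -- `Γ` and `Γ'` make the skew tensor product a 2-variable morphism of `V`-actegories
  Γ_assoc (X Y : V) (A B : M) :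
    (αₗ X Y (t A B)).inv ≫ Γ (X ⊗ Y) A B =
      X ⊴ₗ Γ Y A B ≫ Γ X (Y ⊙ₗ A) B ≫ wr (αₗ X Y A).inv B
  Γ_unit (A B : M) : (λₗ (t A B)).inv ≫ Γ (𝟙_ V) A B = wr (λₗ A).inv B
  Γ'_assoc (X Y : V) (A B : M) :
    (αₗ X Y (t A B)).inv ≫ Γ' (X ⊗ Y) A B =
      X ⊴ₗ Γ' Y A B ≫ Γ' X A (Y ⊙ₗ B) ≫ wl A (αₗ X Y B).inv
  Γ'_unit (A B : M) : (λₗ (t A B)).inv ≫ Γ' (𝟙_ V) A B = wl A (λₗ B).inv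
  Γ_Γ' (X Y : V) (A B : M) :
    X ⊴ₗ Γ Y A B ≫ Γ' X (Y ⊙ₗ A) B =
      (αₗ X Y (t A B)).inv ≫ (β_ X Y).hom ⊵ₗ t A B ≫ (αₗ Y X (t A B)).hom ≫
        Y ⊴ₗ Γ' X A B ≫ Γ Y A (X ⊙ₗ B)
  -- `γ`, `η` and `ε` are transformations of actegory morphisms in each variable
  Γ_γ₁ (X : V) (A B C : M) :
    Γ X A (t B C) ≫ γ (X ⊙ₗ A) B C = X ⊴ₗ γ A B C ≫ Γ X (t A B) C ≫ wr (Γ X A B) C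
  Γ_γ₂ (X : V) (A B C : M) :
    Γ' X A (t B C) ≫ wl A (Γ X B C) ≫ γ A (X ⊙ₗ B) C =
      X ⊴ₗ γ A B C ≫ Γ X (t A B) C ≫ wr (Γ' X A B) C
  Γ_γ₃ (X : V) (A B C : M) :
    Γ' X A (t B C) ≫ wl A (Γ' X B C) ≫ γ A B (X ⊙ₗ C) = X ⊴ₗ γ A B C ≫ Γ' X (t A B) C
  η_Γ' (X : V) (A : M) : X ⊴ₗ η A ≫ Γ' X R A = η (X ⊙ₗ A)
  Γ_ε (X : V) (A : M) : Γ X A R ≫ ε (X ⊙ₗ A) = X ⊴ₗ ε A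

namespace SkewMonoidalActegory

variable {V : Type u} [Category.{v} V] [MonoidalCategory V] [SymmetricCategory V]
  {M : Type u₁} [Category.{v₁} M] [MonoidalLeftAction V M]
  {t : M → M → M} {R : M} (S : SkewMonoidalActegory V t R)

/-- The endofunctor `A ⊙ -`. -/
@[simps]
def tensorLeft (A : M) : M ⥤ M where
  obj B := t A B
  map g := S.wl A g
  map_id B := S.wl_id A B
  map_comp g g' := S.wl_comp A g g'

/-- `r2`-exactness of a skew monoidal (tensored) `V`-category. -/
class R2Exact : Prop where
  hasReflexiveCoequalizers : HasReflexiveCoequalizers M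
  act_preserves (X : V) : Monad.PreservesColimitOfIsReflexivePair (actionLeft M X)
  isIso_Γ' (X : V) (A B : M) : IsIso (S.Γ' X A B)
  tensor_preserves (A : M) : Monad.PreservesColimitOfIsReflexivePair (S.tensorLeft A)

/-- `μ_{A,B} : A ⊙ (R ⊙ B) ⟶ A ⊙ B`. -/
def mu (A B : M) : t A (t R B) ⟶ t A B := S.γ A R B ≫ S.wr (S.ε A) B

lemma mu_nat (A : M) {B C : M} (f : B ⟶ C) :
    S.wl A (S.wl R f) ≫ S.mu A C = S.mu A B ≫ S.wl A f := by
  rw [mu, reassoc_of% S.γ_nat₃, S.exchange, mu, Category.assoc]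

lemma wl_η_mu (A B : M) : S.wl A (S.η B) ≫ S.mu A B = 𝟙 _ := S.η_γ_ε A B

lemma η_mu (B : M) : S.η (t R B) ≫ S.mu R B = 𝟙 _ := by
  rw [mu, reassoc_of% S.η_γ, ← S.wr_comp, S.η_ε, S.wr_id]

lemma mu_mu (A B : M) : S.wl A (S.mu R B) ≫ S.mu A B = S.mu A (t R B) ≫ S.mu A B := by
  have h : S.wr (S.wl A (S.ε R)) B ≫ S.wr (S.ε A) B =
      S.wr (S.γ A R R) B ≫ S.wr (S.wr (S.ε A) R) B ≫ S.wr (S.ε A) B := by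
    rw [← S.γ_ε, ← S.wr_comp, ← S.wr_comp, ← S.wr_comp, S.ε_nat, Category.assoc]
  rw [mu, mu, mu, S.wl_comp, Category.assoc, reassoc_of% S.γ_nat₂, h, reassoc_of% S.pentagon,
    Category.assoc, reassoc_of% S.γ_nat₁]

/-- The canonical monad `T = R ⊙ -` of a skew monoidal category. -/
@[simps]
def canonicalMonad : Monad M where
  obj A := t R A
  map f := S.wl R f
  map_id A := S.wl_id R A
  map_comp f g := S.wl_comp R f g
  η := { app := S.η, naturality := fun _ _ f => S.η_nat f }
  μ := { app := S.mu R, naturality := fun _ _ f => S.mu_nat R f }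
  assoc A := S.mu_mu R A
  left_unit A := S.η_mu A
  right_unit A := S.wl_η_mu R A

lemma Γ'_mu (X : V) (A B : M) :
    X ⊴ₗ S.mu A B ≫ S.Γ' X A B = S.Γ' X A (t R B) ≫ S.wl A (S.Γ' X R B) ≫ S.mu A (X ⊙ₗ B) := by
  rw [mu, actionHomRight_comp, Category.assoc, S.Γ'_nat₂, mu, reassoc_of% S.Γ_γ₃]

/-- `Γ'` as an invertible strength of the monad `R ⊙ -`. -/
noncomputable def canonicalStrength [h : S.R2Exact] : MonadStrength V S.canonicalMonad where
  iso X A := @asIso _ _ _ _ (S.Γ' X R A) (h.isIso_Γ' X R A)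
  naturality_left f A := S.Γ'_nat₁ f R A
  naturality_right X _ _ g := S.Γ'_nat₃ X R g
  assoc X Y A := S.Γ'_assoc X Y R A
  unitor A := S.Γ'_unit R A
  unit X A := S.η_Γ' X A
  mul X A := S.Γ'_mu X R A

/-- The category `M^T` of modules over `M`: the Eilenberg-Moore category of `T = R ⊙ -`. -/
abbrev Mod : Type max u₁ v₁ := S.canonicalMonad.Algebra

noncomputable instance [S.R2Exact] : MonoidalLeftAction V S.Mod :=
  S.canonicalStrength.algebraAction

/-- The structure morphism `R ⊙ A ⟶ A` of a `T`-algebra. -/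
def modAct (A : S.Mod) : t R A.A ⟶ A.A := A.a

lemma η_modAct (A : S.Mod) : S.η A.A ≫ S.modAct A = 𝟙 A.A := A.unit

lemma mu_modAct (A : S.Mod) : S.mu R A.A ≫ S.modAct A = S.wl R (S.modAct A) ≫ S.modAct A :=
  A.assoc

/-- Constructor for `T`-algebras. -/
def mkMod (A : M) (a : t R A ⟶ A) (h₁ : S.η A ≫ a = 𝟙 A)
    (h₂ : S.mu R A ≫ a = S.wl R a ≫ a) : S.Mod := { A := A, a := a, unit := h₁, assoc := h₂ }

/-- The `T`-algebra `⟨R, ε_R⟩`. -/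
def modUnit : S.Mod :=
  S.mkMod R (S.ε R) S.η_ε (by rw [mu, Category.assoc, S.ε_nat, reassoc_of% S.γ_ε])

section Horizontal

lemma mu_nat_left {A A' : M} (f : A ⟶ A') (B : M) :
    S.wr f (t R B) ≫ S.mu A' B = S.mu A B ≫ S.wr f B := by
  rw [mu, reassoc_of% S.γ_nat₁, ← S.wr_comp, S.ε_nat, mu, Category.assoc, S.wr_comp]

/-- For a `T`-algebra `⟨A, a⟩` and `N : M`, the `T`-algebra structure
`(a ⊙ N) ∘ γ_{R,A,N}` on `A ⊙ N`. -/
def ractAct (A : S.Mod) (N : M) : t R (t A.A N) ⟶ t A.A N :=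
  S.γ R A.A N ≫ S.wr (S.modAct A) N

lemma η_ractAct (A : S.Mod) (N : M) : S.η (t A.A N) ≫ S.ractAct A N = 𝟙 _ := by
  rw [ractAct, reassoc_of% S.η_γ, ← S.wr_comp, S.η_modAct, S.wr_id]

lemma mu_ractAct (A : S.Mod) (N : M) :
    S.mu R (t A.A N) ≫ S.ractAct A N = S.wl R (S.ractAct A N) ≫ S.ractAct A N := by
  rw [ractAct, S.wl_comp, Category.assoc, reassoc_of% S.γ_nat₂, ← S.wr_comp, ← S.mu_modAct, mu, mu,
    Category.assoc, reassoc_of% S.γ_nat₁, Category.assoc, S.wr_comp, S.wr_comp, reassoc_of% S.pentagon]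

lemma ractAct_nat (A : S.Mod) {N N' : M} (g : N ⟶ N') :
    S.wl R (S.wl A.A g) ≫ S.ractAct A N' = S.ractAct A N ≫ S.wl A.A g := by
  rw [ractAct, ractAct, reassoc_of% S.γ_nat₃, S.exchange, Category.assoc]

lemma ractAct_mu (A : S.Mod) (N : M) :
    S.wl R (S.mu A.A N) ≫ S.ractAct A N = S.ractAct A (t R N) ≫ S.mu A.A N := by
  rw [ractAct, ractAct, mu, S.wl_comp, Category.assoc, reassoc_of% S.γ_nat₂, ← S.γ_ε, S.wr_comp,
    Category.assoc, reassoc_of% S.pentagon, Category.assoc, reassoc_of% S.γ_nat₁, ← S.wr_comp, ← S.wr_comp,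
    S.ε_nat]

instance isReflexivePair_hot (A : M) (B : S.Mod) :
    IsReflexivePair (S.mu A B.A) (S.wl A (S.modAct B)) :=
  IsReflexivePair.mk' (S.wl A (S.η B.A)) (S.wl_η_mu A B.A)
    (by rw [← S.wl_comp, S.η_modAct, S.wl_id])

variable [hS : S.R2Exact]

instance (A : M) (B : S.Mod) : HasCoequalizer (S.mu A B.A) (S.wl A (S.modAct B)) :=
  hS.hasReflexiveCoequalizers.has_coeq _ _

/-- The horizontal tensor product of `A : M` and a `T`-algebra `⟨B, b⟩`: the coequalizer of
`μ_{A,B}, A ⊙ b : A ⊙ T B ⟶ A ⊙ B`. -/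
noncomputable def hotCarrier (A : M) (B : S.Mod) : M :=
  coequalizer (S.mu A B.A) (S.wl A (S.modAct B))

/-- The coequalizer `π_{A,B} : A ⊙ B ⟶ A hot B`. -/
noncomputable def hotπ (A : M) (B : S.Mod) : t A B.A ⟶ S.hotCarrier A B :=
  coequalizer.π (S.mu A B.A) (S.wl A (S.modAct B))

instance (A : M) (B : S.Mod) : Epi (S.hotπ A B) := coequalizer.π_epi

lemma hotπ_condition (A : M) (B : S.Mod) :
    S.mu A B.A ≫ S.hotπ A B = S.wl A (S.modAct B) ≫ S.hotπ A B := coequalizer.condition _ _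

/-- `C ⊙ π_{A,B}` is again a coequalizer. -/
noncomputable def isColimitWlHotπ (C A : M) (B : S.Mod) :
    IsColimit (Cofork.ofπ (f := S.wl C (S.mu A B.A)) (g := S.wl C (S.wl A (S.modAct B)))
      (S.wl C (S.hotπ A B))
      (by rw [← S.wl_comp, ← S.wl_comp, hotπ_condition])) :=
  have := hS.tensor_preserves C
  isColimitOfHasCoequalizerOfPreservesColimit (S.tensorLeft C) (S.mu A B.A)
    (S.wl A (S.modAct B))

instance (C A : M) (B : S.Mod) : Epi (S.wl C (S.hotπ A B)) :=
  epi_of_isColimit_cofork (S.isColimitWlHotπ C A B)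

/-- The `T`-algebra structure of the horizontal tensor product of two `T`-algebras: the unique
`ψ` with `ψ ∘ (R ⊙ π) = π ∘ (a ⊙ B) ∘ γ_{R,A,B}`. -/
noncomputable def hotAct (A B : S.Mod) : t R (S.hotCarrier A.A B) ⟶ S.hotCarrier A.A B :=
  Cofork.IsColimit.desc (S.isColimitWlHotπ R A.A B) (S.ractAct A B.A ≫ S.hotπ A.A B) (by
    rw [← Category.assoc, ractAct_mu, Category.assoc, hotπ_condition, ← Category.assoc,
      ← Category.assoc, ractAct_nat])

lemma hotπ_hotAct (A B : S.Mod) :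
    S.wl R (S.hotπ A.A B) ≫ S.hotAct A B = S.ractAct A B.A ≫ S.hotπ A.A B :=
  Cofork.IsColimit.π_desc' (S.isColimitWlHotπ R A.A B) _ _

/-- The horizontal tensor product of `T`-algebras. -/
noncomputable def hot (A B : S.Mod) : S.Mod :=
  S.mkMod (S.hotCarrier A.A B) (S.hotAct A B)
    (by
      rw [← cancel_epi (S.hotπ A.A B), reassoc_of% S.η_nat, hotπ_hotAct, ← Category.assoc, η_ractAct]
      simp)
    (by
      have : Epi (S.wl R (S.wl R (S.hotπ A.A B))) := by
        have := hS.tensor_preserves R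
        exact epi_map_map_coequalizer (S.tensorLeft R) (S.mu A.A B.A) (S.wl A.A (S.modAct B))
      rw [← cancel_epi (S.wl R (S.wl R (S.hotπ A.A B))), ← Category.assoc, mu_nat,
        Category.assoc, hotπ_hotAct, ← Category.assoc, mu_ractAct, ← reassoc_of% S.wl_comp, hotπ_hotAct,
        S.wl_comp, Category.assoc, Category.assoc, hotπ_hotAct])

end Horizontal

lemma Γ_mu (X : V) (A B : M) :
    X ⊴ₗ S.mu A B ≫ S.Γ X A B = S.Γ X A (t R B) ≫ S.mu (X ⊙ₗ A) B := by
  rw [mu, actionHomRight_comp, Category.assoc, S.Γ_nat₂, ← S.Γ_ε, S.wr_comp, mu, reassoc_of% S.Γ_γ₁]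

section EObjects

variable [Hommed V M]

/-- `σ_B : E ⊙ B ⟶ R ⊙ B`. -/
def sigma (B : M) : endObj V R ⊙ₗ B ⟶ t R B :=
  endObj V R ⊴ₗ S.η B ≫ S.Γ (endObj V R) R B ≫ S.wr (ev V R R) B

/-- The `E^op`-action `ρ` on `A ⊙ B`. -/
def rho (A B : M) : endObj V R ⊙ₗ t A B ⟶ t A B :=
  S.Γ' (endObj V R) A B ≫ S.wl A (S.sigma B) ≫ S.mu A B

/-- The `E`-action `λ₁` on `A ⊙ B` induced by the one on `A`. -/
def lam₁ (A : EObj V R) (B : M) : endObj V R ⊙ₗ t A.A B ⟶ t A.A B :=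
  S.Γ (endObj V R) A.A B ≫ S.wr (eAct A) B

/-- The `E`-action `λ₂` on `A ⊙ B` induced by the one on `B`. -/
def lam₂ (A : M) (B : EObj V R) : endObj V R ⊙ₗ t A B.A ⟶ t A B.A :=
  S.Γ' (endObj V R) A B.A ≫ S.wl A (eAct B)

lemma one_sigma (B : M) : (λₗ B).inv ≫ endOne V R ⊵ₗ B ≫ S.sigma B = S.η B := by
  rw [sigma, ← action_exchange_assoc, actionUnitIso_inv_naturality_assoc, reassoc_of% S.Γ_nat₁,
    reassoc_of% S.Γ_unit, ← S.wr_comp, endOne_ev, ← S.wr_comp, Iso.inv_hom_id, S.wr_id,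
    Category.comp_id]

lemma one_rho (A B : M) : (λₗ _).inv ≫ endOne V R ⊵ₗ t A B ≫ S.rho A B = 𝟙 _ := by
  rw [rho, reassoc_of% S.Γ'_nat₁, reassoc_of% S.Γ'_unit, ← reassoc_of% S.wl_comp, ← reassoc_of% S.wl_comp,
    Category.assoc, one_sigma, S.wl_η_mu]

lemma one_lam₂ (A : M) (B : EObj V R) :
    (λₗ _).inv ≫ endOne V R ⊵ₗ t A B.A ≫ S.lam₂ A B = 𝟙 _ := by
  rw [lam₂, reassoc_of% S.Γ'_nat₁, reassoc_of% S.Γ'_unit, ← S.wl_comp, ← S.wl_comp, one_eAct, S.wl_id]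

lemma one_lam₁ (A : EObj V R) (B : M) :
    (λₗ _).inv ≫ endOne V R ⊵ₗ t A.A B ≫ S.lam₁ A B = 𝟙 _ := by
  rw [lam₁, reassoc_of% S.Γ_nat₁, reassoc_of% S.Γ_unit, ← S.wr_comp, ← S.wr_comp, one_eAct, S.wr_id]

lemma mul_lam₁ (A : EObj V R) (B : M) :
    (αₗ _ _ _).inv ≫ endMul V R ⊵ₗ t A.A B ≫ S.lam₁ A B =
      endObj V R ⊴ₗ S.lam₁ A B ≫ S.lam₁ A B := by
  rw [lam₁, reassoc_of% S.Γ_nat₁, reassoc_of% S.Γ_assoc, ← S.wr_comp, ← S.wr_comp, mul_eAct,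
    actionHomRight_comp, Category.assoc, reassoc_of% S.Γ_nat₂, S.wr_comp]

lemma lam₂_lam₁ (A B : EObj V R) :
    (actSwap _ _ _).hom ≫ endObj V R ⊴ₗ S.lam₂ A.A B ≫ S.lam₁ A B.A =
      endObj V R ⊴ₗ S.lam₁ A B.A ≫ S.lam₂ A.A B := by
  simp only [lam₂, lam₁, actionHomRight_comp, Category.assoc, reassoc_of% S.Γ_nat₃, reassoc_of% S.Γ'_nat₂,
    reassoc_of% S.Γ_Γ', actSwap_hom, S.exchange]

lemma rho_lam₁ (A : EObj V R) (B : M) :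
    (actSwap _ _ _).hom ≫ endObj V R ⊴ₗ S.rho A.A B ≫ S.lam₁ A B =
      endObj V R ⊴ₗ S.lam₁ A B ≫ S.rho A.A B := by
  rw [rho, lam₁, actionHomRight_comp, actionHomRight_comp, actionHomRight_comp]
  simp only [Category.assoc]
  rw [reassoc_of% (S.Γ_mu (endObj V R) A.A B), reassoc_of% S.Γ_nat₃, reassoc_of% S.Γ'_nat₂, reassoc_of% S.Γ_Γ',
    ← S.mu_nat_left, reassoc_of% S.exchange]
  simp only [actSwap_hom, Category.assoc]

instance isReflexivePair_quot (A : M) (B : EObj V R) :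
    IsReflexivePair (S.rho A B.A) (S.lam₂ A B) :=
  IsReflexivePair.mk' ((λₗ _).inv ≫ endOne V R ⊵ₗ t A B.A)
    ((Category.assoc _ _ _).trans (S.one_rho A B.A))
    ((Category.assoc _ _ _).trans (S.one_lam₂ A B))

variable [hS : S.R2Exact]

instance (A : M) (B : EObj V R) : HasCoequalizer (S.rho A B.A) (S.lam₂ A B) :=
  hS.hasReflexiveCoequalizers.has_coeq _ _

/-- The object `A ⊙_q B` for `A : M` and an `E`-object `B`: the coequalizer of
`ρ, λ₂ : E ⊙ (A ⊙ B) ⟶ A ⊙ B`. -/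
noncomputable def quotCarrier (A : M) (B : EObj V R) : M :=
  coequalizer (S.rho A B.A) (S.lam₂ A B)

/-- The coequalizer `q_{A,B} : A ⊙ B ⟶ A ⊙_q B`. -/
noncomputable def quotπ (A : M) (B : EObj V R) : t A B.A ⟶ S.quotCarrier A B :=
  coequalizer.π (S.rho A B.A) (S.lam₂ A B)

instance (A : M) (B : EObj V R) : Epi (S.quotπ A B) := coequalizer.π_epi

lemma quotπ_condition (A : M) (B : EObj V R) :
    S.rho A B.A ≫ S.quotπ A B = S.lam₂ A B ≫ S.quotπ A B := coequalizer.condition _ _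

/-- `X ⊙ q_{A,B}` is again a coequalizer. -/
noncomputable def isColimitActQuotπ (X : V) (A : M) (B : EObj V R) :
    IsColimit (Cofork.ofπ (f := X ⊴ₗ S.rho A B.A) (g := X ⊴ₗ S.lam₂ A B)
      (X ⊴ₗ S.quotπ A B)
      (by rw [← actionHomRight_comp, ← actionHomRight_comp, quotπ_condition])) :=
  have := hS.act_preserves X
  isColimitOfHasCoequalizerOfPreservesColimit (actionLeft M X) (S.rho A B.A) (S.lam₂ A B)

instance (X : V) (A : M) (B : EObj V R) : Epi (X ⊴ₗ S.quotπ A B) :=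
  epi_of_isColimit_cofork (S.isColimitActQuotπ X A B)

/-- The `E`-action on `A ⊙_q B` induced by `λ₁`. -/
noncomputable def quotAct (A B : EObj V R) :
    endObj V R ⊙ₗ S.quotCarrier A.A B ⟶ S.quotCarrier A.A B :=
  Cofork.IsColimit.desc (S.isColimitActQuotπ _ A.A B) (S.lam₁ A B.A ≫ S.quotπ A.A B) (by
    rw [← cancel_epi (actSwap _ _ _).hom, reassoc_of% (S.rho_lam₁ A B.A), quotπ_condition,
      reassoc_of% (S.lam₂_lam₁ A B)])

lemma quotπ_quotAct (A B : EObj V R) :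
    endObj V R ⊴ₗ S.quotπ A.A B ≫ S.quotAct A B = S.lam₁ A B.A ≫ S.quotπ A.A B :=
  Cofork.IsColimit.π_desc' (S.isColimitActQuotπ _ A.A B) _ _

/-- The product `A ⊙_q B` of `E`-objects. -/
noncomputable def quot (A B : EObj V R) : EObj V R :=
  mkEObj (S.quotCarrier A.A B) (S.quotAct A B)
    (by
      rw [← cancel_epi (S.quotπ A.A B), ← actionUnitIso_inv_naturality_assoc,
        action_exchange_assoc, quotπ_quotAct, reassoc_of% (S.one_lam₁ A B.A), Category.comp_id])
    (by
      have : Epi (endObj V R ⊴ₗ endObj V R ⊴ₗ S.quotπ A.A B) := by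
        have := hS.act_preserves (endObj V R)
        exact epi_map_map_coequalizer (actionLeft M (endObj V R)) (S.rho A.A B.A)
          (S.lam₂ A.A B)
      rw [← cancel_epi (endObj V R ⊴ₗ endObj V R ⊴ₗ S.quotπ A.A B)]
      have h : endObj V R ⊴ₗ endObj V R ⊴ₗ S.quotπ A.A B ≫ (αₗ _ _ _).inv ≫ endMul V R ⊵ₗ _ =
          ((αₗ _ _ _).inv ≫ endMul V R ⊵ₗ _) ≫ endObj V R ⊴ₗ S.quotπ A.A B :=
        (endMonad V R).μ.naturality (S.quotπ A.A B)
      rw [Category.assoc] at h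
      rw [reassoc_of% h, quotπ_quotAct, reassoc_of% (S.mul_lam₁ A B.A),
        ← actionHomRight_comp_assoc, quotπ_quotAct, actionHomRight_comp, Category.assoc,
        quotπ_quotAct])

end EObjects

end SkewMonoidalActegory

end SkewMonoidal

section SkewFunctors

variable {V : Type u} [Category.{v} V] [MonoidalCategory V] [SymmetricCategory V]
  {M : Type u₁} [Category.{v₁} M] [MonoidalLeftAction V M] {t : M → M → M} {R : M}
  {M' : Type u₂} [Category.{v₂} M'] [MonoidalLeftAction V M'] {t' : M' → M' → M'} {R' : M'}
  {M'' : Type u₃} [Category.{v₃} M''] [MonoidalLeftAction V M''] {t'' : M'' → M'' → M''} {R'' : M''}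

/-- The data of a skew monoidal `V`-functor: a functor `K`, a strength `X ⊙ K A ⟶ K (X ⊙ A)`,
and constraints `K A ⊙ K B ⟶ K (A ⊙ B)` and `R' ⟶ K R`. -/
structure SkewFunctorData (S : SkewMonoidalActegory V t R) (S' : SkewMonoidalActegory V t' R') where
  functor : M ⥤ M'
  strength (X : V) (A : M) : X ⊙ₗ functor.obj A ⟶ functor.obj (X ⊙ₗ A)
  tens (A B : M) : t' (functor.obj A) (functor.obj B) ⟶ functor.obj (t A B)
  unit : R' ⟶ functor.obj R

namespace SkewFunctorData

variable {S : SkewMonoidalActegory V t R} {S' : SkewMonoidalActegory V t' R'}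
  {S'' : SkewMonoidalActegory V t'' R''}

/-- The axioms of a skew monoidal `V`-functor. -/
structure IsSkewMonoidalVFunctor (K : SkewFunctorData S S') : Prop where
  strength_nat_left {X Y : V} (x : X ⟶ Y) (A : M) :
    x ⊵ₗ K.functor.obj A ≫ K.strength Y A = K.strength X A ≫ K.functor.map (x ⊵ₗ A)
  strength_nat_right (X : V) {A B : M} (f : A ⟶ B) :
    X ⊴ₗ K.functor.map f ≫ K.strength X B = K.strength X A ≫ K.functor.map (X ⊴ₗ f)
  strength_assoc (X Y : V) (A : M) :
    (αₗ X Y (K.functor.obj A)).inv ≫ K.strength (X ⊗ Y) A =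
      X ⊴ₗ K.strength Y A ≫ K.strength X (Y ⊙ₗ A) ≫ K.functor.map (αₗ X Y A).inv
  strength_unit (A : M) :
    (λₗ (K.functor.obj A)).inv ≫ K.strength (𝟙_ V) A = K.functor.map (λₗ A).inv
  tens_nat_left {A A' : M} (f : A ⟶ A') (B : M) :
    S'.wr (K.functor.map f) (K.functor.obj B) ≫ K.tens A' B =
      K.tens A B ≫ K.functor.map (S.wr f B)
  tens_nat_right (A : M) {B B' : M} (g : B ⟶ B') :
    S'.wl (K.functor.obj A) (K.functor.map g) ≫ K.tens A B' =
      K.tens A B ≫ K.functor.map (S.wl A g)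
  tens_assoc (A B C : M) :
    S'.wl (K.functor.obj A) (K.tens B C) ≫ K.tens A (t B C) ≫ K.functor.map (S.γ A B C) =
      S'.γ (K.functor.obj A) (K.functor.obj B) (K.functor.obj C) ≫
        S'.wr (K.tens A B) (K.functor.obj C) ≫ K.tens (t A B) C
  left_unit (A : M) :
    S'.η (K.functor.obj A) ≫ S'.wr K.unit (K.functor.obj A) ≫ K.tens R A =
      K.functor.map (S.η A)
  right_unit (A : M) :
    S'.wl (K.functor.obj A) K.unit ≫ K.tens A R ≫ K.functor.map (S.ε A) =
      S'.ε (K.functor.obj A)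
  -- `V`-naturality of the constraint `tens` in its two variables
  tens_strength_left (X : V) (A B : M) :
    X ⊴ₗ K.tens A B ≫ K.strength X (t A B) ≫ K.functor.map (S.Γ X A B) =
      S'.Γ X (K.functor.obj A) (K.functor.obj B) ≫
        S'.wr (K.strength X A) (K.functor.obj B) ≫ K.tens (X ⊙ₗ A) B
  tens_strength_right (X : V) (A B : M) :
    X ⊴ₗ K.tens A B ≫ K.strength X (t A B) ≫ K.functor.map (S.Γ' X A B) =
      S'.Γ' X (K.functor.obj A) (K.functor.obj B) ≫
        S'.wl (K.functor.obj A) (K.strength X B) ≫ K.tens A (X ⊙ₗ B)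

/-- Strong skew monoidal: the constraints `K A ⊙ K B ⟶ K (A ⊙ B)` and `R' ⟶ K R` are invertible. -/
def IsStrong (K : SkewFunctorData S S') : Prop :=
  (∀ A B, IsIso (K.tens A B)) ∧ IsIso K.unit

/-- The identity skew monoidal `V`-functor. -/
def id (S : SkewMonoidalActegory V t R) : SkewFunctorData S S where
  functor := 𝟭 M
  strength _ _ := 𝟙 _
  tens _ _ := 𝟙 _
  unit := 𝟙 _

/-- The composite `L ∘ K` of skew monoidal `V`-functors. -/
def comp (K : SkewFunctorData S S') (L : SkewFunctorData S' S'') : SkewFunctorData S S'' where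
  functor := K.functor ⋙ L.functor
  strength X A := L.strength X (K.functor.obj A) ≫ L.functor.map (K.strength X A)
  tens A B := L.tens (K.functor.obj A) (K.functor.obj B) ≫ L.functor.map (K.tens A B)
  unit := L.unit ≫ L.functor.map K.unit

/-- Skew monoidal `V`-natural transformations. -/
structure IsSkewMonoidalVNat (K L : SkewFunctorData S S') (ν : K.functor ⟶ L.functor) : Prop where
  strength (X : V) (A : M) : K.strength X A ≫ ν.app (X ⊙ₗ A) = X ⊴ₗ ν.app A ≫ L.strength X A
  tens (A B : M) :
    K.tens A B ≫ ν.app (t A B) =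
      S'.wr (ν.app A) (K.functor.obj B) ≫ S'.wl (L.functor.obj A) (ν.app B) ≫ L.tens A B
  unit : K.unit ≫ ν.app R = L.unit

/-- `K` is an equivalence in the 2-category of skew monoidal `V`-categories, skew monoidal
`V`-functors and skew monoidal `V`-natural transformations. -/
def IsSkewMonoidalVEquivalence (K : SkewFunctorData S S') : Prop :=
  K.IsSkewMonoidalVFunctor ∧ ∃ L : SkewFunctorData S' S, L.IsSkewMonoidalVFunctor ∧
    (∃ e : (K.comp L).functor ≅ (id S).functor,
      IsSkewMonoidalVNat (K.comp L) (id S) e.hom ∧ IsSkewMonoidalVNat (id S) (K.comp L) e.inv) ∧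
    ∃ e : (L.comp K).functor ≅ (id S').functor,
      IsSkewMonoidalVNat (L.comp K) (id S') e.hom ∧ IsSkewMonoidalVNat (id S') (L.comp K) e.inv

/-- `κ_A : R' ⊙ K A ⟶ K (R ⊙ A)`. -/
def kappa (K : SkewFunctorData S S') (A : M) : t' R' (K.functor.obj A) ⟶ K.functor.obj (t R A) :=
  S'.wr K.unit (K.functor.obj A) ≫ K.tens R A

namespace IsSkewMonoidalVFunctor

variable {K : SkewFunctorData S S'}

lemma kappa_nat (hK : K.IsSkewMonoidalVFunctor) {A B : M} (f : A ⟶ B) :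
    S'.wl R' (K.functor.map f) ≫ K.kappa B = K.kappa A ≫ K.functor.map (S.wl R f) := by
  rw [kappa, reassoc_of% S'.exchange, hK.tens_nat_right, kappa, Category.assoc]

lemma mu_kappa (hK : K.IsSkewMonoidalVFunctor) (A : M) :
    S'.mu R' (K.functor.obj A) ≫ K.kappa A =
      S'.wl R' (K.kappa A) ≫ K.kappa (t R A) ≫ K.functor.map (S.mu R A) := by
  have h : S'.wr (S'.wl (K.functor.obj R) K.unit) (K.functor.obj A) ≫
      S'.wr (K.tens R R) (K.functor.obj A) ≫ S'.wr (K.functor.map (S.ε R)) (K.functor.obj A) =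
      S'.wr (S'.ε (K.functor.obj R)) (K.functor.obj A) := by
    rw [← S'.wr_comp, ← S'.wr_comp, hK.right_unit]
  simp only [kappa, SkewMonoidalActegory.mu, S'.wl_comp, Category.assoc, K.functor.map_comp]
  rw [reassoc_of% S'.exchange, reassoc_of% S'.exchange, reassoc_of% hK.tens_assoc, ← hK.tens_nat_left,
    reassoc_of% S'.γ_nat₂, reassoc_of% h, reassoc_of% S'.γ_nat₁, ← reassoc_of% S'.wr_comp, ← reassoc_of% S'.wr_comp, S'.ε_nat]


end IsSkewMonoidalVFunctor

/-- The lift of a skew monoidal `V`-functor `K` to the categories of modules, as a functor: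
`⟨A, a⟩ ↦ ⟨K A, K a ∘ κ_A⟩`. -/
@[simps obj map_f]
def lift (K : SkewFunctorData S S') (hK : K.IsSkewMonoidalVFunctor) : S.Mod ⥤ S'.Mod where
  obj A := S'.mkMod (K.functor.obj A.A) (K.kappa A.A ≫ K.functor.map (S.modAct A))
    (by
      rw [kappa, Category.assoc, reassoc_of% hK.left_unit, ← K.functor.map_comp, S.η_modAct,
        K.functor.map_id])
    (by
      rw [reassoc_of% (hK.mu_kappa A.A), ← K.functor.map_comp, S.mu_modAct, S'.wl_comp,
        Category.assoc, reassoc_of% (hK.kappa_nat (S.modAct A)), K.functor.map_comp])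
  map {A B} f :=
    { f := K.functor.map f.f
      h := by
        have h : S.wl R f.f ≫ S.modAct B = S.modAct A ≫ f.f := f.h
        change S'.wl R' (K.functor.map f.f) ≫ K.kappa B.A ≫ K.functor.map (S.modAct B) =
          (K.kappa A.A ≫ K.functor.map (S.modAct A)) ≫ K.functor.map f.f
        rw [reassoc_of% (hK.kappa_nat f.f), ← K.functor.map_comp, h, K.functor.map_comp,
          Category.assoc] }

end SkewFunctorData

namespace SkewMonoidalActegory

variable (S : SkewMonoidalActegory V t R) [S.R2Exact]

/-- The forgetful functor `G : M^T ⥤ M` with identity strength, the coequalizers `π` as tensor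
constraint, and identity unit constraint, for a skew monoidal structure `Sh` on the `V`-actegory
`M^T` with the horizontal tensor product and unit `⟨R, ε_R⟩`. -/
noncomputable def hotForget (Sh : SkewMonoidalActegory V S.hot S.modUnit) :
    SkewFunctorData Sh S where
  functor := S.canonicalMonad.forget
  strength X A := 𝟙 (X ⊙ₗ A.A)
  tens A B := S.hotπ A.A B
  unit := 𝟙 R

/-- The forgetful functor `φ : _E M ⥤ M` with identity strength, the coequalizers `q` as tensor
constraint, and identity unit constraint, for a skew monoidal structure `Sq` on the `V`-actegory
`_E M` with product `⊙_q` and unit `⟨R, ev⟩`. -/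
noncomputable def quotForget [Hommed V M] (Sq : SkewMonoidalActegory V S.quot (eUnit V R)) :
    SkewFunctorData Sq S where
  functor := (endMonad V R).forget
  strength X A := 𝟙 (X ⊙ₗ A.A)
  tens A B := S.quotπ A.A B
  unit := 𝟙 R

end SkewMonoidalActegory

end SkewFunctors

end SkewActegory

open SkewActegory

/-! The skew structures of parts 1 and 2 come from one construction. Let `P` be a monad on `M` with
an invertible strength, a map `θ : P (A ⊙ B) ⟶ P A ⊙ B`, and a map `σ : P ⟶ R ⊙ -` compatible with
`θ`, `γ` and `Γ'`, such that `R` carries the algebra structure `ε_R ∘ σ_R`. For `P`-algebras, `A ⊙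
B` modulo `μ ∘ (A ⊙ σ_B) = A ⊙ b` is a reflexive coequalizer `p_{A,B}`. The operations `γ`, `Γ`,
`Γ'`, `ε` of `M` respect these relations and descend, while `η` is composed with `p`. The maps `p`
stay epi under `A ⊙ -`, `X ⊙ -` and `P`, so every axiom for algebras reduces to the same axiom in
`M`. `AlgebraTensor` holds the data and `AlgebraTensor.skew` is the result. For the canonical monad
`T`, `θ` is `γ_{R,-,-}` and `σ` is the identity. For `E ⊗ -`, `θ` is `Γ_E` and `σ` is `sigma`.

That the forgetful functor is skew monoidal amounts to the equations by which the descended maps are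
characterized, whence uniqueness (`eq_skew`). Reflexive coequalizers of algebras are computed in `M`
because `P` preserves them, whence r2-exactness (`r2Exact_skew`). Algebras are tensored because
their hom object is an equalizer in `V` (`algebraHommed`).

For part 3, `sigma` is a morphism of monads from `E ⊗ -` to `T`. A `T`-algebra therefore has an
underlying `E`-object, and its `R`-action factors through `⊙_q` (`exists_modEObj_act`). Conversely
the `E`-action of a `T_q`-algebra is forced by its `R`-action (`eAct_eq`). So the lift of `φ` is
fully faithful and essentially surjective.

Its tensor constraint is obtained by descent. It is skew monoidal because its composite with `G` is,
and `G` can be cancelled (`of_comp`). The constraint is invertible because the relations for the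
horizontal product already imply those for `⊙_q`, so dividing in two steps gives the same quotient
as dividing at once (`IsReflCoeq.isIso_of_comp`). Finally, a strong functor with invertible strength
that is an equivalence of categories has a skew monoidal pseudo-inverse
(`isSkewMonoidalVEquivalence`). -/

namespace SkewActegory

/-! ### Reflexive coequalizers as a proposition: existence of factorizations plus epi. -/

section ReflexiveCoequalizers

variable {C : Type u₁} [Category.{v₁} C] {D : Type u₁} [Category.{v₁} D]

/-- `p` is the coequalizer of the reflexive pair `f, g`. -/
structure IsReflCoeq {A B Q : C} (f g : A ⟶ B) (p : B ⟶ Q) : Prop where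
  refl : IsReflexivePair f g
  w : f ≫ p = g ≫ p
  exists_desc {W : C} (h : B ⟶ W) : f ≫ h = g ≫ h → ∃ k, p ≫ k = h
  epi : Epi p

namespace IsReflCoeq

lemma of_isColimit {A B Q : C} {f g : A ⟶ B} [IsReflexivePair f g] {p : B ⟶ Q}
    {w : f ≫ p = g ≫ p} (h : IsColimit (Cofork.ofπ p w)) : IsReflCoeq f g p where
  refl := inferInstance
  w := w
  exists_desc k hk := ⟨Cofork.IsColimit.desc h k hk, Cofork.IsColimit.π_desc' h k hk⟩
  epi := epi_of_isColimit_cofork h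

lemma of_coequalizer {A B : C} (f g : A ⟶ B) [IsReflexivePair f g] [HasCoequalizer f g] :
    IsReflCoeq f g (coequalizer.π f g) :=
  of_isColimit (coequalizerIsCoequalizer f g)

/-- The colimit cofork of a reflexive coequalizer. -/
noncomputable def isColimit {A B Q : C} {f g : A ⟶ B} {p : B ⟶ Q} (h : IsReflCoeq f g p) :
    IsColimit (Cofork.ofπ p h.w) :=
  have := h.epi
  Cofork.IsColimit.mk _ (fun s => (h.exists_desc s.π s.condition).choose)
    (fun s => (h.exists_desc s.π s.condition).choose_spec)
    (fun s m hm => by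
      rw [← cancel_epi p]
      exact hm.trans (h.exists_desc s.π s.condition).choose_spec.symm)

lemma isReflexivePair_map {D : Type u₂} [Category.{v₂} D] (F : C ⥤ D) {A B : C} {f g : A ⟶ B}
    (h : IsReflexivePair f g) :
    IsReflexivePair (F.map f) (F.map g) :=
  IsReflexivePair.mk' (F.map (commonSection f g))
    (by rw [← F.map_comp, section_comp_left, F.map_id])
    (by rw [← F.map_comp, section_comp_right, F.map_id])

lemma map (F : C ⥤ D) [Monad.PreservesColimitOfIsReflexivePair F] {A B Q : C} {f g : A ⟶ B}
    {p : B ⟶ Q} (h : IsReflCoeq f g p) : IsReflCoeq (F.map f) (F.map g) (F.map p) := by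
  have := h.refl
  have := isReflexivePair_map F h.refl
  exact of_isColimit (isColimitCoforkMapOfIsColimit F _ h.isColimit)

/-- Coequalizers are unique up to isomorphism, so testing one conveniently chosen coequalizer of
each pair is enough. -/
lemma preserves (F : C ⥤ D) (hF : ∀ ⦃A B : C⦄ (f g : A ⟶ B) [IsReflexivePair f g],
    ∃ (Q : C) (p : B ⟶ Q), IsReflCoeq f g p ∧ IsReflCoeq (F.map f) (F.map g) (F.map p)) :
    Monad.PreservesColimitOfIsReflexivePair F where
  out A B f g _ := by
    obtain ⟨Q, p, h, h'⟩ := hF f g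
    exact preservesColimit_of_preserves_colimit_cocone h.isColimit
      ((isColimitMapCoconeCoforkEquiv F h.w).symm h'.isColimit)

lemma congr {A B Q : C} {f g f' g' : A ⟶ B} {p : B ⟶ Q} (h : IsReflCoeq f g p) (hf : f' = f)
    (hg : g' = g) : IsReflCoeq f' g' p := by
  subst hf hg
  exact h

lemma exists_iso {A B Q Q' : C} {f g : A ⟶ B} {p : B ⟶ Q} {p' : B ⟶ Q'} (h : IsReflCoeq f g p)
    (h' : IsReflCoeq f g p') : ∃ e : Q ≅ Q', p ≫ e.hom = p' := by
  have := h.epi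
  have := h'.epi
  obtain ⟨k, hk⟩ := h.exists_desc p' h'.w
  obtain ⟨k', hk'⟩ := h'.exists_desc p h.w
  refine ⟨⟨k, k', ?_, ?_⟩, hk⟩
  · rw [← cancel_epi p, reassoc_of% hk, hk', Category.comp_id]
  · rw [← cancel_epi p', reassoc_of% hk', hk, Category.comp_id]

lemma comp_iso {A B Q Q' : C} {f g : A ⟶ B} {p : B ⟶ Q} (h : IsReflCoeq f g p) (e : Q ≅ Q') :
    IsReflCoeq f g (p ≫ e.hom) where
  refl := h.refl
  w := by rw [reassoc_of% h.w]
  exists_desc k hk := by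
    obtain ⟨l, hl⟩ := h.exists_desc k hk
    exact ⟨e.inv ≫ l, by simpa using hl⟩
  epi := have := h.epi; epi_comp _ _

/-- Lets the domain of the pair be changed. In `quotTensor` it moves the pair from `E ⊗ (A ⊙ B)` to
`A ⊙ (E ⊗ B)` along the inverse of `Γ'`. -/
lemma iso_comp {A A' B Q : C} {f g : A ⟶ B} {p : B ⟶ Q} (h : IsReflCoeq f g p) (e : A' ≅ A) :
    IsReflCoeq (e.hom ≫ f) (e.hom ≫ g) p where
  refl := have := h.refl
    IsReflexivePair.mk' (commonSection f g ≫ e.inv) (by simp) (by simp)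
  w := by rw [Category.assoc, h.w, Category.assoc]
  exists_desc k hk := h.exists_desc k (by simpa using hk)
  epi := h.epi

end IsReflCoeq

end ReflexiveCoequalizers

/-! ### Reflexive coequalizers of algebras over a monad preserving them. -/

section AlgebraCoequalizers

variable {C : Type u₁} [Category.{v₁} C] {T : Monad C}

/-- An algebra morphism that factors through an algebra morphism `p` in the base category factors
through `p` as an algebra morphism, if `T p` is epi. -/
lemma exists_algebra_desc {Y Z W : T.Algebra} (p : Y ⟶ Z) [Epi (T.map p.f)] (h : Y ⟶ W)
    (hk : ∃ k, p.f ≫ k = h.f) : ∃ k : Z ⟶ W, p.f ≫ k.f = h.f := by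
  obtain ⟨k, hk⟩ := hk
  refine ⟨⟨k, ?_⟩, hk⟩
  rw [← cancel_epi (T.map p.f), ← T.map_comp_assoc, hk, h.h, ← hk, p.h_assoc]

/-- A factorization found in the base is automatically an algebra morphism, since `T p` can be
cancelled. -/
lemma IsReflCoeq.of_forget {A B Q : T.Algebra} {f g : A ⟶ B} {p : B ⟶ Q} [Epi (T.map p.f)]
    (h : IsReflCoeq f.f g.f p.f) (hr : IsReflexivePair f g) : IsReflCoeq f g p where
  refl := hr
  w := Monad.Algebra.Hom.ext h.w
  exists_desc k hk := by
    obtain ⟨l, hl⟩ := exists_algebra_desc p k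
      (h.exists_desc k.f (congrArg Monad.Algebra.Hom.f hk))
    exact ⟨l, Monad.Algebra.Hom.ext hl⟩
  epi := ⟨fun a b hab => by
    have := h.epi
    exact Monad.Algebra.Hom.ext ((cancel_epi p.f).1 (congrArg Monad.Algebra.Hom.f hab))⟩

variable [HasReflexiveCoequalizers C] [Monad.PreservesColimitOfIsReflexivePair T.toFunctor]

/-- `T` and `T ∘ T` preserve the coequalizer `q` taken in the base. The structure map of `B`
descends along `T q`, and the unit and associativity laws follow by cancelling `q` and `T (T q)`. -/
lemma exists_algebra_coequalizer {A B : T.Algebra} (f g : A ⟶ B) [hr : IsReflexivePair f g] :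
    ∃ (Q : T.Algebra) (p : B ⟶ Q), IsReflCoeq f.f g.f p.f := by
  have : IsReflexivePair f.f g.f := IsReflCoeq.isReflexivePair_map T.forget hr
  have h := IsReflCoeq.of_coequalizer f.f g.f
  have h₁ := h.map T.toFunctor
  have h₂ := h₁.map T.toFunctor
  have := h.epi
  have := h₁.epi
  have := h₂.epi
  set q := coequalizer.π f.f g.f
  obtain ⟨a, ha⟩ := h₁.exists_desc (B.a ≫ q) (by rw [f.h_assoc, g.h_assoc, h.w])
  exact ⟨⟨_, a, by
      rw [← cancel_epi q, T.unit_naturality_assoc, ha, B.unit_assoc, Category.comp_id], by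
      rw [← cancel_epi (T.map (T.map q)), T.mu_naturality_assoc, ha, B.assoc_assoc,
        ← T.map_comp_assoc, ha, T.map_comp_assoc, ha]⟩, ⟨q, ha⟩, h⟩

/-- Any coequalizer of algebras is isomorphic to the one built over a coequalizer in the base. -/
lemma IsReflCoeq.forget {A B Q : T.Algebra} {f g : A ⟶ B} {p : B ⟶ Q} (h : IsReflCoeq f g p) :
    IsReflCoeq f.f g.f p.f := by
  have := h.refl
  obtain ⟨Q', p', h'⟩ := exists_algebra_coequalizer f g
  have := (h'.map T.toFunctor).epi
  obtain ⟨e, he⟩ := (h'.of_forget h.refl).exists_iso h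
  rw [← he]
  exact h'.comp_iso (T.forget.mapIso e)

lemma hasReflexiveCoequalizers_algebra : HasReflexiveCoequalizers T.Algebra where
  has_coeq A B f g _ := by
    obtain ⟨Q, p, h⟩ := exists_algebra_coequalizer f g
    have := (h.map T.toFunctor).epi
    exact ⟨_, (h.of_forget inferInstance).isColimit⟩

end AlgebraCoequalizers

end SkewActegory

/-! ### Data on a monad that make its algebras skew monoidal. -/

namespace SkewActegory

variable {V : Type u} [Category.{v} V] [MonoidalCategory V] [SymmetricCategory V]
  {M : Type u₁} [Category.{v₁} M] [MonoidalLeftAction V M] {t : M → M → M} {R : M}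

namespace SkewMonoidalActegory

variable (S : SkewMonoidalActegory V t R)

/-- The pentagon with `R` in second place, followed by `ε_A`. -/
lemma mu_γ (A B C : M) :
    S.mu A (t B C) ≫ S.γ A B C = S.wl A (S.γ R B C) ≫ S.γ A (t R B) C ≫ S.wr (S.mu A B) C := by
  rw [mu, mu, Category.assoc, S.γ_nat₁, S.wr_comp, reassoc_of% S.pentagon]

/-- The pentagon with `R` in third place, after `A ⊙ ε_B` is rewritten as `ε_{A ⊙ B} ∘ γ`. -/
lemma wl_mu_γ (A B C : M) :
    S.wl A (S.mu B C) ≫ S.γ A B C = S.γ A B (t R C) ≫ S.mu (t A B) C := by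
  rw [mu, mu, S.wl_comp, Category.assoc, S.γ_nat₂, ← S.γ_ε, S.wr_comp, reassoc_of% S.pentagon]

lemma mu_ε (A : M) : S.mu A R ≫ S.ε A = S.wl A (S.ε R) ≫ S.ε A := by
  rw [mu, Category.assoc, S.ε_nat, reassoc_of% S.γ_ε]

/-- A monad `P` on a skew monoidal `V`-category together with the data that make its category of
algebras skew monoidal: an invertible strength, a strength `θ` over the skew tensor product, a
compatible transformation `σ` to the canonical monad, an algebra structure on the skew unit, and,
for algebras `⟨A, a⟩` and `⟨B, b⟩`, an algebra structure on the coequalizer `p_{A,B}` of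
`μ_{A,B} ∘ (A ⊙ σ_B)` and `A ⊙ b`. -/
structure AlgebraTensor (P : Monad M) where
  str : MonadStrength V P
  θ (A B : M) : P.obj (t A B) ⟶ t (P.obj A) B
  θ_nat₁ {A A' : M} (f : A ⟶ A') (B : M) :
    P.map (S.wr f B) ≫ θ A' B = θ A B ≫ S.wr (P.map f) B
  θ_nat₂ (A : M) {B B' : M} (g : B ⟶ B') :
    P.map (S.wl A g) ≫ θ A B' = θ A B ≫ S.wl (P.obj A) g
  unit_θ (A B : M) : P.η.app (t A B) ≫ θ A B = S.wr (P.η.app A) B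
  mul_θ (A B : M) :
    P.μ.app (t A B) ≫ θ A B = P.map (θ A B) ≫ θ (P.obj A) B ≫ S.wr (P.μ.app A) B
  θ_γ (A B C : M) :
    θ A (t B C) ≫ S.γ (P.obj A) B C = P.map (S.γ A B C) ≫ θ (t A B) C ≫ S.wr (θ A B) C
  θ_ε (A : M) : θ A R ≫ S.ε (P.obj A) = P.map (S.ε A)
  θ_Γ (X : V) (A B : M) :
    X ⊴ₗ θ A B ≫ S.Γ X (P.obj A) B ≫ S.wr (str.iso X A).hom B =
      (str.iso X (t A B)).hom ≫ P.map (S.Γ X A B) ≫ θ (X ⊙ₗ A) B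
  θ_Γ' (X : V) (A B : M) :
    X ⊴ₗ θ A B ≫ S.Γ' X (P.obj A) B =
      (str.iso X (t A B)).hom ≫ P.map (S.Γ' X A B) ≫ θ A (X ⊙ₗ B)
  σ (A : M) : P.obj A ⟶ t R A
  σ_nat {A B : M} (f : A ⟶ B) : P.map f ≫ σ B = σ A ≫ S.wl R f
  σ_γ (A B : M) : σ (t A B) ≫ S.γ R A B = θ A B ≫ S.wr (σ A) B
  σ_Γ' (X : V) (A : M) : X ⊴ₗ σ A ≫ S.Γ' X R A = (str.iso X A).hom ≫ σ (X ⊙ₗ A)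
  unitAct : P.obj R ⟶ R
  unit_unitAct : P.η.app R ≫ unitAct = 𝟙 R
  mul_unitAct : P.μ.app R ≫ unitAct = P.map unitAct ≫ unitAct
  unitAct_eq : unitAct = σ R ≫ S.ε R
  tens (A B : P.Algebra) : P.Algebra
  p (A B : P.Algebra) : t A.A B.A ⟶ (tens A B).A
  p_act (A B : P.Algebra) : P.map (p A B) ≫ (tens A B).a = (θ A.A B.A ≫ S.wr A.a B.A) ≫ p A B
  p_coeq (A B : P.Algebra) : IsReflCoeq (S.wl A.A (σ B.A) ≫ S.mu A.A B.A) (S.wl A.A B.a) (p A B)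

namespace AlgebraTensor

variable {S} {P : Monad M} (D : S.AlgebraTensor P)

/-- The map `μ_{A,N} ∘ (A ⊙ σ_N) : A ⊙ P N ⟶ A ⊙ N`. -/
def dot (A N : M) : t A (P.obj N) ⟶ t A N := S.wl A (D.σ N) ≫ S.mu A N

lemma dot_nat_left {A A' : M} (f : A ⟶ A') (N : M) :
    S.wr f (P.obj N) ≫ D.dot A' N = D.dot A N ≫ S.wr f N := by
  rw [dot, ← reassoc_of% S.exchange, S.mu_nat_left, dot, Category.assoc]

lemma dot_nat_right (A : M) {N N' : M} (g : N ⟶ N') :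
    S.wl A (P.map g) ≫ D.dot A N' = D.dot A N ≫ S.wl A g := by
  rw [dot, ← reassoc_of% S.wl_comp, D.σ_nat, S.wl_comp, Category.assoc, S.mu_nat, dot,
    Category.assoc]

lemma Γ_dot (X : V) (A N : M) :
    X ⊴ₗ D.dot A N ≫ S.Γ X A N = S.Γ X A (P.obj N) ≫ D.dot (X ⊙ₗ A) N := by
  rw [dot, actionHomRight_comp, Category.assoc, S.Γ_mu, reassoc_of% S.Γ_nat₃, dot]

/-- The strength of `P` appears because `P` must be moved past `X` in the second variable. It later
cancels against its inverse in the structure map of `X ⊙ B`. -/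
lemma Γ'_dot (X : V) (A N : M) :
    X ⊴ₗ D.dot A N ≫ S.Γ' X A N =
      S.Γ' X A (P.obj N) ≫ S.wl A (D.str.iso X N).hom ≫ D.dot A (X ⊙ₗ N) := by
  rw [dot, actionHomRight_comp, Category.assoc, S.Γ'_mu, reassoc_of% S.Γ'_nat₃,
    ← reassoc_of% S.wl_comp, D.σ_Γ', S.wl_comp, Category.assoc, dot]

/-- With `dot_γ`, this is why `γ` descends: here the relation between `B` and `C` is carried to the
one between `A ⊙ B` and `C`. -/
lemma wl_dot_γ (A B C : M) :
    S.wl A (D.dot B C) ≫ S.γ A B C = S.γ A B (P.obj C) ≫ D.dot (t A B) C := by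
  rw [dot, S.wl_comp, Category.assoc, S.wl_mu_γ, reassoc_of% S.γ_nat₃, dot]

/-- The relation between `A` and `B ⊙ C` becomes the one between `A` and `B`, because `P` acts on `B
⊙ C` through `B` by means of `θ`. -/
lemma dot_γ (A B C : M) :
    D.dot A (t B C) ≫ S.γ A B C =
      S.wl A (D.θ B C) ≫ S.γ A (P.obj B) C ≫ S.wr (D.dot A B) C := by
  rw [dot, Category.assoc, S.mu_γ, ← reassoc_of% S.wl_comp, D.σ_γ, S.wl_comp, Category.assoc,
    reassoc_of% S.γ_nat₂, ← S.wr_comp, dot]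

/-- Uses that the structure map of `R` is `ε_R ∘ σ_R`. It is what allows `ε_A` to factor through
`p_{A,R}`. -/
lemma dot_ε (A : M) : D.dot A R ≫ S.ε A = S.wl A D.unitAct ≫ S.ε A := by
  rw [dot, Category.assoc, S.mu_ε, ← reassoc_of% S.wl_comp, ← D.unitAct_eq]

lemma p_condition (A B : P.Algebra) : D.dot A.A B.A ≫ D.p A B = S.wl A.A B.a ≫ D.p A B :=
  (D.p_coeq A B).w

/-- The action of `V` on algebras, as a reducible definition. -/
@[reducible]
def act (X : V) (A : P.Algebra) : P.Algebra where
  A := X ⊙ₗ A.A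
  a := (D.str.iso X A.A).inv ≫ X ⊴ₗ A.a
  unit := (D.str.actObj X A).unit
  assoc := (D.str.actObj X A).assoc

/-- The algebra structure on `A ⊙ N` for an algebra `A` and `N : M`. -/
@[reducible]
def ract (A : P.Algebra) (N : M) : P.Algebra where
  A := t A.A N
  a := D.θ A.A N ≫ S.wr A.a N
  unit := by rw [reassoc_of% D.unit_θ, ← S.wr_comp, A.unit, S.wr_id]
  assoc := by
    rw [reassoc_of% D.mul_θ, ← S.wr_comp, A.assoc, P.map_comp, Category.assoc,
      reassoc_of% D.θ_nat₁, S.wr_comp]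

/-- `p_{A,B}` as a morphism of algebras. -/
def pHom (A B : P.Algebra) : D.ract A B.A ⟶ D.tens A B where
  f := D.p A B
  h := D.p_act A B

/-- `f ⊙ N` as a morphism of algebras. -/
def ractLeft {A A' : P.Algebra} (f : A ⟶ A') (N : M) : D.ract A N ⟶ D.ract A' N where
  f := S.wr f.f N
  h := by
    dsimp only [ract]
    rw [reassoc_of% D.θ_nat₁, ← S.wr_comp, f.h, S.wr_comp, Category.assoc]

/-- `A ⊙ g` as a morphism of algebras. -/
def ractRight (A : P.Algebra) {N N' : M} (g : N ⟶ N') : D.ract A N ⟶ D.ract A N' where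
  f := S.wl A.A g
  h := by
    dsimp only [ract]
    rw [reassoc_of% D.θ_nat₂, S.exchange, Category.assoc]

/-- The strength `Γ` as a morphism of algebras. -/
def ractΓ (X : V) (A : P.Algebra) (N : M) :
    D.act X (D.ract A N) ⟶ D.ract (D.act X A) N where
  f := S.Γ X A.A N
  h := by
    dsimp only [ract, act]
    rw [← cancel_epi (D.str.iso X (t A.A N)).hom, ← reassoc_of% D.θ_Γ, Category.assoc,
      Iso.hom_inv_id_assoc, ← S.wr_comp, Iso.hom_inv_id_assoc, actionHomRight_comp, Category.assoc,
      S.Γ_nat₂]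

/-- The strength `Γ'` as a morphism of algebras. -/
def ractΓ' (X : V) (A : P.Algebra) (N : M) :
    D.act X (D.ract A N) ⟶ D.ract A (X ⊙ₗ N) where
  f := S.Γ' X A.A N
  h := by
    dsimp only [ract, act]
    rw [← cancel_epi (D.str.iso X (t A.A N)).hom, ← reassoc_of% D.θ_Γ', Category.assoc,
      Iso.hom_inv_id_assoc, actionHomRight_comp, Category.assoc, S.Γ'_nat₂]

/-- The associator `γ` as a morphism of algebras. -/
def ractγ (A : P.Algebra) (N N' : M) : D.ract A (t N N') ⟶ D.ract (D.ract A N) N' where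
  f := S.γ A.A N N'
  h := by
    dsimp only [ract]
    rw [S.wr_comp, ← reassoc_of% D.θ_γ, Category.assoc, S.γ_nat₁]

/-- The skew unit as an algebra. -/
@[reducible]
def unitObj : P.Algebra where
  A := R
  a := D.unitAct
  unit := D.unit_unitAct
  assoc := D.mul_unitAct

/-- The right unitor `ε` as a morphism of algebras. -/
def ractε (A : P.Algebra) : D.ract A R ⟶ A where
  f := S.ε A.A
  h := by
    dsimp only [ract]
    rw [← D.θ_ε, Category.assoc, Category.assoc, S.ε_nat]

end AlgebraTensor

end SkewMonoidalActegory

end SkewActegory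

/-! ### Descent of the skew monoidal operations along the coequalizers `p`. -/

namespace SkewActegory

variable {V : Type u} [Category.{v} V] [MonoidalCategory V] [SymmetricCategory V]
  {M : Type u₁} [Category.{v₁} M] [MonoidalLeftAction V M] {t : M → M → M} {R : M}

namespace SkewMonoidalActegory

variable {S : SkewMonoidalActegory V t R}

lemma R2Exact.wl_coeq (hS : S.R2Exact) (C : M) {A B Q : M} {f g : A ⟶ B}
    {p : B ⟶ Q} (h : IsReflCoeq f g p) : IsReflCoeq (S.wl C f) (S.wl C g) (S.wl C p) :=
  have := hS.tensor_preserves C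
  h.map (S.tensorLeft C)

lemma R2Exact.act_coeq (hS : S.R2Exact) (X : V) {A B Q : M} {f g : A ⟶ B}
    {p : B ⟶ Q} (h : IsReflCoeq f g p) : IsReflCoeq (X ⊴ₗ f) (X ⊴ₗ g) (X ⊴ₗ p) :=
  have := hS.act_preserves X
  h.map (actionLeft M X)

namespace AlgebraTensor

variable {P : Monad M} (D : S.AlgebraTensor P)

instance epi_p (A B : P.Algebra) : Epi (D.p A B) := (D.p_coeq A B).epi

section Epi

section

variable [Monad.PreservesColimitOfIsReflexivePair P.toFunctor]

instance epi_map_p (A B : P.Algebra) : Epi (P.map (D.p A B)) :=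
  ((D.p_coeq A B).map P.toFunctor).epi

instance epi_map_pHom (A B : P.Algebra) : Epi (P.map (D.pHom A B).f) := D.epi_map_p A B

end

variable [hS : S.R2Exact]

instance epi_wl_p (C : M) (A B : P.Algebra) : Epi (S.wl C (D.p A B)) :=
  (hS.wl_coeq C (D.p_coeq A B)).epi

instance epi_wl_wl_p (C C' : M) (A B : P.Algebra) : Epi (S.wl C (S.wl C' (D.p A B))) :=
  (hS.wl_coeq C (hS.wl_coeq C' (D.p_coeq A B))).epi

instance epi_act_p (X : V) (A B : P.Algebra) : Epi (X ⊴ₗ D.p A B) :=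
  (hS.act_coeq X (D.p_coeq A B)).epi

instance epi_act_act_p (X Y : V) (A B : P.Algebra) : Epi (X ⊴ₗ Y ⊴ₗ D.p A B) :=
  (hS.act_coeq X (hS.act_coeq Y (D.p_coeq A B))).epi

instance epi_act_wl_p (X : V) (C : M) (A B : P.Algebra) : Epi (X ⊴ₗ S.wl C (D.p A B)) :=
  (hS.act_coeq X (hS.wl_coeq C (D.p_coeq A B))).epi

variable [Monad.PreservesColimitOfIsReflexivePair P.toFunctor]

instance epi_map_act_p (X : V) (A B : P.Algebra) : Epi (P.map (X ⊴ₗ D.p A B)) :=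
  ((hS.act_coeq X (D.p_coeq A B)).map P.toFunctor).epi

instance epi_wl_map_p (C : M) (A B : P.Algebra) : Epi (S.wl C (P.map (D.p A B))) :=
  (hS.wl_coeq C ((D.p_coeq A B).map P.toFunctor)).epi

instance epi_map_wl_p (C : M) (A B : P.Algebra) : Epi (P.map (S.wl C (D.p A B))) :=
  ((hS.wl_coeq C (D.p_coeq A B)).map P.toFunctor).epi

end Epi

/-- `Γ'` carries the relations of `p_{A,B}`, acted on by `X`, to those of `p_{A, X ⊙ B}`, up to the
strength isomorphism hidden in the algebra `X ⊙ B`. -/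
lemma Γ'_coequalizes (X : V) (A B : P.Algebra) :
    X ⊴ₗ D.dot A.A B.A ≫ S.Γ' X A.A B.A ≫ D.p A (D.act X B) =
      X ⊴ₗ S.wl A.A B.a ≫ S.Γ' X A.A B.A ≫ D.p A (D.act X B) := by
  have h := D.p_condition A (D.act X B)
  dsimp only [act] at h
  rw [reassoc_of% D.Γ'_dot, h, reassoc_of% S.Γ'_nat₃, ← reassoc_of% S.wl_comp,
    Iso.hom_inv_id_assoc]

/-- `X ⊙ p_{A,B}` as a morphism of algebras. -/
def actPHom (X : V) (A B : P.Algebra) :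
    D.act X (D.ract A B.A) ⟶ D.act X (D.tens A B) where
  f := X ⊴ₗ D.p A B
  h := by
    dsimp only [act]
    rw [reassoc_of% D.str.inv_naturality_right, Category.assoc, ← actionHomRight_comp,
      ← actionHomRight_comp]
    exact congrArg (fun z => _ ≫ X ⊴ₗ z) (D.p_act A B)

/-- The left unitor on algebras. -/
@[simps]
def η (B : P.Algebra) : B ⟶ D.tens D.unitObj B where
  f := S.η B.A ≫ D.p D.unitObj B
  h := by
    have h := D.p_condition D.unitObj B
    dsimp only [unitObj] at h
    have h₁ : P.map (D.p D.unitObj B) ≫ (D.tens D.unitObj B).a =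
        (D.θ R B.A ≫ S.wr D.unitAct B.A) ≫ D.p D.unitObj B := D.p_act D.unitObj B
    -- As `R` has structure map `ε_R ∘ σ_R`, the structure map of `R ⊙ B` is `μ ∘ σ`.
    have h₂ : D.θ R B.A ≫ S.wr D.unitAct B.A = D.σ (t R B.A) ≫ S.mu R B.A := by
      rw [D.unitAct_eq, S.wr_comp, ← reassoc_of% D.σ_γ, mu]
    -- Both sides reduce to `σ_B` followed by `p`: the left one by `μ ∘ (R ⊙ η) = 1`, the right one
    -- by trading `b` for `σ_B` under `p` and then using `μ ∘ η = 1`.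
    rw [P.map_comp, Category.assoc, h₁, h₂, Category.assoc, reassoc_of% D.σ_nat,
      reassoc_of% S.wl_η_mu, reassoc_of% S.η_nat, ← h, dot, Category.assoc, ← reassoc_of% S.η_nat,
      reassoc_of% S.η_mu]

section Lift

variable [Monad.PreservesColimitOfIsReflexivePair P.toFunctor]

lemma exists_wl (A : P.Algebra) {B B' : P.Algebra} (g : B ⟶ B') :
    ∃ k : D.tens A B ⟶ D.tens A B', D.p A B ≫ k.f = S.wl A.A g.f ≫ D.p A B' :=
  exists_algebra_desc (D.pHom A B) (D.ractRight A g.f ≫ D.pHom A B')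
    ((D.p_coeq A B).exists_desc _ (by
      change D.dot _ _ ≫ S.wl _ _ ≫ D.p _ _ = S.wl _ _ ≫ S.wl _ _ ≫ D.p _ _
      rw [← reassoc_of% D.dot_nat_right, p_condition, ← reassoc_of% S.wl_comp, g.h, S.wl_comp,
        Category.assoc]))

lemma exists_wr {A A' : P.Algebra} (f : A ⟶ A') (B : P.Algebra) :
    ∃ k : D.tens A B ⟶ D.tens A' B, D.p A B ≫ k.f = S.wr f.f B.A ≫ D.p A' B :=
  exists_algebra_desc (D.pHom A B) (D.ractLeft f B.A ≫ D.pHom A' B)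
    ((D.p_coeq A B).exists_desc _ (by
      change D.dot _ _ ≫ S.wr _ _ ≫ D.p _ _ = S.wl _ _ ≫ S.wr _ _ ≫ D.p _ _
      rw [← reassoc_of% D.dot_nat_left, p_condition, reassoc_of% S.exchange]))

lemma exists_ε (A : P.Algebra) :
    ∃ k : D.tens A D.unitObj ⟶ A, D.p A D.unitObj ≫ k.f = S.ε A.A :=
  exists_algebra_desc (D.pHom A D.unitObj) (D.ractε A)
    ((D.p_coeq A D.unitObj).exists_desc _ (D.dot_ε A.A))

/-- The functor `A ⊙ -` on algebras. -/
noncomputable def wl (A : P.Algebra) {B B' : P.Algebra} (g : B ⟶ B') :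
    D.tens A B ⟶ D.tens A B' := (D.exists_wl A g).choose

lemma p_wl (A : P.Algebra) {B B' : P.Algebra} (g : B ⟶ B') :
    D.p A B ≫ (D.wl A g).f = S.wl A.A g.f ≫ D.p A B' := (D.exists_wl A g).choose_spec

/-- The functor `- ⊙ B` on algebras. -/
noncomputable def wr {A A' : P.Algebra} (f : A ⟶ A') (B : P.Algebra) :
    D.tens A B ⟶ D.tens A' B := (D.exists_wr f B).choose

lemma p_wr {A A' : P.Algebra} (f : A ⟶ A') (B : P.Algebra) :
    D.p A B ≫ (D.wr f B).f = S.wr f.f B.A ≫ D.p A' B := (D.exists_wr f B).choose_spec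

/-- The right unitor on algebras. -/
noncomputable def ε (A : P.Algebra) : D.tens A D.unitObj ⟶ A := (D.exists_ε A).choose

lemma p_ε (A : P.Algebra) : D.p A D.unitObj ≫ (D.ε A).f = S.ε A.A := (D.exists_ε A).choose_spec

variable [hS : S.R2Exact]

instance epi_map_actPHom (X : V) (A B : P.Algebra) : Epi (P.map (D.actPHom X A B).f) :=
  D.epi_map_act_p X A B

lemma exists_Γ (X : V) (A B : P.Algebra) :
    ∃ k : D.act X (D.tens A B) ⟶ D.tens (D.act X A) B,
      X ⊴ₗ D.p A B ≫ k.f = S.Γ X A.A B.A ≫ D.p (D.act X A) B :=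
  exists_algebra_desc (D.actPHom X A B) (D.ractΓ X A B.A ≫ D.pHom (D.act X A) B)
    ((hS.act_coeq X (D.p_coeq A B)).exists_desc _ (by
      change X ⊴ₗ D.dot A.A B.A ≫ S.Γ X A.A B.A ≫ D.p (D.act X A) B =
        X ⊴ₗ S.wl A.A B.a ≫ S.Γ X A.A B.A ≫ D.p (D.act X A) B
      rw [reassoc_of% D.Γ_dot, reassoc_of% S.Γ_nat₃]
      exact congrArg _ (D.p_condition (D.act X A) B)))

lemma exists_Γ' (X : V) (A B : P.Algebra) :
    ∃ k : D.act X (D.tens A B) ⟶ D.tens A (D.act X B),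
      X ⊴ₗ D.p A B ≫ k.f = S.Γ' X A.A B.A ≫ D.p A (D.act X B) :=
  exists_algebra_desc (D.actPHom X A B) (D.ractΓ' X A B.A ≫ D.pHom A (D.act X B))
    ((hS.act_coeq X (D.p_coeq A B)).exists_desc _ (D.Γ'_coequalizes X A B))

/-- Two descents: along `A ⊙ p_{B,C}`, a coequalizer since `A ⊙ -` preserves it, and then along
`p_{A, B ⊙ C}`. Exactness of `- ⊙ C` is never needed, since the source of `γ` is bracketed to the
right. -/
lemma exists_γ (A B C : P.Algebra) :
    ∃ k : D.tens A (D.tens B C) ⟶ D.tens (D.tens A B) C,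
      S.wl A.A (D.p B C) ≫ D.p A (D.tens B C) ≫ k.f =
        S.γ A.A B.A C.A ≫ S.wr (D.p A B) C.A ≫ D.p (D.tens A B) C := by
  have hB : S.wl A.A (D.dot B.A C.A) ≫ S.γ A.A B.A C.A ≫ S.wr (D.p A B) C.A ≫
      D.p (D.tens A B) C =
      S.wl A.A (S.wl B.A C.a) ≫ S.γ A.A B.A C.A ≫ S.wr (D.p A B) C.A ≫ D.p (D.tens A B) C := by
    rw [reassoc_of% D.wl_dot_γ, ← reassoc_of% D.dot_nat_left, p_condition,
      reassoc_of% S.γ_nat₃, reassoc_of% S.exchange]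
  obtain ⟨l, hl⟩ := (hS.wl_coeq A.A (D.p_coeq B C)).exists_desc _ hB
  -- The algebra structure of the product of `B` and `C` is known only after `P p`, so the equation
  -- is tested on the epimorphism `A ⊙ P p_{B,C}`; there it becomes the relation between `A` and
  -- `B`.
  have hA : D.dot A.A (D.tens B C).A ≫ l = S.wl A.A (D.tens B C).a ≫ l := by
    rw [← cancel_epi (S.wl A.A (P.map (D.p B C))), reassoc_of% D.dot_nat_right, hl,
      ← reassoc_of% S.wl_comp, D.p_act, S.wl_comp, Category.assoc, hl, reassoc_of% D.dot_γ,
      ← reassoc_of% S.wr_comp, D.p_condition, S.wr_comp, Category.assoc, S.wl_comp,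
      Category.assoc, reassoc_of% S.γ_nat₂]
  obtain ⟨k, hk⟩ := (D.p_coeq A (D.tens B C)).exists_desc _ hA
  -- Both descents are treated as one quotient map of algebras, so that the factorization is an
  -- algebra morphism by `exists_algebra_desc`.
  have : Epi (P.map (D.ractRight A (D.p B C) ≫ D.pHom A (D.tens B C)).f) := by
    change Epi (P.map (S.wl A.A (D.p B C) ≫ D.p A (D.tens B C)))
    rw [P.map_comp]
    infer_instance
  obtain ⟨m, hm⟩ := exists_algebra_desc (D.ractRight A (D.p B C) ≫ D.pHom A (D.tens B C))
    (D.ractγ A B.A C.A ≫ D.ractLeft (D.pHom A B) C.A ≫ D.pHom _ C)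
    ⟨k, by
      change (S.wl A.A (D.p B C) ≫ D.p A (D.tens B C)) ≫ k = _
      rw [Category.assoc, hk, hl]
      rfl⟩
  exact ⟨m, (Category.assoc _ _ _).symm.trans hm⟩

/-- The strength in the first variable on algebras. -/
noncomputable def Γ (X : V) (A B : P.Algebra) :
    D.act X (D.tens A B) ⟶ D.tens (D.act X A) B := (D.exists_Γ X A B).choose

lemma p_Γ (X : V) (A B : P.Algebra) :
    X ⊴ₗ D.p A B ≫ (D.Γ X A B).f = S.Γ X A.A B.A ≫ D.p (D.act X A) B :=
  (D.exists_Γ X A B).choose_spec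

/-- The strength in the second variable on algebras. -/
noncomputable def Γ' (X : V) (A B : P.Algebra) :
    D.act X (D.tens A B) ⟶ D.tens A (D.act X B) := (D.exists_Γ' X A B).choose

lemma p_Γ' (X : V) (A B : P.Algebra) :
    X ⊴ₗ D.p A B ≫ (D.Γ' X A B).f = S.Γ' X A.A B.A ≫ D.p A (D.act X B) :=
  (D.exists_Γ' X A B).choose_spec

/-- The associator on algebras. -/
noncomputable def γ (A B C : P.Algebra) :
    D.tens A (D.tens B C) ⟶ D.tens (D.tens A B) C := (D.exists_γ A B C).choose

lemma p_γ (A B C : P.Algebra) :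
    S.wl A.A (D.p B C) ≫ D.p A (D.tens B C) ≫ (D.γ A B C).f =
      S.γ A.A B.A C.A ≫ S.wr (D.p A B) C.A ≫ D.p (D.tens A B) C :=
  (D.exists_γ A B C).choose_spec

end Lift

end AlgebraTensor

end SkewMonoidalActegory

end SkewActegory

/-! ### The skew monoidal axioms for algebras, verified on epimorphisms built from `p`. -/

namespace SkewActegory

variable {V : Type u} [Category.{v} V] [MonoidalCategory V] [SymmetricCategory V]
  {M : Type u₁} [Category.{v₁} M] [MonoidalLeftAction V M] {t : M → M → M} {R : M}

namespace SkewMonoidalActegory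

variable {S : SkewMonoidalActegory V t R}

namespace AlgebraTensor

variable {P : Monad M} (D : S.AlgebraTensor P)

/-- `x ⊙ A` as a morphism of algebras. -/
@[simps]
def actLeft {X Y : V} (x : X ⟶ Y) (A : P.Algebra) : D.act X A ⟶ D.act Y A where
  f := x ⊵ₗ A.A
  h := (D.str.algebraAction.actionHomLeft x A).h

/-- `X ⊙ g` as a morphism of algebras. -/
@[simps]
def actRight (X : V) {A B : P.Algebra} (g : A ⟶ B) : D.act X A ⟶ D.act X B where
  f := X ⊴ₗ g.f
  h := (D.str.algebraAction.actionHomRight X g).h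

/-- The associator of the action on algebras. -/
@[simps]
def actAssoc (X Y : V) (A : P.Algebra) : D.act X (D.act Y A) ⟶ D.act (X ⊗ Y) A where
  f := (αₗ X Y A.A).inv
  h := (D.str.algebraAction.actionAssocIso X Y A).inv.h

/-- The unitor of the action on algebras. -/
@[simps]
def actUnit (A : P.Algebra) : A ⟶ D.act (𝟙_ V) A where
  f := (λₗ A.A).inv
  h := (D.str.algebraAction.actionUnitIso A).inv.h

section

variable [Monad.PreservesColimitOfIsReflexivePair P.toFunctor]

lemma wl_id (A B : P.Algebra) : (D.wl A (𝟙 B)).f = 𝟙 (D.tens A B).A := by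
  rw [← cancel_epi (D.p A B), p_wl, Monad.Algebra.id_f, S.wl_id, Category.id_comp,
    Category.comp_id]

lemma wl_comp (A : P.Algebra) {B B' B'' : P.Algebra} (g : B ⟶ B') (g' : B' ⟶ B'') :
    (D.wl A (g ≫ g')).f = (D.wl A g).f ≫ (D.wl A g').f := by
  rw [← cancel_epi (D.p A B), p_wl, Monad.Algebra.comp_f, S.wl_comp, reassoc_of% D.p_wl, p_wl,
    Category.assoc]

lemma wr_id (A B : P.Algebra) : (D.wr (𝟙 A) B).f = 𝟙 (D.tens A B).A := by
  rw [← cancel_epi (D.p A B), p_wr, Monad.Algebra.id_f, S.wr_id, Category.id_comp,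
    Category.comp_id]

lemma wr_comp {A A' A'' : P.Algebra} (f : A ⟶ A') (f' : A' ⟶ A'') (B : P.Algebra) :
    (D.wr (f ≫ f') B).f = (D.wr f B).f ≫ (D.wr f' B).f := by
  rw [← cancel_epi (D.p A B), p_wr, Monad.Algebra.comp_f, S.wr_comp, reassoc_of% D.p_wr, p_wr,
    Category.assoc]

lemma exchange {A A' B B' : P.Algebra} (f : A ⟶ A') (g : B ⟶ B') :
    (D.wl A g).f ≫ (D.wr f B').f = (D.wr f B).f ≫ (D.wl A' g).f := by
  rw [← cancel_epi (D.p A B), reassoc_of% D.p_wl, p_wr, reassoc_of% S.exchange,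
    reassoc_of% D.p_wr, p_wl]

lemma η_nat {A B : P.Algebra} (f : A ⟶ B) :
    f.f ≫ (D.η B).f = (D.η A).f ≫ (D.wl D.unitObj f).f := by
  rw [η_f, η_f, reassoc_of% S.η_nat, Category.assoc, p_wl]

lemma ε_nat {A B : P.Algebra} (f : A ⟶ B) :
    (D.wr f D.unitObj).f ≫ (D.ε B).f = (D.ε A).f ≫ f.f := by
  rw [← cancel_epi (D.p A D.unitObj), reassoc_of% D.p_wr, p_ε, reassoc_of% D.p_ε, S.ε_nat]

lemma η_ε : (D.η D.unitObj).f ≫ (D.ε D.unitObj).f = 𝟙 R := by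
  rw [η_f, Category.assoc, p_ε, S.η_ε]

end

variable [S.R2Exact] [Monad.PreservesColimitOfIsReflexivePair P.toFunctor]

lemma Γ_nat₁ {X Y : V} (x : X ⟶ Y) (A B : P.Algebra) :
    x ⊵ₗ (D.tens A B).A ≫ (D.Γ Y A B).f = (D.Γ X A B).f ≫ (D.wr (D.actLeft x A) B).f := by
  rw [← cancel_epi (X ⊴ₗ D.p A B), action_exchange_assoc, p_Γ, reassoc_of% S.Γ_nat₁,
    reassoc_of% D.p_Γ, p_wr, actLeft_f]

lemma Γ_nat₂ (X : V) {A A' : P.Algebra} (f : A ⟶ A') (B : P.Algebra) :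
    X ⊴ₗ (D.wr f B).f ≫ (D.Γ X A' B).f = (D.Γ X A B).f ≫ (D.wr (D.actRight X f) B).f := by
  rw [← cancel_epi (X ⊴ₗ D.p A B), ← actionHomRight_comp_assoc, p_wr, reassoc_of% D.p_Γ, p_wr,
    actionHomRight_comp, Category.assoc, p_Γ, reassoc_of% S.Γ_nat₂, actRight_f]

lemma Γ_nat₃ (X : V) (A : P.Algebra) {B B' : P.Algebra} (g : B ⟶ B') :
    X ⊴ₗ (D.wl A g).f ≫ (D.Γ X A B').f = (D.Γ X A B).f ≫ (D.wl (D.act X A) g).f := by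
  rw [← cancel_epi (X ⊴ₗ D.p A B), ← actionHomRight_comp_assoc, p_wl, reassoc_of% D.p_Γ, p_wl,
    actionHomRight_comp, Category.assoc, p_Γ, reassoc_of% S.Γ_nat₃]

lemma Γ'_nat₁ {X Y : V} (x : X ⟶ Y) (A B : P.Algebra) :
    x ⊵ₗ (D.tens A B).A ≫ (D.Γ' Y A B).f = (D.Γ' X A B).f ≫ (D.wl A (D.actLeft x B)).f := by
  rw [← cancel_epi (X ⊴ₗ D.p A B), action_exchange_assoc, p_Γ', reassoc_of% S.Γ'_nat₁,
    reassoc_of% D.p_Γ', p_wl, actLeft_f]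

lemma Γ'_nat₂ (X : V) {A A' : P.Algebra} (f : A ⟶ A') (B : P.Algebra) :
    X ⊴ₗ (D.wr f B).f ≫ (D.Γ' X A' B).f = (D.Γ' X A B).f ≫ (D.wr f (D.act X B)).f := by
  rw [← cancel_epi (X ⊴ₗ D.p A B), ← actionHomRight_comp_assoc, p_wr, reassoc_of% D.p_Γ', p_wr,
    actionHomRight_comp, Category.assoc, p_Γ', reassoc_of% S.Γ'_nat₂]

lemma Γ'_nat₃ (X : V) (A : P.Algebra) {B B' : P.Algebra} (g : B ⟶ B') :
    X ⊴ₗ (D.wl A g).f ≫ (D.Γ' X A B').f = (D.Γ' X A B).f ≫ (D.wl A (D.actRight X g)).f := by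
  rw [← cancel_epi (X ⊴ₗ D.p A B), ← actionHomRight_comp_assoc, p_wl, reassoc_of% D.p_Γ', p_wl,
    actionHomRight_comp, Category.assoc, p_Γ', reassoc_of% S.Γ'_nat₃, actRight_f]

lemma γ_nat₁ {A A' : P.Algebra} (f : A ⟶ A') (B C : P.Algebra) :
    (D.wr f (D.tens B C)).f ≫ (D.γ A' B C).f = (D.γ A B C).f ≫ (D.wr (D.wr f B) C).f := by
  rw [← cancel_epi (D.p A (D.tens B C)), ← cancel_epi (S.wl A.A (D.p B C)),
    reassoc_of% D.p_wr, reassoc_of% D.p_γ, p_wr, ← reassoc_of% S.wr_comp, p_wr,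
    reassoc_of% S.exchange, p_γ, reassoc_of% S.γ_nat₁, S.wr_comp, Category.assoc]

lemma γ_nat₂ (A : P.Algebra) {B B' : P.Algebra} (f : B ⟶ B') (C : P.Algebra) :
    (D.wl A (D.wr f C)).f ≫ (D.γ A B' C).f = (D.γ A B C).f ≫ (D.wr (D.wl A f) C).f := by
  rw [← cancel_epi (D.p A (D.tens B C)), ← cancel_epi (S.wl A.A (D.p B C)),
    reassoc_of% D.p_wl, reassoc_of% D.p_γ, p_wr, ← reassoc_of% S.wr_comp, p_wl,
    ← reassoc_of% S.wl_comp, p_wr, S.wl_comp, Category.assoc, p_γ, reassoc_of% S.γ_nat₂,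
    S.wr_comp, Category.assoc]

lemma γ_nat₃ (A B : P.Algebra) {C C' : P.Algebra} (f : C ⟶ C') :
    (D.wl A (D.wl B f)).f ≫ (D.γ A B C').f = (D.γ A B C).f ≫ (D.wl (D.tens A B) f).f := by
  rw [← cancel_epi (D.p A (D.tens B C)), ← cancel_epi (S.wl A.A (D.p B C)),
    reassoc_of% D.p_wl, reassoc_of% D.p_γ, p_wl, ← reassoc_of% S.wl_comp, p_wl, S.wl_comp,
    Category.assoc, p_γ, reassoc_of% S.γ_nat₃, reassoc_of% S.exchange]

lemma pentagon (A B C E : P.Algebra) :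
    (D.wl A (D.γ B C E)).f ≫ (D.γ A (D.tens B C) E).f ≫ (D.wr (D.γ A B C) E).f =
      (D.γ A B (D.tens C E)).f ≫ (D.γ (D.tens A B) C E).f := by
  -- The fourfold product is covered by three successive quotients; after composing with all of them
  -- only the pentagon of `M` remains.
  rw [← cancel_epi (D.p A (D.tens B (D.tens C E))),
    ← cancel_epi (S.wl A.A (D.p B (D.tens C E))),
    ← cancel_epi (S.wl A.A (S.wl B.A (D.p C E))), reassoc_of% D.p_γ, reassoc_of% S.γ_nat₃,
    reassoc_of% S.exchange, p_γ, reassoc_of% S.γ_nat₁, ← reassoc_of% S.pentagon,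
    reassoc_of% D.p_wl, ← reassoc_of% S.wl_comp, ← reassoc_of% S.wl_comp, Category.assoc, p_γ,
    S.wl_comp, S.wl_comp, Category.assoc, Category.assoc, reassoc_of% D.p_γ,
    reassoc_of% S.γ_nat₂, p_wr,
    ← reassoc_of% S.wr_comp, ← reassoc_of% S.wr_comp, Category.assoc, p_γ]
  simp only [S.wr_comp, Category.assoc]

lemma η_γ (A B : P.Algebra) :
    (D.η (D.tens A B)).f ≫ (D.γ D.unitObj A B).f = (D.wr (D.η A) B).f := by
  rw [← cancel_epi (D.p A B), p_wr, η_f, η_f, Category.assoc, reassoc_of% S.η_nat,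
    D.p_γ D.unitObj A B,
    reassoc_of% S.η_γ, S.wr_comp, Category.assoc]

lemma γ_ε (A B : P.Algebra) :
    (D.γ A B D.unitObj).f ≫ (D.ε (D.tens A B)).f = (D.wl A (D.ε B)).f := by
  rw [← cancel_epi (D.p A (D.tens B D.unitObj)), ← cancel_epi (S.wl A.A (D.p B D.unitObj)),
    reassoc_of% D.p_γ, p_ε, S.ε_nat, p_wl, ← reassoc_of% S.wl_comp, p_ε, reassoc_of% S.γ_ε]

lemma η_γ_ε (A B : P.Algebra) :
    (D.wl A (D.η B)).f ≫ (D.γ A D.unitObj B).f ≫ (D.wr (D.ε A) B).f = 𝟙 (D.tens A B).A := by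
  rw [← cancel_epi (D.p A B), reassoc_of% D.p_wl, η_f, S.wl_comp, Category.assoc,
    reassoc_of% D.p_γ, p_wr, ← reassoc_of% S.wr_comp, p_ε, reassoc_of% S.η_γ_ε, Category.comp_id]

lemma Γ_assoc (X Y : V) (A B : P.Algebra) :
    (αₗ X Y (D.tens A B).A).inv ≫ (D.Γ (X ⊗ Y) A B).f =
      X ⊴ₗ (D.Γ Y A B).f ≫ (D.Γ X (D.act Y A) B).f ≫ (D.wr (D.actAssoc X Y A) B).f := by
  have h := actionAssocIso_inv_naturality (𝟙 X) (𝟙 Y) (D.p A B)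
  simp only [id_actionHom, id_tensorHom_id] at h
  rw [← cancel_epi (X ⊴ₗ Y ⊴ₗ D.p A B), reassoc_of% h, p_Γ, reassoc_of% S.Γ_assoc,
    ← actionHomRight_comp_assoc, p_Γ, actionHomRight_comp, Category.assoc, reassoc_of% D.p_Γ,
    p_wr, actAssoc_f]

lemma Γ_unit (A B : P.Algebra) :
    (λₗ (D.tens A B).A).inv ≫ (D.Γ (𝟙_ V) A B).f = (D.wr (D.actUnit A) B).f := by
  rw [← cancel_epi (D.p A B), ← actionUnitIso_inv_naturality_assoc, p_Γ, reassoc_of% S.Γ_unit,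
    p_wr, actUnit_f]

lemma Γ'_assoc (X Y : V) (A B : P.Algebra) :
    (αₗ X Y (D.tens A B).A).inv ≫ (D.Γ' (X ⊗ Y) A B).f =
      X ⊴ₗ (D.Γ' Y A B).f ≫ (D.Γ' X A (D.act Y B)).f ≫ (D.wl A (D.actAssoc X Y B)).f := by
  have h := actionAssocIso_inv_naturality (𝟙 X) (𝟙 Y) (D.p A B)
  simp only [id_actionHom, id_tensorHom_id] at h
  rw [← cancel_epi (X ⊴ₗ Y ⊴ₗ D.p A B), reassoc_of% h, p_Γ', reassoc_of% S.Γ'_assoc,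
    ← actionHomRight_comp_assoc, p_Γ', actionHomRight_comp, Category.assoc, reassoc_of% D.p_Γ',
    p_wl, actAssoc_f]

lemma Γ'_unit (A B : P.Algebra) :
    (λₗ (D.tens A B).A).inv ≫ (D.Γ' (𝟙_ V) A B).f = (D.wl A (D.actUnit B)).f := by
  rw [← cancel_epi (D.p A B), ← actionUnitIso_inv_naturality_assoc, p_Γ', reassoc_of% S.Γ'_unit,
    p_wl, actUnit_f]

lemma Γ_Γ' (X Y : V) (A B : P.Algebra) :
    X ⊴ₗ (D.Γ Y A B).f ≫ (D.Γ' X (D.act Y A) B).f =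
      (αₗ X Y (D.tens A B).A).inv ≫ (β_ X Y).hom ⊵ₗ (D.tens A B).A ≫
        (αₗ Y X (D.tens A B).A).hom ≫ Y ⊴ₗ (D.Γ' X A B).f ≫ (D.Γ Y A (D.act X B)).f := by
  have h := actSwap_nat_right X Y (D.p A B)
  simp only [actSwap_hom, Category.assoc] at h
  rw [← cancel_epi (X ⊴ₗ Y ⊴ₗ D.p A B), reassoc_of% h, ← actionHomRight_comp_assoc, p_Γ,
    actionHomRight_comp, Category.assoc, p_Γ', reassoc_of% S.Γ_Γ', ← actionHomRight_comp_assoc,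
    p_Γ', actionHomRight_comp, Category.assoc, p_Γ]

lemma Γ_γ₁ (X : V) (A B C : P.Algebra) :
    (D.Γ X A (D.tens B C)).f ≫ (D.γ (D.act X A) B C).f =
      X ⊴ₗ (D.γ A B C).f ≫ (D.Γ X (D.tens A B) C).f ≫ (D.wr (D.Γ X A B) C).f := by
  rw [← cancel_epi (X ⊴ₗ D.p A (D.tens B C)), ← cancel_epi (X ⊴ₗ S.wl A.A (D.p B C)),
    reassoc_of% D.p_Γ, reassoc_of% S.Γ_nat₃, D.p_γ (D.act X A) B C, reassoc_of% S.Γ_γ₁,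
    ← actionHomRight_comp_assoc, ← actionHomRight_comp_assoc, Category.assoc, p_γ,
    actionHomRight_comp, actionHomRight_comp, Category.assoc, Category.assoc,
    reassoc_of% D.p_Γ, p_wr, reassoc_of% S.Γ_nat₂, ← reassoc_of% S.wr_comp,
    ← reassoc_of% S.wr_comp, p_Γ]

lemma Γ_γ₂ (X : V) (A B C : P.Algebra) :
    (D.Γ' X A (D.tens B C)).f ≫ (D.wl A (D.Γ X B C)).f ≫ (D.γ A (D.act X B) C).f =
      X ⊴ₗ (D.γ A B C).f ≫ (D.Γ X (D.tens A B) C).f ≫ (D.wr (D.Γ' X A B) C).f := by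
  rw [← cancel_epi (X ⊴ₗ D.p A (D.tens B C)), ← cancel_epi (X ⊴ₗ S.wl A.A (D.p B C)),
    reassoc_of% D.p_Γ', reassoc_of% S.Γ'_nat₃, reassoc_of% D.p_wl, ← reassoc_of% S.wl_comp, p_Γ,
    S.wl_comp, Category.assoc, p_γ, reassoc_of% S.Γ_γ₂,
    ← actionHomRight_comp_assoc, ← actionHomRight_comp_assoc, Category.assoc, p_γ,
    actionHomRight_comp, actionHomRight_comp, Category.assoc, Category.assoc,
    reassoc_of% D.p_Γ, p_wr, reassoc_of% S.Γ_nat₂, ← reassoc_of% S.wr_comp,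
    ← reassoc_of% S.wr_comp, p_Γ']

lemma Γ_γ₃ (X : V) (A B C : P.Algebra) :
    (D.Γ' X A (D.tens B C)).f ≫ (D.wl A (D.Γ' X B C)).f ≫ (D.γ A B (D.act X C)).f =
      X ⊴ₗ (D.γ A B C).f ≫ (D.Γ' X (D.tens A B) C).f := by
  rw [← cancel_epi (X ⊴ₗ D.p A (D.tens B C)), ← cancel_epi (X ⊴ₗ S.wl A.A (D.p B C)),
    reassoc_of% D.p_Γ', reassoc_of% S.Γ'_nat₃, reassoc_of% D.p_wl, ← reassoc_of% S.wl_comp, p_Γ',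
    S.wl_comp, Category.assoc, p_γ, reassoc_of% S.Γ_γ₃,
    ← actionHomRight_comp_assoc, ← actionHomRight_comp_assoc, Category.assoc, p_γ,
    actionHomRight_comp, actionHomRight_comp, Category.assoc, Category.assoc,
    p_Γ', reassoc_of% S.Γ'_nat₂]

lemma η_Γ' (X : V) (A : P.Algebra) :
    X ⊴ₗ (D.η A).f ≫ (D.Γ' X D.unitObj A).f = (D.η (D.act X A)).f := by
  rw [η_f, η_f, actionHomRight_comp, Category.assoc, p_Γ', reassoc_of% S.η_Γ']

lemma Γ_ε (X : V) (A : P.Algebra) :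
    (D.Γ X A D.unitObj).f ≫ (D.ε (D.act X A)).f = X ⊴ₗ (D.ε A).f := by
  rw [← cancel_epi (X ⊴ₗ D.p A D.unitObj), reassoc_of% D.p_Γ, p_ε, S.Γ_ε,
    ← actionHomRight_comp, p_ε]

/-- The skew monoidal structure on the algebras of `P`. -/
noncomputable def skew :
    @SkewMonoidalActegory V _ _ _ P.Algebra _ D.str.algebraAction D.tens D.unitObj :=
  letI := D.str.algebraAction
  { wl := fun A _ _ g => D.wl A g
    wr := fun f B => D.wr f B
    wl_id := fun A B => Monad.Algebra.Hom.ext (D.wl_id A B)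
    wl_comp := fun A _ _ _ g g' => Monad.Algebra.Hom.ext (D.wl_comp A g g')
    wr_id := fun A B => Monad.Algebra.Hom.ext (D.wr_id A B)
    wr_comp := fun f f' B => Monad.Algebra.Hom.ext (D.wr_comp f f' B)
    exchange := fun f g => Monad.Algebra.Hom.ext (D.exchange f g)
    Γ := D.Γ
    Γ' := D.Γ'
    γ := D.γ
    η := D.η
    ε := D.ε
    Γ_nat₁ := fun x A B => Monad.Algebra.Hom.ext (D.Γ_nat₁ x A B)
    Γ_nat₂ := fun X _ _ f B => Monad.Algebra.Hom.ext (D.Γ_nat₂ X f B)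
    Γ_nat₃ := fun X A _ _ g => Monad.Algebra.Hom.ext (D.Γ_nat₃ X A g)
    Γ'_nat₁ := fun x A B => Monad.Algebra.Hom.ext (D.Γ'_nat₁ x A B)
    Γ'_nat₂ := fun X _ _ f B => Monad.Algebra.Hom.ext (D.Γ'_nat₂ X f B)
    Γ'_nat₃ := fun X A _ _ g => Monad.Algebra.Hom.ext (D.Γ'_nat₃ X A g)
    γ_nat₁ := fun f B C => Monad.Algebra.Hom.ext (D.γ_nat₁ f B C)
    γ_nat₂ := fun A _ _ f C => Monad.Algebra.Hom.ext (D.γ_nat₂ A f C)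
    γ_nat₃ := fun A B _ _ f => Monad.Algebra.Hom.ext (D.γ_nat₃ A B f)
    η_nat := fun f => Monad.Algebra.Hom.ext (D.η_nat f)
    ε_nat := fun f => Monad.Algebra.Hom.ext (D.ε_nat f)
    pentagon := fun A B C E => Monad.Algebra.Hom.ext (D.pentagon A B C E)
    η_γ := fun A B => Monad.Algebra.Hom.ext (D.η_γ A B)
    γ_ε := fun A B => Monad.Algebra.Hom.ext (D.γ_ε A B)
    η_γ_ε := fun A B => Monad.Algebra.Hom.ext (D.η_γ_ε A B)
    η_ε := Monad.Algebra.Hom.ext D.η_ε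
    Γ_assoc := fun X Y A B => Monad.Algebra.Hom.ext (D.Γ_assoc X Y A B)
    Γ_unit := fun A B => Monad.Algebra.Hom.ext (D.Γ_unit A B)
    Γ'_assoc := fun X Y A B => Monad.Algebra.Hom.ext (D.Γ'_assoc X Y A B)
    Γ'_unit := fun A B => Monad.Algebra.Hom.ext (D.Γ'_unit A B)
    Γ_Γ' := fun X Y A B => Monad.Algebra.Hom.ext (D.Γ_Γ' X Y A B)
    Γ_γ₁ := fun X A B C => Monad.Algebra.Hom.ext (D.Γ_γ₁ X A B C)
    Γ_γ₂ := fun X A B C => Monad.Algebra.Hom.ext (D.Γ_γ₂ X A B C)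
    Γ_γ₃ := fun X A B C => Monad.Algebra.Hom.ext (D.Γ_γ₃ X A B C)
    η_Γ' := fun X A => Monad.Algebra.Hom.ext (D.η_Γ' X A)
    Γ_ε := fun X A => Monad.Algebra.Hom.ext (D.Γ_ε X A) }

end AlgebraTensor

end SkewMonoidalActegory

end SkewActegory

/-! ### The forgetful functor, uniqueness and r2-exactness. -/

namespace SkewActegory

variable {V : Type u} [Category.{v} V] [MonoidalCategory V] [SymmetricCategory V]
  {M : Type u₁} [Category.{v₁} M] [MonoidalLeftAction V M] {t : M → M → M} {R : M}

namespace SkewMonoidalActegory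

variable {S : SkewMonoidalActegory V t R}

namespace AlgebraTensor

variable {P : Monad M} (D : S.AlgebraTensor P)

/-- The forgetful functor from the algebras of `P`, with identity strength, tensor constraint `p`
and identity unit constraint. -/
def forgetData
    (Sq : @SkewMonoidalActegory V _ _ _ P.Algebra _ D.str.algebraAction D.tens D.unitObj) :
    letI := D.str.algebraAction
    SkewFunctorData Sq S :=
  letI := D.str.algebraAction
  { functor := P.forget
    strength := fun X A => 𝟙 (X ⊙ₗ A.A)
    tens := D.p
    unit := 𝟙 R }

variable [hS : S.R2Exact] [Monad.PreservesColimitOfIsReflexivePair P.toFunctor]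

/-- The axioms involving `p` are the equations characterizing the descended operations; the strength
and unit constraint are identities. -/
lemma isSkewMonoidalVFunctor_forgetData :
    letI := D.str.algebraAction
    (D.forgetData D.skew).IsSkewMonoidalVFunctor :=
  letI := D.str.algebraAction
  { strength_nat_left := fun x A => (Category.comp_id _).trans (Category.id_comp _).symm
    strength_nat_right := fun X _ _ f => (Category.comp_id _).trans (Category.id_comp _).symm
    strength_assoc := fun X Y A => by
      change (αₗ X Y A.A).inv ≫ 𝟙 _ = X ⊴ₗ 𝟙 (Y ⊙ₗ A.A) ≫ 𝟙 _ ≫ (αₗ X Y A.A).inv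
      simp
    strength_unit := fun A => Category.comp_id _
    tens_nat_left := fun f B => (D.p_wr f B).symm
    tens_nat_right := fun A _ _ g => (D.p_wl A g).symm
    tens_assoc := D.p_γ
    left_unit := fun A => by
      change S.η A.A ≫ S.wr (𝟙 R) A.A ≫ D.p D.unitObj A = S.η A.A ≫ D.p D.unitObj A
      rw [S.wr_id, Category.id_comp]
    right_unit := fun A => by
      change S.wl A.A (𝟙 R) ≫ D.p A D.unitObj ≫ (D.ε A).f = S.ε A.A
      rw [S.wl_id, Category.id_comp, p_ε]
    tens_strength_left := fun X A B => by
      change X ⊴ₗ D.p A B ≫ 𝟙 _ ≫ (D.Γ X A B).f =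
        S.Γ X A.A B.A ≫ S.wr (𝟙 (X ⊙ₗ A.A)) B.A ≫ D.p (D.act X A) B
      rw [S.wr_id, Category.id_comp, Category.id_comp, p_Γ]
    tens_strength_right := fun X A B => by
      change X ⊴ₗ D.p A B ≫ 𝟙 _ ≫ (D.Γ' X A B).f =
        S.Γ' X A.A B.A ≫ S.wl A.A (𝟙 (X ⊙ₗ B.A)) ≫ D.p A (D.act X B)
      rw [S.wl_id, Category.id_comp, Category.id_comp, p_Γ'] }

/-- Each axiom of a skew monoidal functor expresses one operation after composition with `p`, or
with `p` tensored or acted on, and these maps are epi. For `η` nothing has to be cancelled. -/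
lemma eq_skew
    (Sq : @SkewMonoidalActegory V _ _ _ P.Algebra _ D.str.algebraAction D.tens D.unitObj)
    (h : letI := D.str.algebraAction
      (D.forgetData Sq).IsSkewMonoidalVFunctor) : Sq = D.skew := by
  let := D.str.algebraAction
  -- Removes the identity strength from the two axioms on `Γ` and `Γ'`.
  have key {Y Z W : M} {p : Y ⟶ Z} {k k' : Z ⟶ W} (hk : p ≫ 𝟙 Z ≫ k = p ≫ 𝟙 Z ≫ k') :
      p ≫ k = p ≫ k' := by simpa using hk
  have h' := D.isSkewMonoidalVFunctor_forgetData
  refine SkewMonoidalActegory.ext ?_ ?_ ?_ ?_ ?_ ?_ ?_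
  · funext A B B' g
    refine Monad.Algebra.Hom.ext ((cancel_epi (D.p A B)).1 ?_)
    exact (h.tens_nat_right A g).symm.trans (h'.tens_nat_right A g)
  · funext A A' f B
    refine Monad.Algebra.Hom.ext ((cancel_epi (D.p A B)).1 ?_)
    exact (h.tens_nat_left f B).symm.trans (h'.tens_nat_left f B)
  · funext X A B
    refine Monad.Algebra.Hom.ext ((cancel_epi (X ⊴ₗ D.p A B)).1 ?_)
    exact key ((h.tens_strength_left X A B).trans (h'.tens_strength_left X A B).symm)
  · funext X A B
    refine Monad.Algebra.Hom.ext ((cancel_epi (X ⊴ₗ D.p A B)).1 ?_)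
    exact key ((h.tens_strength_right X A B).trans (h'.tens_strength_right X A B).symm)
  · funext A B C
    refine Monad.Algebra.Hom.ext ((cancel_epi (D.p A (D.tens B C))).1
      ((cancel_epi (S.wl A.A (D.p B C))).1 ?_))
    exact (h.tens_assoc A B C).trans (h'.tens_assoc A B C).symm
  · funext A
    exact Monad.Algebra.Hom.ext ((h.left_unit A).symm.trans (h'.left_unit A))
  · funext A
    refine Monad.Algebra.Hom.ext ((cancel_epi (D.p A D.unitObj)).1 ?_)
    have h₁ := (h.right_unit A).trans (h'.right_unit A).symm
    change S.wl A.A (𝟙 R) ≫ D.p A D.unitObj ≫ (Sq.ε A).f =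
      S.wl A.A (𝟙 R) ≫ D.p A D.unitObj ≫ (D.skew.ε A).f at h₁
    rwa [S.wl_id, Category.id_comp, Category.id_comp] at h₁

/-- `A ⊙ -` preserves reflexive coequalizers of algebras. -/
lemma tens_coeq (A : P.Algebra) {B B' B'' : P.Algebra} {f g : B ⟶ B'} {c : B' ⟶ B''}
    (hr : IsReflexivePair (D.wl A f) (D.wl A g))
    (h : IsReflCoeq f.f g.f c.f) : IsReflCoeq (D.wl A f) (D.wl A g) (D.wl A c) := by
  have hP := (hS.wl_coeq A.A (h.map P.toFunctor)).epi
  have hw := hS.wl_coeq A.A h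
  have hp : IsReflCoeq (D.wl A f).f (D.wl A g).f (D.wl A c).f :=
    { refl := IsReflCoeq.isReflexivePair_map P.forget hr
      w := by rw [← wl_comp, ← wl_comp, show f ≫ c = g ≫ c from Monad.Algebra.Hom.ext h.w]
      exists_desc := fun k hk => by
        -- The factorization passes from the quotient to `A ⊙ B'` in `M`, descends along `A ⊙ c`,
        -- and then descends along `p_{A,B''}`. The last step is checked after the epimorphism `A ⊙
        -- P c`.
        obtain ⟨l, hl⟩ := hw.exists_desc (D.p A B' ≫ k) (by
          rw [← reassoc_of% D.p_wl, ← reassoc_of% D.p_wl, hk])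
        obtain ⟨m, hm⟩ := (D.p_coeq A B'').exists_desc l (by
          change D.dot A.A B''.A ≫ l = S.wl A.A B''.a ≫ l
          rw [← cancel_epi (S.wl A.A (P.map c.f)), reassoc_of% D.dot_nat_right, hl,
            ← reassoc_of% S.wl_comp, c.h, S.wl_comp, Category.assoc, hl,
            reassoc_of% D.p_condition])
        exact ⟨m, by rw [← cancel_epi (D.p A B'), reassoc_of% D.p_wl, hm, hl]⟩
      epi := by
        have := hw.epi
        have : Epi (D.p A B' ≫ (D.wl A c).f) := by
          rw [p_wl]
          infer_instance
        exact epi_of_epi (D.p A B') _ }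
  have := (hp.map P.toFunctor).epi
  exact hp.of_forget hr

/-- The inverse is the descent of `(X ⊙ p) ∘ Γ'⁻¹` along `p_{A, X ⊙ B}`. That it respects the
relations is `Γ'_dot` read backwards, after cancelling the strength and `Γ'`. -/
lemma isIso_Γ' (X : V) (A B : P.Algebra) : IsIso (D.Γ' X A B) := by
  have := hS.isIso_Γ'
  obtain ⟨k, hk⟩ := (D.p_coeq A (D.act X B)).exists_desc
    (inv (S.Γ' X A.A B.A) ≫ X ⊴ₗ D.p A B) (by
      change D.dot A.A (X ⊙ₗ B.A) ≫ _ = S.wl A.A ((D.str.iso X B.A).inv ≫ X ⊴ₗ B.a) ≫ _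
      have : IsIso (S.wl A.A (D.str.iso X B.A).hom) :=
        inferInstanceAs (IsIso ((S.tensorLeft A.A).map (D.str.iso X B.A).hom))
      rw [← cancel_epi (S.wl A.A (D.str.iso X B.A).hom), ← cancel_epi (S.Γ' X A.A (P.obj B.A)),
        ← reassoc_of% D.Γ'_dot, ← reassoc_of% S.wl_comp, Iso.hom_inv_id_assoc,
        ← reassoc_of% S.Γ'_nat₃, IsIso.hom_inv_id_assoc,
        ← actionHomRight_comp, ← actionHomRight_comp, p_condition])
  have : IsIso (D.Γ' X A B).f := by
    refine ⟨k, ?_, ?_⟩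
    · rw [← cancel_epi (X ⊴ₗ D.p A B), reassoc_of% D.p_Γ', hk, IsIso.hom_inv_id_assoc]
      exact (Category.comp_id _).symm
    · rw [← cancel_epi (D.p A (D.act X B)), reassoc_of% hk, p_Γ', IsIso.inv_hom_id_assoc]
      exact (Category.comp_id _).symm
  have : IsIso (P.forget.map (D.Γ' X A B)) := this
  exact isIso_of_reflects_iso _ P.forget

/-- Reflexive coequalizers of algebras can be chosen over coequalizers in `M`, so preservation by
the action is inherited from `M` and preservation by the product is `tens_coeq`. -/
lemma r2Exact_skew :
    letI := D.str.algebraAction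
    D.skew.R2Exact := by
  let := D.str.algebraAction
  have := hS.hasReflexiveCoequalizers
  refine ⟨hasReflexiveCoequalizers_algebra, fun X => ?_, D.isIso_Γ', fun A => ?_⟩
  · refine IsReflCoeq.preserves _ fun A B f g hfg => ?_
    obtain ⟨Q, p, h⟩ := exists_algebra_coequalizer f g
    have := (h.map P.toFunctor).epi
    have := ((hS.act_coeq X h).map P.toFunctor).epi
    have : Epi (P.map ((actionLeft P.Algebra X).map p).f) := this
    exact ⟨Q, p, h.of_forget hfg, IsReflCoeq.of_forget (hS.act_coeq X h)
      (IsReflCoeq.isReflexivePair_map _ hfg)⟩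
  · refine IsReflCoeq.preserves _ fun B B' f g hfg => ?_
    obtain ⟨Q, p, h⟩ := exists_algebra_coequalizer f g
    have := (h.map P.toFunctor).epi
    exact ⟨Q, p, h.of_forget hfg, D.tens_coeq A
      (IsReflCoeq.isReflexivePair_map (D.skew.tensorLeft A) hfg) h⟩

end AlgebraTensor

end SkewMonoidalActegory

end SkewActegory

/-! ### The two instances: the canonical monad and the monad `E ⊗ -`. -/

namespace SkewActegory

variable {V : Type u} [Category.{v} V] [MonoidalCategory V] [SymmetricCategory V]
  {M : Type u₁} [Category.{v₁} M] [MonoidalLeftAction V M] {t : M → M → M} {R : M}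

namespace SkewMonoidalActegory

variable (S : SkewMonoidalActegory V t R)

section Canonical

variable [hS : S.R2Exact]

lemma preserves_canonicalMonad :
    Monad.PreservesColimitOfIsReflexivePair S.canonicalMonad.toFunctor :=
  IsReflCoeq.preserves _ fun _ _ f g _ =>
    have := hS.hasReflexiveCoequalizers
    ⟨_, _, IsReflCoeq.of_coequalizer f g, hS.wl_coeq R (IsReflCoeq.of_coequalizer f g)⟩

/-- The horizontal tensor product of modules over the canonical monad. -/
noncomputable def modTensor : S.AlgebraTensor S.canonicalMonad where
  str := S.canonicalStrength
  θ A B := S.γ R A B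
  θ_nat₁ f B := S.γ_nat₂ R f B
  θ_nat₂ A _ _ g := S.γ_nat₃ R A g
  unit_θ A B := S.η_γ A B
  mul_θ A B := by
    change S.mu R (t A B) ≫ S.γ R A B = S.wl R (S.γ R A B) ≫ S.γ R (t R A) B ≫ S.wr (S.mu R A) B
    exact S.mu_γ R A B
  θ_γ A B C := (S.pentagon R A B C).symm
  θ_ε A := S.γ_ε R A
  θ_Γ X A B := (S.Γ_γ₂ X R A B).symm
  θ_Γ' X A B := (S.Γ_γ₃ X R A B).symm
  -- With `σ` the identity, the map `dot` is `μ` up to the composite with `A ⊙ 1`, which `p_coeq`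
  -- removes.
  σ A := 𝟙 (t R A)
  σ_nat f := by
    change S.wl R f ≫ 𝟙 _ = 𝟙 _ ≫ S.wl R f
    rw [Category.comp_id, Category.id_comp]
  σ_γ A B := by
    change 𝟙 (t R (t A B)) ≫ S.γ R A B = S.γ R A B ≫ S.wr (𝟙 (t R A)) B
    rw [S.wr_id, Category.id_comp, Category.comp_id]
  σ_Γ' X A := by
    change X ⊴ₗ 𝟙 (t R A) ≫ S.Γ' X R A = S.Γ' X R A ≫ 𝟙 _
    simp
  unitAct := S.ε R
  unit_unitAct := S.modUnit.unit
  mul_unitAct := S.modUnit.assoc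
  unitAct_eq := (Category.id_comp _).symm
  tens := S.hot
  p A B := S.hotπ A.A B
  p_act A B := S.hotπ_hotAct A B
  p_coeq A B :=
    (IsReflCoeq.of_coequalizer (S.mu A.A B.A) (S.wl A.A (S.modAct B))).congr
      (((S.wl_id A.A (t R B.A)).symm ▸ Category.id_comp _ :
        S.wl A.A (𝟙 (t R B.A)) ≫ S.mu A.A B.A = S.mu A.A B.A)) rfl

/-- The skew monoidal structure on the category of modules. -/
noncomputable def modSkew : SkewMonoidalActegory V S.hot S.modUnit :=
  have := S.preserves_canonicalMonad
  S.modTensor.skew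

lemma isSkewMonoidalVFunctor_hotForget : (S.hotForget S.modSkew).IsSkewMonoidalVFunctor :=
  have := S.preserves_canonicalMonad
  S.modTensor.isSkewMonoidalVFunctor_forgetData

lemma eq_modSkew (Sh : SkewMonoidalActegory V S.hot S.modUnit)
    (h : (S.hotForget Sh).IsSkewMonoidalVFunctor) : Sh = S.modSkew :=
  have := S.preserves_canonicalMonad
  S.modTensor.eq_skew Sh h

end Canonical

lemma Γ_assoc_hom (X Y : V) (A B : M) :
    S.Γ (X ⊗ Y) A B ≫ S.wr (αₗ X Y A).hom B =
      (αₗ X Y (t A B)).hom ≫ X ⊴ₗ S.Γ Y A B ≫ S.Γ X (Y ⊙ₗ A) B := by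
  rw [← cancel_epi (αₗ X Y (t A B)).inv, reassoc_of% S.Γ_assoc, ← S.wr_comp, Iso.inv_hom_id,
    S.wr_id, Category.comp_id, Iso.inv_hom_id_assoc]

section EndMonoid

variable [Hommed V M]

local notation "𝐄" => endObj V R

lemma σ_sigma_nat {A B : M} (f : A ⟶ B) : 𝐄 ⊴ₗ f ≫ S.sigma B = S.sigma A ≫ S.wl R f := by
  rw [sigma, ← actionHomRight_comp_assoc, S.η_nat, actionHomRight_comp, Category.assoc,
    reassoc_of% S.Γ_nat₃, S.exchange, sigma, Category.assoc, Category.assoc]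

lemma sigma_γ (A B : M) :
    S.sigma (t A B) ≫ S.γ R A B = S.Γ 𝐄 A B ≫ S.wr (S.sigma A) B := by
  rw [sigma, Category.assoc, Category.assoc, S.γ_nat₁, reassoc_of% S.Γ_γ₁,
    ← actionHomRight_comp_assoc, S.η_γ, reassoc_of% S.Γ_nat₂, ← S.wr_comp, ← S.wr_comp, sigma]

/-- The symmetry enters through `Γ_Γ'`, when the strength of `E` in the first variable passes the
strength of `X` in the second; `η_Γ'` then absorbs the remaining `Γ'`. -/
lemma sigma_Γ' (X : V) (A : M) :
    X ⊴ₗ S.sigma A ≫ S.Γ' X R A = (actSwap X 𝐄 A).hom ≫ S.sigma (X ⊙ₗ A) := by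
  rw [sigma, actionHomRight_comp, actionHomRight_comp, Category.assoc, Category.assoc,
    S.Γ'_nat₂, reassoc_of% S.Γ_Γ', sigma, ← S.η_Γ', actionHomRight_comp, Category.assoc,
    ← reassoc_of% actSwap_nat_right, actSwap_hom]
  simp only [Category.assoc]

/-- Identifies the evaluation on `R` as the structure map required by `AlgebraTensor`: `Γ`
disappears against `ε`, and `η_R` against `ε_R`. -/
lemma sigma_ε : S.sigma R ≫ S.ε R = ev V R R := by
  rw [sigma, Category.assoc, Category.assoc, S.ε_nat, reassoc_of% S.Γ_ε,
    ← actionHomRight_comp_assoc, S.η_ε, actionHomRight_id, Category.id_comp]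

lemma preserves_endMonad (hS : S.R2Exact) :
    Monad.PreservesColimitOfIsReflexivePair (endMonad V R).toFunctor :=
  IsReflCoeq.preserves _ fun _ _ f g _ =>
    have := hS.hasReflexiveCoequalizers
    ⟨_, _, IsReflCoeq.of_coequalizer f g, hS.act_coeq 𝐄 (IsReflCoeq.of_coequalizer f g)⟩

variable [hS : S.R2Exact]

/-- The product `⊙_q` of `E`-objects. -/
noncomputable def quotTensor : S.AlgebraTensor (endMonad V R) where
  str := endStrength V R
  θ A B := S.Γ 𝐄 A B
  θ_nat₁ f B := S.Γ_nat₂ 𝐄 f B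
  θ_nat₂ A _ _ g := S.Γ_nat₃ 𝐄 A g
  unit_θ A B := by
    change ((λₗ (t A B)).inv ≫ endOne V R ⊵ₗ t A B) ≫ S.Γ 𝐄 A B =
      S.wr ((λₗ A).inv ≫ endOne V R ⊵ₗ A) B
    rw [Category.assoc, S.Γ_nat₁, reassoc_of% S.Γ_unit, S.wr_comp]
  mul_θ A B := by
    change ((αₗ 𝐄 𝐄 (t A B)).inv ≫ endMul V R ⊵ₗ t A B) ≫ S.Γ 𝐄 A B =
      𝐄 ⊴ₗ S.Γ 𝐄 A B ≫ S.Γ 𝐄 (𝐄 ⊙ₗ A) B ≫ S.wr ((αₗ 𝐄 𝐄 A).inv ≫ endMul V R ⊵ₗ A) B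
    rw [Category.assoc, S.Γ_nat₁, reassoc_of% S.Γ_assoc, S.wr_comp]
  θ_γ A B C := S.Γ_γ₁ 𝐄 A B C
  θ_ε A := S.Γ_ε 𝐄 A
  θ_Γ X A B := by
    change X ⊴ₗ S.Γ 𝐄 A B ≫ S.Γ X (𝐄 ⊙ₗ A) B ≫ S.wr (actSwap X 𝐄 A).hom B =
      (actSwap X 𝐄 (t A B)).hom ≫ 𝐄 ⊴ₗ S.Γ X A B ≫ S.Γ 𝐄 (X ⊙ₗ A) B
    rw [actSwap_hom, actSwap_hom, S.wr_comp, S.wr_comp, ← reassoc_of% S.Γ_assoc,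
      ← reassoc_of% S.Γ_nat₁, S.Γ_assoc_hom, Category.assoc, Category.assoc]
  θ_Γ' X A B := by
    change X ⊴ₗ S.Γ 𝐄 A B ≫ S.Γ' X (𝐄 ⊙ₗ A) B =
      (actSwap X 𝐄 (t A B)).hom ≫ 𝐄 ⊴ₗ S.Γ' X A B ≫ S.Γ 𝐄 A (X ⊙ₗ B)
    rw [S.Γ_Γ', actSwap_hom]
    simp only [Category.assoc]
  σ A := S.sigma A
  σ_nat f := S.σ_sigma_nat f
  σ_γ A B := S.sigma_γ A B
  σ_Γ' X A := S.sigma_Γ' X A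
  unitAct := ev V R R
  unit_unitAct := (eUnit V R).unit
  mul_unitAct := (eUnit V R).assoc
  unitAct_eq := S.sigma_ε.symm
  tens := S.quot
  p A B := S.quotπ A.A B
  p_act A B := S.quotπ_quotAct A B
  p_coeq A B := by
    have := hS.isIso_Γ' 𝐄 A.A B.A
    have h : IsReflCoeq (S.rho A.A B.A) (S.lam₂ A.A B) (S.quotπ A.A B) :=
      IsReflCoeq.of_coequalizer (S.rho A.A B.A) (S.lam₂ A.A B)
    -- Both `rho` and `lam₂` begin with `Γ'`. As it is invertible, removing it leaves the
    -- coequalizer unchanged and gives the pair with domain `A ⊙ (E ⊗ B)`.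
    exact (h.iso_comp (asIso (S.Γ' 𝐄 A.A B.A)).symm).congr
      ((IsIso.inv_hom_id_assoc (S.Γ' 𝐄 A.A B.A) _).symm)
      ((IsIso.inv_hom_id_assoc (S.Γ' 𝐄 A.A B.A) _).symm)

/-- The skew monoidal structure on the category of `E`-objects. -/
noncomputable def quotSkew : SkewMonoidalActegory V S.quot (eUnit V R) :=
  have := S.preserves_endMonad hS
  S.quotTensor.skew

lemma isSkewMonoidalVFunctor_quotForget : (S.quotForget S.quotSkew).IsSkewMonoidalVFunctor :=
  have := S.preserves_endMonad hS
  S.quotTensor.isSkewMonoidalVFunctor_forgetData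

lemma eq_quotSkew (Sq : SkewMonoidalActegory V S.quot (eUnit V R))
    (h : (S.quotForget Sq).IsSkewMonoidalVFunctor) : Sq = S.quotSkew :=
  have := S.preserves_endMonad hS
  S.quotTensor.eq_skew Sq h

lemma r2Exact_quotSkew : S.quotSkew.R2Exact :=
  have := S.preserves_endMonad hS
  S.quotTensor.r2Exact_skew

end EndMonoid

end SkewMonoidalActegory

end SkewActegory

/-! ### Hom objects for algebras of a strong monad. -/

namespace SkewActegory

section AlgebraHom

variable {V : Type u} [Category.{v} V] [MonoidalCategory V]
  {M : Type u₁} [Category.{v₁} M] [MonoidalLeftAction V M] [Hommed V M]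

lemma comp_curry {X Y : V} {A B : M} (x : X ⟶ Y) (f : Y ⊙ₗ A ⟶ B) :
    x ≫ curry f = curry (x ⊵ₗ A ≫ f) := by
  apply hom_ext_ev
  rw [comp_actionHomLeft, Category.assoc, curry_ev, curry_ev]

lemma curry_comp_ev {X : V} {A B : M} (x : X ⟶ (Hommed.ihom (V := V) A).obj B) :
    curry (x ⊵ₗ A ≫ ev V A B) = x := by
  apply hom_ext_ev
  rw [curry_ev]

namespace MonadStrength

variable {P : Monad M} (σ : MonadStrength V P)

/-- The precomposition `M(A, B) ⟶ M(P A, B)` with the structure morphism of `A`. -/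
def homPre (A B : P.Algebra) : (Hommed.ihom (V := V) A.A).obj B.A ⟶
    (Hommed.ihom (V := V) (P.obj A.A)).obj B.A :=
  curry ((Hommed.ihom (V := V) A.A).obj B.A ⊴ₗ A.a ≫ ev V A.A B.A)

/-- The map `M(A, B) ⟶ M(P A, B)` given by the monad and the structure morphism of `B`. -/
def homPost (A B : P.Algebra) : (Hommed.ihom (V := V) A.A).obj B.A ⟶
    (Hommed.ihom (V := V) (P.obj A.A)).obj B.A :=
  curry ((σ.iso _ A.A).hom ≫ P.map (ev V A.A B.A) ≫ B.a)

/-- Transposing the two composites gives the two sides of the condition that the map `X ⊙ A ⟶ B` be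
an algebra morphism, up to the invertible strength. -/
lemma comp_homPre_eq_iff {X : V} {A B : P.Algebra} (x : X ⟶ (Hommed.ihom (V := V) A.A).obj B.A) :
    x ≫ homPre A B = x ≫ σ.homPost A B ↔
      P.map (x ⊵ₗ A.A ≫ ev V A.A B.A) ≫ B.a =
        ((σ.iso X A.A).inv ≫ X ⊴ₗ A.a) ≫ x ⊵ₗ A.A ≫ ev V A.A B.A := by
  have h₁ : (x ≫ homPre A B) ⊵ₗ P.obj A.A ≫ ev V (P.obj A.A) B.A =
      X ⊴ₗ A.a ≫ x ⊵ₗ A.A ≫ ev V A.A B.A := by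
    rw [comp_actionHomLeft, Category.assoc, homPre, curry_ev, action_exchange_assoc]
  have h₂ : (x ≫ σ.homPost A B) ⊵ₗ P.obj A.A ≫ ev V (P.obj A.A) B.A =
      (σ.iso X A.A).hom ≫ P.map (x ⊵ₗ A.A ≫ ev V A.A B.A) ≫ B.a := by
    rw [comp_actionHomLeft, Category.assoc, homPost, curry_ev, reassoc_of% σ.naturality_left,
      P.map_comp, Category.assoc]
  constructor
  · intro h
    rw [h, h₂] at h₁
    rw [Category.assoc, ← h₁, Iso.inv_hom_id_assoc]
  · intro h
    apply hom_ext_ev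
    rw [h₁, h₂, h, Category.assoc, Iso.hom_inv_id_assoc]

lemma curry_homPre_eq_iff {X : V} {A B : P.Algebra} (f : X ⊙ₗ A.A ⟶ B.A) :
    curry f ≫ homPre A B = curry f ≫ σ.homPost A B ↔
      P.map f ≫ B.a = ((σ.iso X A.A).inv ≫ X ⊴ₗ A.a) ≫ f := by
  rw [comp_homPre_eq_iff, curry_ev]

/-- The category of algebras of a strong monad on a tensored `V`-category is tensored. -/
@[reducible]
noncomputable def algebraHommed [HasEqualizers V] : @Hommed V _ _ P.Algebra _ σ.algebraAction :=
  letI := σ.algebraAction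
  -- The hom object of algebras is the part of `M(A, B)` on which `homPre` and `homPost` agree; maps
  -- into it are the transposes of algebra morphisms out of `X ⊙ A`.
  let e (A : P.Algebra) (X : V) (B : P.Algebra) :
      ((actionRight V A).obj X ⟶ B) ≃ (X ⟶ equalizer (homPre A B) (σ.homPost A B)) :=
    { toFun := fun f => equalizer.lift (curry f.f)
        ((σ.curry_homPre_eq_iff f.f).2 f.h)
      invFun := fun k =>
        { f := (k ≫ equalizer.ι _ _) ⊵ₗ A.A ≫ ev V A.A B.A
          h := (σ.comp_homPre_eq_iff _).1 (by
            rw [Category.assoc, equalizer.condition, Category.assoc]) }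
      left_inv := fun f => Monad.Algebra.Hom.ext (by
        change (equalizer.lift _ _ ≫ equalizer.ι _ _) ⊵ₗ A.A ≫ ev V A.A B.A = f.f
        rw [equalizer.lift_ι]
        exact curry_ev _)
      right_inv := fun k => by
        apply equalizer.hom_ext
        rw [equalizer.lift_ι]
        exact curry_comp_ev _ }
  have he (A : P.Algebra) (X' X : V) (B : P.Algebra) (g : X' ⟶ X)
      (f : (actionRight V A).obj X ⟶ B) :
      e A X' B ((actionRight V A).map g ≫ f) = g ≫ e A X B f := by
    apply equalizer.hom_ext
    change equalizer.lift _ _ ≫ _ = (g ≫ equalizer.lift _ _) ≫ _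
    rw [Category.assoc, equalizer.lift_ι, equalizer.lift_ι]
    exact (comp_curry g f.f).symm
  { ihom := fun A => Adjunction.rightAdjointOfEquiv (e A) (he A)
    adj := fun A => Adjunction.adjunctionOfEquivRight (e A) (he A) }

end MonadStrength

end AlgebraHom

end SkewActegory

/-! ### Composition and cancellation of skew monoidal `V`-functors; compatibility of `kappa`. -/

namespace SkewActegory

variable {V : Type u} [Category.{v} V] [MonoidalCategory V] [SymmetricCategory V]
  {M : Type u₁} [Category.{v₁} M] [MonoidalLeftAction V M] {t : M → M → M} {R : M}
  {M' : Type u₂} [Category.{v₂} M'] [MonoidalLeftAction V M'] {t' : M' → M' → M'} {R' : M'}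
  {M'' : Type u₃} [Category.{v₃} M''] [MonoidalLeftAction V M''] {t'' : M'' → M'' → M''} {R'' : M''}
  {S : SkewMonoidalActegory V t R} {S' : SkewMonoidalActegory V t' R'}
  {S'' : SkewMonoidalActegory V t'' R''}

namespace SkewFunctorData.IsSkewMonoidalVFunctor

lemma comp {K : SkewFunctorData S S'} {L : SkewFunctorData S' S''}
    (hK : K.IsSkewMonoidalVFunctor) (hL : L.IsSkewMonoidalVFunctor) :
    (K.comp L).IsSkewMonoidalVFunctor where
  strength_nat_left x A := by
    dsimp only [SkewFunctorData.comp, Functor.comp_obj, Functor.comp_map]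
    rw [reassoc_of% hL.strength_nat_left, ← L.functor.map_comp, hK.strength_nat_left,
      L.functor.map_comp, Category.assoc]
  strength_nat_right X _ _ f := by
    dsimp only [SkewFunctorData.comp, Functor.comp_obj, Functor.comp_map]
    rw [reassoc_of% hL.strength_nat_right, ← L.functor.map_comp, hK.strength_nat_right,
      L.functor.map_comp, Category.assoc]
  strength_assoc X Y A := by
    dsimp only [SkewFunctorData.comp, Functor.comp_obj, Functor.comp_map]
    rw [reassoc_of% hL.strength_assoc, ← L.functor.map_comp, hK.strength_assoc]
    simp only [L.functor.map_comp, Category.assoc, actionHomRight_comp]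
    rw [reassoc_of% hL.strength_nat_right]
  strength_unit A := by
    dsimp only [SkewFunctorData.comp, Functor.comp_obj, Functor.comp_map]
    rw [reassoc_of% hL.strength_unit, ← L.functor.map_comp, hK.strength_unit]
  tens_nat_left f B := by
    dsimp only [SkewFunctorData.comp, Functor.comp_obj, Functor.comp_map]
    rw [reassoc_of% hL.tens_nat_left, ← L.functor.map_comp, hK.tens_nat_left,
      L.functor.map_comp, Category.assoc]
  tens_nat_right A _ _ g := by
    dsimp only [SkewFunctorData.comp, Functor.comp_obj, Functor.comp_map]
    rw [reassoc_of% hL.tens_nat_right, ← L.functor.map_comp, hK.tens_nat_right,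
      L.functor.map_comp, Category.assoc]
  tens_assoc A B C := by
    dsimp only [SkewFunctorData.comp, Functor.comp_obj, Functor.comp_map]
    rw [S''.wl_comp, S''.wr_comp, Category.assoc, Category.assoc, Category.assoc,
      reassoc_of% hL.tens_nat_right, reassoc_of% hL.tens_nat_left, ← L.functor.map_comp,
      ← L.functor.map_comp, hK.tens_assoc, L.functor.map_comp, L.functor.map_comp,
      reassoc_of% hL.tens_assoc]
  left_unit A := by
    dsimp only [SkewFunctorData.comp, Functor.comp_obj, Functor.comp_map]
    rw [S''.wr_comp, Category.assoc, reassoc_of% hL.tens_nat_left, reassoc_of% hL.left_unit,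
      ← L.functor.map_comp, ← L.functor.map_comp, hK.left_unit]
  right_unit A := by
    dsimp only [SkewFunctorData.comp, Functor.comp_obj, Functor.comp_map]
    rw [S''.wl_comp, Category.assoc, Category.assoc, reassoc_of% hL.tens_nat_right,
      ← L.functor.map_comp, ← L.functor.map_comp, hK.right_unit, hL.right_unit]
  tens_strength_left X A B := by
    dsimp only [SkewFunctorData.comp, Functor.comp_obj, Functor.comp_map]
    rw [actionHomRight_comp, S''.wr_comp, Category.assoc, Category.assoc, Category.assoc,
      reassoc_of% hL.strength_nat_right, reassoc_of% hL.tens_nat_left, ← L.functor.map_comp,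
      ← L.functor.map_comp, hK.tens_strength_left, L.functor.map_comp, L.functor.map_comp,
      reassoc_of% hL.tens_strength_left]
  tens_strength_right X A B := by
    dsimp only [SkewFunctorData.comp, Functor.comp_obj, Functor.comp_map]
    rw [actionHomRight_comp, S''.wl_comp, Category.assoc, Category.assoc, Category.assoc,
      reassoc_of% hL.strength_nat_right, reassoc_of% hL.tens_nat_right, ← L.functor.map_comp,
      ← L.functor.map_comp, hK.tens_strength_right, L.functor.map_comp, L.functor.map_comp,
      reassoc_of% hL.tens_strength_right]

/-- Skew monoidality is reflected by composition with a faithful skew monoidal `V`-functor whose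
strength and unit constraint are invertible and whose tensor constraint is epi, stably under the
action and the tensor product. -/
lemma of_comp {K : SkewFunctorData S S'} {L : SkewFunctorData S' S''}
    (h : (K.comp L).IsSkewMonoidalVFunctor) (hL : L.IsSkewMonoidalVFunctor)
    [L.functor.Faithful] [hs : ∀ X A, IsIso (L.strength X A)] [hu : IsIso L.unit]
    [ht : ∀ A B, Epi (L.tens A B)] [hat : ∀ (X : V) A B, Epi (X ⊴ₗ L.tens A B)]
    [hwt : ∀ C A B, Epi (S''.wl C (L.tens A B))] : K.IsSkewMonoidalVFunctor where
  strength_nat_left {X Y} x A := by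
    have h₁ := h.strength_nat_left x A
    dsimp only [SkewFunctorData.comp, Functor.comp_obj, Functor.comp_map] at h₁
    apply L.functor.map_injective
    rw [← cancel_epi (L.strength X (K.functor.obj A)), L.functor.map_comp, L.functor.map_comp,
      ← reassoc_of% hL.strength_nat_left, h₁, Category.assoc]
  strength_nat_right X A _ f := by
    have h₁ := h.strength_nat_right X f
    dsimp only [SkewFunctorData.comp, Functor.comp_obj, Functor.comp_map] at h₁
    apply L.functor.map_injective
    rw [← cancel_epi (L.strength X (K.functor.obj A)), L.functor.map_comp, L.functor.map_comp,
      ← reassoc_of% hL.strength_nat_right, h₁, Category.assoc]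
  strength_assoc X Y A := by
    have h₁ := h.strength_assoc X Y A
    dsimp only [SkewFunctorData.comp, Functor.comp_obj, Functor.comp_map] at h₁
    have : IsIso (X ⊴ₗ L.strength Y (K.functor.obj A)) :=
      inferInstanceAs (IsIso ((actionLeft M'' X).map (L.strength Y (K.functor.obj A))))
    apply L.functor.map_injective
    rw [← cancel_epi (L.strength X (Y ⊙ₗ K.functor.obj A)),
      ← cancel_epi (X ⊴ₗ L.strength Y (K.functor.obj A)), L.functor.map_comp, L.functor.map_comp,
      L.functor.map_comp, ← reassoc_of% hL.strength_assoc, ← reassoc_of% hL.strength_nat_right, h₁,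
      actionHomRight_comp, Category.assoc, Category.assoc]
  strength_unit A := by
    have h₁ := h.strength_unit A
    dsimp only [SkewFunctorData.comp, Functor.comp_obj, Functor.comp_map] at h₁
    apply L.functor.map_injective
    rw [L.functor.map_comp, ← hL.strength_unit, Category.assoc, h₁]
  tens_nat_left {A A'} f B := by
    have h₁ := h.tens_nat_left f B
    dsimp only [SkewFunctorData.comp, Functor.comp_obj, Functor.comp_map] at h₁
    apply L.functor.map_injective
    rw [← cancel_epi (L.tens (K.functor.obj A) (K.functor.obj B)), L.functor.map_comp,
      L.functor.map_comp, ← reassoc_of% hL.tens_nat_left, h₁, Category.assoc]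
  tens_nat_right A {B B'} g := by
    have h₁ := h.tens_nat_right A g
    dsimp only [SkewFunctorData.comp, Functor.comp_obj, Functor.comp_map] at h₁
    apply L.functor.map_injective
    rw [← cancel_epi (L.tens (K.functor.obj A) (K.functor.obj B)), L.functor.map_comp,
      L.functor.map_comp, ← reassoc_of% hL.tens_nat_right, h₁, Category.assoc]
  tens_assoc A B C := by
    have h₁ := h.tens_assoc A B C
    dsimp only [SkewFunctorData.comp, Functor.comp_obj, Functor.comp_map] at h₁
    apply L.functor.map_injective
    rw [← cancel_epi (L.tens (K.functor.obj A) (t' (K.functor.obj B) (K.functor.obj C))),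
      ← cancel_epi (S''.wl _ (L.tens (K.functor.obj B) (K.functor.obj C)))]
    simp only [L.functor.map_comp]
    rw [← reassoc_of% hL.tens_nat_right, ← reassoc_of% S''.wl_comp, reassoc_of% hL.tens_assoc,
      ← reassoc_of% hL.tens_nat_left, ← reassoc_of% S''.wr_comp, ← h₁, Category.assoc]
  left_unit A := by
    have h₁ := h.left_unit A
    dsimp only [SkewFunctorData.comp, Functor.comp_obj, Functor.comp_map] at h₁
    apply L.functor.map_injective
    rw [← h₁, L.functor.map_comp, L.functor.map_comp, ← hL.left_unit, Category.assoc,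
      Category.assoc, ← reassoc_of% hL.tens_nat_left, ← reassoc_of% S''.wr_comp]
  right_unit A := by
    have h₁ := h.right_unit A
    dsimp only [SkewFunctorData.comp, Functor.comp_obj, Functor.comp_map] at h₁
    have : IsIso (S''.wl (L.functor.obj (K.functor.obj A)) L.unit) :=
      inferInstanceAs (IsIso ((S''.tensorLeft _).map L.unit))
    apply L.functor.map_injective
    rw [← cancel_epi (L.tens (K.functor.obj A) R'),
      ← cancel_epi (S''.wl (L.functor.obj (K.functor.obj A)) L.unit), hL.right_unit, ← h₁,
      L.functor.map_comp, L.functor.map_comp, ← reassoc_of% hL.tens_nat_right,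
      ← reassoc_of% S''.wl_comp, Category.assoc]
  tens_strength_left X A B := by
    have h₁ := h.tens_strength_left X A B
    dsimp only [SkewFunctorData.comp, Functor.comp_obj, Functor.comp_map] at h₁
    apply L.functor.map_injective
    rw [← cancel_epi (L.strength X (t' (K.functor.obj A) (K.functor.obj B))),
      ← cancel_epi (X ⊴ₗ L.tens (K.functor.obj A) (K.functor.obj B))]
    simp only [L.functor.map_comp]
    rw [← reassoc_of% hL.strength_nat_right, ← actionHomRight_comp_assoc,
      reassoc_of% hL.tens_strength_left, ← reassoc_of% hL.tens_nat_left,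
      ← reassoc_of% S''.wr_comp, ← h₁, Category.assoc]
  tens_strength_right X A B := by
    have h₁ := h.tens_strength_right X A B
    dsimp only [SkewFunctorData.comp, Functor.comp_obj, Functor.comp_map] at h₁
    apply L.functor.map_injective
    rw [← cancel_epi (L.strength X (t' (K.functor.obj A) (K.functor.obj B))),
      ← cancel_epi (X ⊴ₗ L.tens (K.functor.obj A) (K.functor.obj B))]
    simp only [L.functor.map_comp]
    rw [← reassoc_of% hL.strength_nat_right, ← actionHomRight_comp_assoc,
      reassoc_of% hL.tens_strength_right, ← reassoc_of% hL.tens_nat_right,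
      ← reassoc_of% S''.wl_comp, ← h₁, Category.assoc]

variable {K : SkewFunctorData S S'}

/-- Makes the strength of `K` a morphism of modules in `liftStrength`. -/
lemma kappa_strength (hK : K.IsSkewMonoidalVFunctor) (X : V) (A : M) :
    X ⊴ₗ K.kappa A ≫ K.strength X (t R A) ≫ K.functor.map (S.Γ' X R A) =
      S'.Γ' X R' (K.functor.obj A) ≫ S'.wl R' (K.strength X A) ≫ K.kappa (X ⊙ₗ A) := by
  rw [kappa, actionHomRight_comp, Category.assoc, hK.tens_strength_right,
    reassoc_of% S'.Γ'_nat₂, kappa, ← reassoc_of% S'.exchange]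

/-- Associativity with `R` in the middle, followed by the right unit axiom. It shows that `K.tens`
respects the relations defining the horizontal product. -/
lemma mu_tens (hK : K.IsSkewMonoidalVFunctor) (A B : M) :
    S'.mu (K.functor.obj A) (K.functor.obj B) ≫ K.tens A B =
      S'.wl (K.functor.obj A) (K.kappa B) ≫ K.tens A (t R B) ≫ K.functor.map (S.mu A B) := by
  simp only [kappa, SkewMonoidalActegory.mu, S'.wl_comp, Category.assoc, K.functor.map_comp]
  rw [reassoc_of% hK.tens_assoc, ← hK.tens_nat_left, reassoc_of% S'.γ_nat₂,
    ← reassoc_of% S'.wr_comp, ← reassoc_of% S'.wr_comp, Category.assoc, hK.right_unit]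

/-- Associativity with `R` in first place, pulled back along the unit constraint. It makes `K.tens`
compatible with the `R`-actions through the first factor. -/
lemma wl_tens_kappa_γ (hK : K.IsSkewMonoidalVFunctor) (A B : M) :
    S'.wl R' (K.tens A B) ≫ K.kappa (t A B) ≫ K.functor.map (S.γ R A B) =
      S'.γ R' (K.functor.obj A) (K.functor.obj B) ≫
        S'.wr (K.kappa A) (K.functor.obj B) ≫ K.tens (t R A) B := by
  rw [kappa, kappa, Category.assoc, reassoc_of% S'.exchange, hK.tens_assoc,
    reassoc_of% S'.γ_nat₁, S'.wr_comp, Category.assoc]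

lemma wl_unit_kappa_ε (hK : K.IsSkewMonoidalVFunctor) :
    S'.wl R' K.unit ≫ K.kappa R ≫ K.functor.map (S.ε R) = S'.ε R' ≫ K.unit := by
  rw [kappa, Category.assoc, reassoc_of% S'.exchange, hK.right_unit, S'.ε_nat]

end SkewFunctorData.IsSkewMonoidalVFunctor

end SkewActegory

/-! ### Transport along natural isomorphisms, and pseudo-inverses of strong functors. -/

namespace SkewActegory

variable {V : Type u} [Category.{v} V] [MonoidalCategory V] [SymmetricCategory V]
  {M : Type u₁} [Category.{v₁} M] [MonoidalLeftAction V M] {t : M → M → M} {R : M}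
  {M' : Type u₂} [Category.{v₂} M'] [MonoidalLeftAction V M'] {t' : M' → M' → M'} {R' : M'}
  {S : SkewMonoidalActegory V t R} {S' : SkewMonoidalActegory V t' R'}

namespace SkewFunctorData

lemma isSkewMonoidalVFunctor_id : (id S).IsSkewMonoidalVFunctor := by
  constructor <;> intros <;> simp [id, S.wl_id, S.wr_id]

lemma IsSkewMonoidalVNat.inv {K L : SkewFunctorData S S'} {e : K.functor ≅ L.functor}
    (h : IsSkewMonoidalVNat K L e.hom) : IsSkewMonoidalVNat L K e.inv where
  strength X A := by
    have : IsIso (X ⊴ₗ e.hom.app A) :=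
      inferInstanceAs (IsIso ((actionLeft M' X).map (e.hom.app A)))
    rw [← cancel_epi (X ⊴ₗ e.hom.app A), ← reassoc_of% h.strength, ← actionHomRight_comp_assoc]
    simp
  tens A B := by
    have : IsIso (S'.wl (L.functor.obj A) (e.hom.app B)) :=
      inferInstanceAs (IsIso ((S'.tensorLeft _).map (e.hom.app B)))
    have : IsIso (S'.wr (e.hom.app A) (K.functor.obj B)) :=
      ⟨S'.wr (e.inv.app A) _, by rw [← S'.wr_comp, Iso.hom_inv_id_app, S'.wr_id],
        by rw [← S'.wr_comp, Iso.inv_hom_id_app, S'.wr_id]⟩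
    rw [← cancel_epi (S'.wl (L.functor.obj A) (e.hom.app B)),
      ← cancel_epi (S'.wr (e.hom.app A) (K.functor.obj B)), ← reassoc_of% h.tens,
      reassoc_of% S'.exchange, ← reassoc_of% S'.wr_comp, ← reassoc_of% S'.wl_comp,
      Iso.hom_inv_id_app, Iso.hom_inv_id_app, Iso.hom_inv_id_app, S'.wr_id, S'.wl_id,
      Category.id_comp, Category.id_comp, Category.comp_id]
  unit := by rw [← h.unit, Category.assoc, Iso.hom_inv_id_app, Category.comp_id]

/-- Skew monoidality is transported along natural isomorphisms. -/
lemma IsSkewMonoidalVFunctor.of_iso {K L : SkewFunctorData S S'} (hL : L.IsSkewMonoidalVFunctor)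
    (e : K.functor ≅ L.functor) (h : IsSkewMonoidalVNat K L e.hom) :
    K.IsSkewMonoidalVFunctor where
  strength_nat_left {X Y} x A := by
    rw [← cancel_mono (e.hom.app _), Category.assoc, Category.assoc, h.strength,
      e.hom.naturality, reassoc_of% h.strength, ← action_exchange_assoc, hL.strength_nat_left]
  strength_nat_right X _ _ f := by
    rw [← cancel_mono (e.hom.app _), Category.assoc, Category.assoc, h.strength,
      e.hom.naturality, reassoc_of% h.strength, ← actionHomRight_comp_assoc, e.hom.naturality,
      actionHomRight_comp, Category.assoc, hL.strength_nat_right]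
  strength_assoc X Y A := by
    have h₁ := actionAssocIso_inv_naturality (𝟙 X) (𝟙 Y) (e.hom.app A)
    simp only [id_actionHom, id_tensorHom_id] at h₁
    rw [← cancel_mono (e.hom.app _), Category.assoc, h.strength, ← reassoc_of% h₁,
      hL.strength_assoc, Category.assoc, Category.assoc, e.hom.naturality, reassoc_of% h.strength,
      ← actionHomRight_comp_assoc, ← actionHomRight_comp_assoc, h.strength]
  strength_unit A := by
    rw [← cancel_mono (e.hom.app _), Category.assoc, h.strength, e.hom.naturality,
      actionUnitIso_inv_naturality_assoc, hL.strength_unit]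
  tens_nat_left f B := by
    rw [← cancel_mono (e.hom.app _), Category.assoc, Category.assoc, h.tens, e.hom.naturality,
      reassoc_of% h.tens, ← reassoc_of% S'.wr_comp, e.hom.naturality, S'.wr_comp, Category.assoc,
      ← hL.tens_nat_left, reassoc_of% S'.exchange]
  tens_nat_right A _ _ g := by
    rw [← cancel_mono (e.hom.app _), Category.assoc, Category.assoc, h.tens, e.hom.naturality,
      reassoc_of% h.tens, ← hL.tens_nat_right, ← reassoc_of% S'.wl_comp, ← e.hom.naturality,
      S'.wl_comp, Category.assoc, reassoc_of% S'.exchange]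
  tens_assoc A B C := by
    rw [← cancel_mono (e.hom.app _)]
    simp only [Category.assoc]
    rw [e.hom.naturality, reassoc_of% h.tens, h.tens, reassoc_of% S'.exchange,
      ← reassoc_of% S'.wl_comp, h.tens, ← reassoc_of% S'.wr_comp, h.tens]
    simp only [S'.wl_comp, S'.wr_comp, Category.assoc]
    rw [hL.tens_assoc, reassoc_of% S'.γ_nat₃, reassoc_of% S'.γ_nat₂, reassoc_of% S'.γ_nat₁,
      reassoc_of% S'.exchange]
  left_unit A := by
    rw [← cancel_mono (e.hom.app _)]
    simp only [Category.assoc]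
    rw [e.hom.naturality, h.tens, ← hL.left_unit, ← reassoc_of% S'.wr_comp, h.unit,
      reassoc_of% S'.η_nat, reassoc_of% S'.exchange]
  right_unit A := by
    rw [← cancel_mono (e.hom.app _)]
    simp only [Category.assoc]
    rw [e.hom.naturality, reassoc_of% h.tens, reassoc_of% S'.exchange, ← reassoc_of% S'.wl_comp,
      h.unit, hL.right_unit, S'.ε_nat]
  tens_strength_left X A B := by
    rw [← cancel_mono (e.hom.app _)]
    simp only [Category.assoc]
    rw [e.hom.naturality, reassoc_of% h.strength, h.tens, ← actionHomRight_comp_assoc, h.tens,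
      ← reassoc_of% S'.wr_comp, h.strength]
    simp only [actionHomRight_comp, S'.wr_comp, Category.assoc]
    rw [hL.tens_strength_left, reassoc_of% S'.Γ_nat₃, reassoc_of% S'.Γ_nat₂,
      reassoc_of% S'.exchange]
  tens_strength_right X A B := by
    rw [← cancel_mono (e.hom.app _)]
    simp only [Category.assoc]
    rw [e.hom.naturality, reassoc_of% h.strength, h.tens, ← actionHomRight_comp_assoc, h.tens,
      reassoc_of% S'.exchange, ← reassoc_of% S'.wl_comp, h.strength]
    simp only [actionHomRight_comp, S'.wl_comp, Category.assoc]
    rw [hL.tens_strength_right, reassoc_of% S'.Γ'_nat₃, reassoc_of% S'.Γ'_nat₂]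

/-- A strong skew monoidal `V`-functor with invertible strength whose underlying functor is an
equivalence is an equivalence of skew monoidal `V`-categories. -/
lemma IsSkewMonoidalVFunctor.isSkewMonoidalVEquivalence {K : SkewFunctorData S S'}
    (hK : K.IsSkewMonoidalVFunctor) [hE : K.functor.IsEquivalence]
    (hs : ∀ X A, IsIso (K.strength X A)) (ht : K.IsStrong) : K.IsSkewMonoidalVEquivalence := by
  obtain ⟨ht, hu⟩ := ht
  let G := K.functor.inv
  let u : K.functor ⋙ G ≅ 𝟭 M := K.functor.asEquivalence.unitIso.symm
  let c : G ⋙ K.functor ≅ 𝟭 M' := K.functor.asEquivalence.counitIso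
  -- A triangle identity, written with the inverse of the unit. It turns statements about `u` into
  -- statements about `c` after applying `K`.
  have huc (A : M) : K.functor.map (u.hom.app A) = c.hom.app (K.functor.obj A) := by
    have h := K.functor.asEquivalence.functor_unitIso_comp A
    change K.functor.map (u.inv.app A) ≫ c.hom.app (K.functor.obj A) = 𝟙 _ at h
    rw [← cancel_epi (K.functor.map (u.inv.app A)), h, ← K.functor.map_comp, Iso.inv_hom_id_app,
      K.functor.map_id]
  -- The constraints of `L` are forced by asking that `c` be a skew monoidal `V`-natural
  -- transformation: the equations are solved in `M'` and pulled back by full faithfulness of `K`.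
  let L : SkewFunctorData S' S :=
    { functor := G
      strength := fun X A => K.functor.preimage (inv (K.strength X (G.obj A)) ≫
        X ⊴ₗ c.hom.app A ≫ c.inv.app (X ⊙ₗ A))
      tens := fun A B => K.functor.preimage (inv (K.tens (G.obj A) (G.obj B)) ≫
        S'.wr (c.hom.app A) _ ≫ S'.wl A (c.hom.app B) ≫ c.inv.app (t' A B))
      unit := K.functor.preimage (inv K.unit ≫ c.inv.app R') }
  have hLs (X : V) (A : M') : K.strength X (G.obj A) ≫ K.functor.map (L.strength X A) ≫
      c.hom.app (X ⊙ₗ A) = X ⊴ₗ c.hom.app A := by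
    simp [L]
  have hLt (A B : M') : K.tens (G.obj A) (G.obj B) ≫ K.functor.map (L.tens A B) ≫
      c.hom.app (t' A B) = S'.wr (c.hom.app A) _ ≫ S'.wl A (c.hom.app B) := by
    simp [L]
  have hLu : K.unit ≫ K.functor.map L.unit ≫ c.hom.app R' = 𝟙 R' := by
    simp [L]
  have hc : IsSkewMonoidalVNat (L.comp K) (id S') c.hom :=
    { strength := fun X A => by
        dsimp only [SkewFunctorData.comp, id, Functor.comp_obj, Functor.comp_map]
        rw [Category.assoc, Category.comp_id]
        exact hLs X A
      tens := fun A B => by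
        dsimp only [SkewFunctorData.comp, id, Functor.comp_obj, Functor.comp_map]
        rw [Category.assoc, Category.comp_id]
        exact hLt A B
      unit := by
        dsimp only [SkewFunctorData.comp, id, Functor.comp_obj, Functor.comp_map]
        rw [Category.assoc]
        exact hLu }
  have hu : IsSkewMonoidalVNat (K.comp L) (id S) u.hom :=
    { strength := fun X A => by
        apply K.functor.map_injective
        dsimp only [SkewFunctorData.comp, id, Functor.comp_obj, Functor.comp_map]
        have h := c.hom.naturality (K.strength X A)
        have h' := hLs X (K.functor.obj A)
        dsimp only [Functor.comp_obj, Functor.comp_map, Functor.id_obj, Functor.id_map] at h h'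
        rw [← cancel_epi (K.strength X (G.obj (K.functor.obj A))), Category.comp_id,
          K.functor.map_comp, K.functor.map_comp, huc, Category.assoc, h, reassoc_of% h',
          ← hK.strength_nat_right, huc]
        rfl
      tens := fun A B => by
        apply K.functor.map_injective
        dsimp only [SkewFunctorData.comp, id, Functor.comp_obj, Functor.comp_map]
        have h := c.hom.naturality (K.tens A B)
        have h' := hLt (K.functor.obj A) (K.functor.obj B)
        dsimp only [Functor.comp_obj, Functor.comp_map, Functor.id_obj, Functor.id_map] at h h'
        rw [← cancel_epi (K.tens (G.obj (K.functor.obj A)) (G.obj (K.functor.obj B))),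
          Category.comp_id, K.functor.map_comp, K.functor.map_comp, K.functor.map_comp, huc,
          Category.assoc, h, reassoc_of% h', ← reassoc_of% hK.tens_nat_left,
          ← hK.tens_nat_right, huc, huc]
        rfl
      unit := by
        apply K.functor.map_injective
        dsimp only [SkewFunctorData.comp, id, Functor.comp_obj, Functor.comp_map]
        have h := c.hom.naturality K.unit
        dsimp only [Functor.comp_obj, Functor.comp_map, Functor.id_obj, Functor.id_map] at h
        rw [← cancel_epi K.unit, K.functor.map_comp, K.functor.map_comp, huc, Category.assoc, h,
          reassoc_of% hLu, K.functor.map_id, Category.comp_id] }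
  -- No axiom of `L` is checked directly: `L` followed by `K` is isomorphic to the identity by `c`,
  -- and `K` is then cancelled by `of_comp`.
  have hL : L.IsSkewMonoidalVFunctor :=
    have (X : V) (A B : M) : IsIso (X ⊴ₗ K.tens A B) :=
      inferInstanceAs (IsIso ((actionLeft M' X).map (K.tens A B)))
    have (C : M') (A B : M) : IsIso (S'.wl C (K.tens A B)) :=
      inferInstanceAs (IsIso ((S'.tensorLeft C).map (K.tens A B)))
    (isSkewMonoidalVFunctor_id.of_iso (K := L.comp K) c hc).of_comp hK
  exact ⟨hK, L, hL, ⟨u, hu, hu.inv⟩, ⟨c, hc, hc.inv⟩⟩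

end SkewFunctorData

end SkewActegory

/-! ### The lift of a skew monoidal `V`-functor to modules. -/

namespace SkewActegory

variable {V : Type u} [Category.{v} V] [MonoidalCategory V] [SymmetricCategory V]
  {M : Type u₁} [Category.{v₁} M] [MonoidalLeftAction V M] {t : M → M → M} {R : M}
  {M' : Type u₂} [Category.{v₂} M'] [MonoidalLeftAction V M'] {t' : M' → M' → M'} {R' : M'}
  {S : SkewMonoidalActegory V t R} {S' : SkewMonoidalActegory V t' R'}

lemma SkewMonoidalActegory.hotπ_coeq [S.R2Exact] (A : M) (B : S.Mod) :
    IsReflCoeq (S.mu A B.A) (S.wl A (S.modAct B)) (S.hotπ A B) :=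
  IsReflCoeq.of_coequalizer _ _

/-- The second hypothesis says that `h` is a module morphism for the action on the first factor; it
passes to the quotient because `R ⊙ π` is epi. -/
lemma SkewMonoidalActegory.exists_hot_desc [S.R2Exact] (A B C : S.Mod) (h : t A.A B.A ⟶ C.A)
    (h₁ : S.mu A.A B.A ≫ h = S.wl A.A (S.modAct B) ≫ h)
    (h₂ : S.wl R h ≫ S.modAct C = S.ractAct A B.A ≫ h) :
    ∃ k : S.hot A B ⟶ C, S.hotπ A.A B ≫ k.f = h := by
  obtain ⟨k, hk⟩ := (S.hotπ_coeq A.A B).exists_desc h h₁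
  refine ⟨⟨k, ?_⟩, hk⟩
  change S.wl R k ≫ S.modAct C = S.hotAct A B ≫ k
  rw [← cancel_epi (S.wl R (S.hotπ A.A B)), ← reassoc_of% S.wl_comp, hk, h₂,
    reassoc_of% S.hotπ_hotAct, hk]

namespace SkewFunctorData

variable {K : SkewFunctorData S S'} (hK : K.IsSkewMonoidalVFunctor)

/-- The unit constraint of the lift of a skew monoidal `V`-functor to modules. -/
def liftUnit : S'.modUnit ⟶ (K.lift hK).obj S.modUnit where
  f := K.unit
  h := hK.wl_unit_kappa_ε

variable [hS : S.R2Exact] [hS' : S'.R2Exact]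

/-- The strength of the lift of a skew monoidal `V`-functor to modules. -/
noncomputable def liftStrength (X : V) (A : S.Mod) :
    X ⊙ₗ (K.lift hK).obj A ⟶ (K.lift hK).obj (X ⊙ₗ A) where
  f := K.strength X A.A
  h := by
    have := hS.isIso_Γ' X R A.A
    have := hS'.isIso_Γ' X R' (K.functor.obj A.A)
    change S'.wl R' (K.strength X A.A) ≫ K.kappa (X ⊙ₗ A.A) ≫
        K.functor.map (inv (S.Γ' X R A.A) ≫ X ⊴ₗ S.modAct A) =
      (inv (S'.Γ' X R' (K.functor.obj A.A)) ≫
        X ⊴ₗ (K.kappa A.A ≫ K.functor.map (S.modAct A))) ≫ K.strength X A.A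
    rw [← cancel_epi (S'.Γ' X R' (K.functor.obj A.A)), ← reassoc_of% hK.kappa_strength,
      ← K.functor.map_comp, IsIso.hom_inv_id_assoc, Category.assoc, IsIso.hom_inv_id_assoc,
      actionHomRight_comp, Category.assoc, hK.strength_nat_right]

/-- The relations are respected by `mu_tens`, and linearity over `R` is `wl_tens_kappa_γ`. -/
lemma exists_liftTens (A B : S.Mod) :
    ∃ k : S'.hot ((K.lift hK).obj A) ((K.lift hK).obj B) ⟶ (K.lift hK).obj (S.hot A B),
      S'.hotπ (K.functor.obj A.A) ((K.lift hK).obj B) ≫ k.f =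
        K.tens A.A B.A ≫ K.functor.map (S.hotπ A.A B) := by
  refine S'.exists_hot_desc ((K.lift hK).obj A) ((K.lift hK).obj B) ((K.lift hK).obj (S.hot A B))
    (K.tens A.A B.A ≫ K.functor.map (S.hotπ A.A B)) ?_ ?_
  · change S'.mu (K.functor.obj A.A) (K.functor.obj B.A) ≫ K.tens A.A B.A ≫
        K.functor.map (S.hotπ A.A B) =
      S'.wl (K.functor.obj A.A) (K.kappa B.A ≫ K.functor.map (S.modAct B)) ≫ K.tens A.A B.A ≫
        K.functor.map (S.hotπ A.A B)
    rw [reassoc_of% hK.mu_tens, ← K.functor.map_comp, S.hotπ_condition, S'.wl_comp,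
      Category.assoc, reassoc_of% hK.tens_nat_right, K.functor.map_comp]
  · change S'.wl R' (K.tens A.A B.A ≫ K.functor.map (S.hotπ A.A B)) ≫
        K.kappa (S.hotCarrier A.A B) ≫ K.functor.map (S.hotAct A B) =
      (S'.γ R' (K.functor.obj A.A) (K.functor.obj B.A) ≫
        S'.wr (K.kappa A.A ≫ K.functor.map (S.modAct A)) (K.functor.obj B.A)) ≫
        K.tens A.A B.A ≫ K.functor.map (S.hotπ A.A B)
    rw [S'.wl_comp, Category.assoc, reassoc_of% hK.kappa_nat, ← K.functor.map_comp,
      S.hotπ_hotAct, SkewMonoidalActegory.ractAct, Category.assoc, K.functor.map_comp,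
      K.functor.map_comp,
      reassoc_of% hK.wl_tens_kappa_γ, S'.wr_comp, Category.assoc, Category.assoc,
      reassoc_of% hK.tens_nat_left]

/-- The tensor constraint of the lift of a skew monoidal `V`-functor to modules. -/
noncomputable def liftTens (A B : S.Mod) :
    S'.hot ((K.lift hK).obj A) ((K.lift hK).obj B) ⟶ (K.lift hK).obj (S.hot A B) :=
  (exists_liftTens hK A B).choose

lemma hotπ_liftTens (A B : S.Mod) :
    S'.hotπ (K.functor.obj A.A) ((K.lift hK).obj B) ≫ (liftTens hK A B).f =
      K.tens A.A B.A ≫ K.functor.map (S.hotπ A.A B) :=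
  (exists_liftTens hK A B).choose_spec

/-- The lift of a skew monoidal `V`-functor to modules, as data of a skew monoidal `V`-functor. -/
noncomputable def liftData (Sh : SkewMonoidalActegory V S.hot S.modUnit)
    (Sh' : SkewMonoidalActegory V S'.hot S'.modUnit) : SkewFunctorData Sh Sh' where
  functor := K.lift hK
  strength := liftStrength hK
  tens := liftTens hK
  unit := liftUnit hK

variable (Sh : SkewMonoidalActegory V S.hot S.modUnit)
  (Sh' : SkewMonoidalActegory V S'.hot S'.modUnit)

lemma liftData_comp_hotForget :
    (liftData hK Sh Sh').comp (S'.hotForget Sh') = (S.hotForget Sh).comp K := by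
  have h₁ : ((liftData hK Sh Sh').comp (S'.hotForget Sh')).strength =
      ((S.hotForget Sh).comp K).strength := by
    funext X A
    change 𝟙 _ ≫ K.strength X A.A = K.strength X A.A ≫ K.functor.map (𝟙 (X ⊙ₗ A.A))
    rw [Category.id_comp, K.functor.map_id, Category.comp_id]
  have h₂ : ((liftData hK Sh Sh').comp (S'.hotForget Sh')).tens =
      ((S.hotForget Sh).comp K).tens := by
    funext A B
    exact hotπ_liftTens hK A B
  have h₃ : ((liftData hK Sh Sh').comp (S'.hotForget Sh')).unit =
      ((S.hotForget Sh).comp K).unit := by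
    change 𝟙 R' ≫ K.unit = K.unit ≫ K.functor.map (𝟙 R)
    rw [Category.id_comp, K.functor.map_id, Category.comp_id]
  -- The two underlying functors agree definitionally, so the remaining fields have the same types
  -- and can be compared one by one.
  exact congr (congr (congrArg (SkewFunctorData.mk (S := Sh) (S' := S')
    (S.canonicalMonad.forget ⋙ K.functor)) h₁) h₂) h₃

variable {Sh Sh'}

/-- By the strict square, the lift followed by the forgetful functor is a composite of skew monoidal
functors. The forgetful functor satisfies the hypotheses of `of_comp`, its tensor constraints being
preserved coequalizers. -/
lemma isSkewMonoidalVFunctor_liftData (hG : (S.hotForget Sh).IsSkewMonoidalVFunctor)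
    (hG' : (S'.hotForget Sh').IsSkewMonoidalVFunctor) :
    (liftData hK Sh Sh').IsSkewMonoidalVFunctor := by
  have h := hG.comp hK
  rw [← liftData_comp_hotForget hK Sh Sh'] at h
  have : (S'.hotForget Sh').functor.Faithful := inferInstanceAs S'.canonicalMonad.forget.Faithful
  have (X : V) (A : S'.Mod) : IsIso ((S'.hotForget Sh').strength X A) :=
    inferInstanceAs (IsIso (𝟙 (X ⊙ₗ A.A)))
  have : IsIso (S'.hotForget Sh').unit := inferInstanceAs (IsIso (𝟙 R'))
  have hc (A B : S'.Mod) : IsReflCoeq (S'.mu A.A B.A) (S'.wl A.A (S'.modAct B))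
      ((S'.hotForget Sh').tens A B) := S'.hotπ_coeq A.A B
  have (A B : S'.Mod) : Epi ((S'.hotForget Sh').tens A B) := (hc A B).epi
  have (X : V) (A B : S'.Mod) : Epi (X ⊴ₗ (S'.hotForget Sh').tens A B) :=
    (hS'.act_coeq X (hc A B)).epi
  have (C : M') (A B : S'.Mod) : Epi (S'.wl C ((S'.hotForget Sh').tens A B)) :=
    (hS'.wl_coeq C (hc A B)).epi
  exact h.of_comp hG'

end SkewFunctorData

end SkewActegory

/-! ### Modules as `E`-objects, and the lift of `φ` as an equivalence of categories. -/

namespace SkewActegory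

variable {V : Type u} [Category.{v} V] [MonoidalCategory V] [SymmetricCategory V]
  {M : Type u₁} [Category.{v₁} M] [MonoidalLeftAction V M] {t : M → M → M} {R : M}

namespace SkewMonoidalActegory

variable (S : SkewMonoidalActegory V t R)

variable [Hommed V M]

local notation "𝐄" => endObj V R

lemma sigma_mu (B : M) :
    S.sigma (t R B) ≫ S.mu R B = S.Γ 𝐄 R B ≫ S.wr (ev V R R) B := by
  rw [sigma, Category.assoc, Category.assoc, S.mu_nat_left, ← reassoc_of% S.Γ_mu,
    ← actionHomRight_comp_assoc, S.η_mu, actionHomRight_id, Category.id_comp]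

/-- With `one_sigma`, this makes `sigma` a morphism of monads from `E ⊗ -` to `R ⊙ -`, hence gives
every module an `E`-action. -/
lemma mul_sigma (B : M) :
    (αₗ 𝐄 𝐄 B).inv ≫ endMul V R ⊵ₗ B ≫ S.sigma B =
      𝐄 ⊴ₗ S.sigma B ≫ S.sigma (t R B) ≫ S.mu R B := by
  have h := actionAssocIso_inv_naturality (𝟙 𝐄) (𝟙 𝐄) (S.η B)
  simp only [id_actionHom, id_tensorHom_id] at h
  rw [sigma_mu, sigma, ← action_exchange_assoc, ← reassoc_of% h, reassoc_of% S.Γ_nat₁,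
    ← S.wr_comp, endMul_ev, S.wr_comp, S.wr_comp, reassoc_of% S.Γ_assoc_hom,
    Iso.inv_hom_id_assoc, actionHomRight_comp, actionHomRight_comp, Category.assoc,
    Category.assoc, reassoc_of% S.Γ_nat₂]

/-- The `E`-object underlying a module. -/
@[reducible]
def modEObj (N : S.Mod) : EObj V R where
  A := N.A
  a := S.sigma N.A ≫ S.modAct N
  unit := by
    change ((λₗ N.A).inv ≫ endOne V R ⊵ₗ N.A) ≫ S.sigma N.A ≫ S.modAct N = 𝟙 N.A
    rw [Category.assoc, reassoc_of% S.one_sigma, S.η_modAct]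
  assoc := by
    change ((αₗ 𝐄 𝐄 N.A).inv ≫ endMul V R ⊵ₗ N.A) ≫ S.sigma N.A ≫ S.modAct N =
      𝐄 ⊴ₗ (S.sigma N.A ≫ S.modAct N) ≫ S.sigma N.A ≫ S.modAct N
    rw [Category.assoc, reassoc_of% S.mul_sigma, S.mu_modAct, actionHomRight_comp,
      Category.assoc, ← reassoc_of% S.σ_sigma_nat (S.modAct N)]

variable [hS : S.R2Exact]

lemma quotπ_coeq (A : M) (B : EObj V R) :
    IsReflCoeq (S.rho A B.A) (S.lam₂ A B) (S.quotπ A B) :=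
  IsReflCoeq.of_coequalizer _ _

lemma exists_quot_desc (A B C : EObj V R) (h : t A.A B.A ⟶ C.A)
    (h₁ : S.rho A.A B.A ≫ h = S.lam₂ A.A B ≫ h)
    (h₂ : 𝐄 ⊴ₗ h ≫ eAct C = S.lam₁ A B.A ≫ h) :
    ∃ k : S.quot A B ⟶ C, S.quotπ A.A B ≫ k.f = h := by
  obtain ⟨k, hk⟩ := (S.quotπ_coeq A.A B).exists_desc h h₁
  refine ⟨⟨k, ?_⟩, hk⟩
  change 𝐄 ⊴ₗ k ≫ eAct C = S.quotAct A B ≫ k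
  rw [← cancel_epi (𝐄 ⊴ₗ S.quotπ A.A B), ← actionHomRight_comp_assoc, hk, h₂,
    reassoc_of% S.quotπ_quotAct, hk]

/-- The `E`-action of `N` is its `R`-action restricted along `sigma`, so both the relations of `⊙_q`
and `E`-linearity follow from associativity of the `R`-action. -/
lemma exists_modEObj_act (N : S.Mod) :
    ∃ k : S.quot (eUnit V R) (S.modEObj N) ⟶ S.modEObj N,
      S.quotπ R (S.modEObj N) ≫ k.f = S.modAct N := by
  refine S.exists_quot_desc (eUnit V R) (S.modEObj N) (S.modEObj N) (S.modAct N) ?_ ?_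
  · change S.rho R N.A ≫ S.modAct N =
      (S.Γ' 𝐄 R N.A ≫ S.wl R (S.sigma N.A ≫ S.modAct N)) ≫ S.modAct N
    rw [rho, Category.assoc, Category.assoc, S.mu_modAct, S.wl_comp, Category.assoc,
      Category.assoc]
  · change 𝐄 ⊴ₗ S.modAct N ≫ S.sigma N.A ≫ S.modAct N =
      (S.Γ 𝐄 R N.A ≫ S.wr (ev V R R) N.A) ≫ S.modAct N
    rw [reassoc_of% S.σ_sigma_nat, ← S.mu_modAct, reassoc_of% S.sigma_mu, Category.assoc]

section Lift

variable {S} {Sq : SkewMonoidalActegory V S.quot (eUnit V R)}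

/-- The morphism `R ⊙_q B ⟶ B` of `M` underlying the structure of a module over `_E M`. -/
noncomputable def quotModAct (B : Sq.Mod) : S.quotCarrier R B.A ⟶ B.A.A := (Sq.modAct B).f

variable (hφ : (S.quotForget Sq).IsSkewMonoidalVFunctor)

include hφ in
lemma η_quotπ (A : EObj V R) : S.η A.A ≫ S.quotπ R A = (Sq.η A).f := by
  have h : S.η A.A ≫ S.wr (𝟙 R) A.A ≫ S.quotπ R A = (Sq.η A).f := hφ.left_unit A
  rw [← h, S.wr_id, Category.id_comp]

include hφ in
lemma η_quotπ_quotModAct (B : Sq.Mod) :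
    S.η B.A.A ≫ S.quotπ R B.A ≫ quotModAct B = 𝟙 B.A.A := by
  rw [← Category.assoc, η_quotπ hφ]
  exact congrArg Monad.Algebra.Hom.f (Sq.η_modAct B)

lemma modAct_lift_obj (B : Sq.Mod) :
    S.modAct (((S.quotForget Sq).lift hφ).obj B) = S.quotπ R B.A ≫ quotModAct B := by
  change (S.wr (𝟙 R) B.A.A ≫ S.quotπ R B.A) ≫ quotModAct B = _
  rw [S.wr_id, Category.id_comp]

include hφ in
lemma quotπ_wl (A : EObj V R) {B B' : EObj V R} (g : B ⟶ B') :
    S.quotπ A.A B ≫ (Sq.wl A g).f = S.wl A.A g.f ≫ S.quotπ A.A B' :=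
  (hφ.tens_nat_right A g).symm

include hφ in
lemma mu_quotπ (A B : EObj V R) :
    S.mu A.A B.A ≫ S.quotπ A.A B =
      S.wl A.A (S.quotπ R B) ≫ S.quotπ A.A (S.quot (eUnit V R) B) ≫ (Sq.mu A B).f := by
  have h : S.mu A.A B.A ≫ S.quotπ A.A B = S.wl A.A (S.wr (𝟙 R) B.A ≫ S.quotπ R B) ≫
    S.quotπ A.A (S.quot (eUnit V R) B) ≫ (Sq.mu A B).f := hφ.mu_tens A B
  rw [h, S.wr_id, Category.id_comp]

include hφ in
/-- The `E`-action of a module over `_E M` is determined by its module structure. -/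
lemma eAct_eq (B : Sq.Mod) :
    eAct B.A = S.sigma B.A.A ≫ S.quotπ R B.A ≫ quotModAct B := by
  -- The structure map of `B` is a morphism of `E`-objects; this records its linearity as an
  -- equation in `M`.
  obtain ⟨a, ha, hβ⟩ : ∃ a : 𝐄 ⊙ₗ S.quotCarrier R B.A ⟶ S.quotCarrier R B.A,
      𝐄 ⊴ₗ S.quotπ R B.A ≫ a = (S.Γ 𝐄 R B.A.A ≫ S.wr (ev V R R) B.A.A) ≫ S.quotπ R B.A ∧
      𝐄 ⊴ₗ quotModAct B ≫ eAct B.A = a ≫ quotModAct B :=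
    ⟨S.quotAct (eUnit V R) B.A, S.quotπ_quotAct (eUnit V R) B.A, (Sq.modAct B).h⟩
  have h : 𝐄 ⊴ₗ (S.quotπ R B.A ≫ quotModAct B) ≫ eAct B.A =
      S.Γ 𝐄 R B.A.A ≫ S.wr (ev V R R) B.A.A ≫ S.quotπ R B.A ≫ quotModAct B := by
    rw [actionHomRight_comp, Category.assoc, hβ, reassoc_of% ha]
  -- Composition with `E ⊗ η` makes the unit law of `B` isolate the `E`-action on the left, while
  -- the right becomes `sigma` followed by the `R`-action.
  have h' := 𝐄 ⊴ₗ S.η B.A.A ≫= h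
  rw [← actionHomRight_comp_assoc, η_quotπ_quotModAct hφ, actionHomRight_id,
    Category.id_comp] at h'
  rw [h', sigma, Category.assoc, Category.assoc]

instance faithful_lift_quotForget : ((S.quotForget Sq).lift hφ).Faithful where
  map_injective {A B a b} h := by
    have h' := congrArg Monad.Algebra.Hom.f h
    exact Monad.Algebra.Hom.ext (Monad.Algebra.Hom.ext h')

instance full_lift_quotForget : ((S.quotForget Sq).lift hφ).Full where
  map_surjective {A B} h := by
    let k : A.A.A ⟶ B.A.A := h.f
    have hk : S.wl R k ≫ S.quotπ R B.A ≫ quotModAct B =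
        S.quotπ R A.A ≫ quotModAct A ≫ k := by
      rw [← modAct_lift_obj hφ, ← Category.assoc (S.quotπ R A.A), ← modAct_lift_obj hφ]
      exact h.h
    -- Linearity over `E` comes for free: by `eAct_eq` both `E`-actions are determined by the
    -- `R`-actions, which `k` respects.
    let l : A.A ⟶ B.A := ⟨k, by
      change 𝐄 ⊴ₗ k ≫ eAct B.A = eAct A.A ≫ k
      rw [eAct_eq hφ, eAct_eq hφ, reassoc_of% S.σ_sigma_nat, hk, Category.assoc,
        Category.assoc]⟩
    refine ⟨⟨l, Monad.Algebra.Hom.ext ?_⟩, rfl⟩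
    obtain ⟨w, hw, hw'⟩ : ∃ w : S.quotCarrier R A.A ⟶ S.quotCarrier R B.A,
        S.quotπ R A.A ≫ w = S.wl R k ≫ S.quotπ R B.A ∧ w = (Sq.wl (eUnit V R) l).f :=
      ⟨_, quotπ_wl hφ (eUnit V R) l, rfl⟩
    have h' : w ≫ quotModAct B = quotModAct A ≫ k := by
      have := (S.quotπ_coeq R A.A).epi
      rw [← cancel_epi (S.quotπ R A.A), ← hk, reassoc_of% hw]
    rw [hw'] at h'
    exact h'

/-- The preimage of `N` is `N` with its `E`-action through `sigma` and its `R`-action factored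
through `⊙_q`. The isomorphism is the identity of the underlying object. -/
instance essSurj_lift_quotForget : ((S.quotForget Sq).lift hφ).EssSurj where
  mem_essImage N := by
    obtain ⟨k, hk⟩ := S.exists_modEObj_act N
    have hm : (Sq.mu (eUnit V R) (S.modEObj N)).f ≫ k.f = (Sq.wl (eUnit V R) k).f ≫ k.f := by
      -- Associativity is tested on the two quotients covering the iterated `⊙_q` product, where it
      -- is associativity of the original `R`-action. All maps are taken in `M`.
      have h (l : S.quotCarrier R (S.modEObj N) ⟶ N.A)
          (q : t R (S.quotCarrier R (S.modEObj N)) ⟶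
            S.quotCarrier R (S.quot (eUnit V R) (S.modEObj N)))
          (m w : S.quotCarrier R (S.quot (eUnit V R) (S.modEObj N)) ⟶
            S.quotCarrier R (S.modEObj N)) (_ : Epi q)
          (hl : S.quotπ R (S.modEObj N) ≫ l = S.modAct N)
          (hm : S.mu R N.A ≫ S.quotπ R (S.modEObj N) =
            S.wl R (S.quotπ R (S.modEObj N)) ≫ q ≫ m)
          (hw : q ≫ w = S.wl R l ≫ S.quotπ R (S.modEObj N)) : m ≫ l = w ≫ l := by
        have := (hS.wl_coeq R (S.quotπ_coeq R (S.modEObj N))).epi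
        rw [← cancel_epi q, ← cancel_epi (S.wl R (S.quotπ R (S.modEObj N))), reassoc_of% hw,
          ← reassoc_of% hm, hl, S.mu_modAct, ← reassoc_of% S.wl_comp, hl]
      exact h k.f _ _ _ (S.quotπ_coeq R (S.quot (eUnit V R) (S.modEObj N))).epi hk
        (mu_quotπ hφ (eUnit V R) (S.modEObj N)) (quotπ_wl hφ (eUnit V R) k)
    let B : Sq.Mod := Sq.mkMod (S.modEObj N) k
      (Monad.Algebra.Hom.ext
        ((congrArg (· ≫ k.f) (η_quotπ hφ (S.modEObj N))).symm.trans
          ((Category.assoc _ _ _).trans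
            ((congrArg (S.η N.A ≫ ·) hk).trans (S.η_modAct N)))))
      (Monad.Algebra.Hom.ext hm)
    refine ⟨B, ⟨(Monad.Algebra.isoMk (Iso.refl N.A) ?_ :
      ((S.quotForget Sq).lift hφ).obj B ≅ N)⟩⟩
    have h : S.modAct (((S.quotForget Sq).lift hφ).obj B) = S.modAct N :=
      (modAct_lift_obj hφ B).trans hk
    exact ((congrArg (· ≫ S.modAct N) (S.wl_id R N.A)).trans (Category.id_comp _)).trans
      (h.symm.trans (Category.comp_id _).symm)

end Lift

end SkewMonoidalActegory

end SkewActegory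

/-! ### Invertibility of the constraints of the lift of `φ`. -/

namespace SkewActegory

/-- A quotient in stages: if `π` already identifies `r` and `l`, then dividing by `r, l` first and
by the image of `f, g` afterwards gives the quotient by `f, g`. As `e` is epi, `m, w` impose no more
than that image. -/
lemma IsReflCoeq.isIso_of_comp {C : Type u₁} [Category.{v₁} C] {W X Y Z Q P P' : C}
    {f g : Z ⟶ X} {π : X ⟶ P} (h : IsReflCoeq f g π)
    {r l : W ⟶ X} {q : X ⟶ Q} (hq : IsReflCoeq r l q)
    {m w : Y ⟶ Q} {p : Q ⟶ P'} (hp : IsReflCoeq m w p)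
    {e : Z ⟶ Y} (he : Epi e) (hm : e ≫ m = f ≫ q) (hw : e ≫ w = g ≫ q)
    (hπ : r ≫ π = l ≫ π) (k : P ⟶ P') (hk : π ≫ k = q ≫ p) : IsIso k := by
  have := h.epi
  have := hq.epi
  have := hp.epi
  obtain ⟨j, hj⟩ := hq.exists_desc π hπ
  obtain ⟨i, hi⟩ := hp.exists_desc j (by
    rw [← cancel_epi e, reassoc_of% hm, reassoc_of% hw, hj, h.w])
  refine ⟨i, ?_, ?_⟩
  · rw [← cancel_epi π, reassoc_of% hk, hi, hj, Category.comp_id]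
  · rw [← cancel_epi p, ← cancel_epi q, reassoc_of% hi, reassoc_of% hj, hk, Category.comp_id]

namespace SkewMonoidalActegory

variable {V : Type u} [Category.{v} V] [MonoidalCategory V] [SymmetricCategory V]
  {M : Type u₁} [Category.{v₁} M] [MonoidalLeftAction V M] {t : M → M → M} {R : M}
  {S : SkewMonoidalActegory V t R} [Hommed V M] [hS : S.R2Exact]
  {Sq : SkewMonoidalActegory V S.quot (eUnit V R)}
  (hφ : (S.quotForget Sq).IsSkewMonoidalVFunctor)

local notation "𝐄" => endObj V R

include hφ in
-- By `eAct_eq`, the relation for `⊙_q` is the horizontal relation composed with `sigma`.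
lemma rho_hotπ (A : M) (B : Sq.Mod) :
    S.rho A B.A.A ≫ S.hotπ A (((S.quotForget Sq).lift hφ).obj B) =
      S.lam₂ A B.A ≫ S.hotπ A (((S.quotForget Sq).lift hφ).obj B) := by
  have h (b : t R B.A.A ⟶ B.A.A) {P : M} (π : t A B.A.A ⟶ P)
      (hb : eAct B.A = S.sigma B.A.A ≫ b) (hπ : S.mu A B.A.A ≫ π = S.wl A b ≫ π) :
      S.rho A B.A.A ≫ π = S.lam₂ A B.A ≫ π := by
    rw [rho, lam₂, hb, S.wl_comp, Category.assoc, Category.assoc, Category.assoc, Category.assoc,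
      hπ]
  exact h (S.quotπ R B.A ≫ quotModAct B) _ (eAct_eq hφ B)
    ((S.hotπ_condition A (((S.quotForget Sq).lift hφ).obj B)).trans
      (congrArg (fun b => S.wl A b ≫ S.hotπ A (((S.quotForget Sq).lift hφ).obj B))
        (modAct_lift_obj hφ B)))

variable [Sq.R2Exact]

/-- On the one hand is the horizontal product over `M`; on the other, the quotient `⊙_q` followed by
the horizontal product over `_E M`. The latter is formed among `E`-objects, and `IsReflCoeq.forget`
turns it into a coequalizer in `M`. -/
instance isIso_liftTens (A B : Sq.Mod) : IsIso (SkewFunctorData.liftTens hφ A B) := by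
  have := hS.hasReflexiveCoequalizers
  have := S.preserves_endMonad hS
  have h : IsIso (SkewFunctorData.liftTens hφ A B).f :=
    (S.hotπ_coeq A.A.A (((S.quotForget Sq).lift hφ).obj B)).isIso_of_comp
      (S.quotπ_coeq A.A.A B.A) (Sq.hotπ_coeq A.A B).forget
      (epi_comp' (hS.wl_coeq A.A.A (S.quotπ_coeq R B.A)).epi
        (S.quotπ_coeq A.A.A (S.quot (eUnit V R) B.A)).epi)
      ((Category.assoc _ _ _).trans (mu_quotπ hφ A.A B.A).symm)
      ((Category.assoc _ _ _).trans
        ((congrArg (S.wl A.A.A (S.quotπ R B.A) ≫ ·) (quotπ_wl hφ A.A (Sq.modAct B))).trans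
          ((Category.assoc _ _ _).symm.trans
            (congrArg (· ≫ S.quotπ A.A.A B.A)
              ((S.wl_comp A.A.A (S.quotπ R B.A) (quotModAct B)).symm.trans
                (congrArg (S.wl A.A.A) (modAct_lift_obj hφ B).symm))))))
      (rho_hotπ hφ A.A.A B) _ (SkewFunctorData.hotπ_liftTens hφ A B)
  have : IsIso (S.canonicalMonad.forget.map (SkewFunctorData.liftTens hφ A B)) := h
  exact isIso_of_reflects_iso _ S.canonicalMonad.forget

instance isIso_liftStrength (X : V) (A : Sq.Mod) :
    IsIso (SkewFunctorData.liftStrength hφ X A) := by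
  have : IsIso (S.canonicalMonad.forget.map (SkewFunctorData.liftStrength hφ X A)) :=
    inferInstanceAs (IsIso (𝟙 (X ⊙ₗ A.A.A)))
  exact isIso_of_reflects_iso _ S.canonicalMonad.forget

instance isIso_liftUnit : IsIso (SkewFunctorData.liftUnit hφ) := by
  have : IsIso (S.canonicalMonad.forget.map (SkewFunctorData.liftUnit hφ)) :=
    inferInstanceAs (IsIso (𝟙 R))
  exact isIso_of_reflects_iso _ S.canonicalMonad.forget

end SkewMonoidalActegory

end SkewActegory

theorem mainTheorem4
    {V : Type u} [Category.{v} V] [MonoidalCategory V] [SymmetricCategory V] [MonoidalClosed V]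
    [HasLimits V] [HasColimits V]
    {M : Type u₁} [Category.{v₁} M] [MonoidalLeftAction V M] [Hommed V M]
    {t : M → M → M} {R : M} (S : SkewMonoidalActegory V t R) [S.R2Exact] :
    ∃ (Sq : SkewMonoidalActegory V S.quot (eUnit V R))
      (hφ : (S.quotForget Sq).IsSkewMonoidalVFunctor)
      (_ : Sq.R2Exact)
      (Sqh : SkewMonoidalActegory V Sq.hot Sq.modUnit)
      (Sh : SkewMonoidalActegory V S.hot S.modUnit)
      (φbar : SkewFunctorData Sqh Sh),
      -- the skew monoidal structure of `_E M` is the only one for which `φ` is skew monoidal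
      (∀ Sq' : SkewMonoidalActegory V S.quot (eUnit V R),
        (S.quotForget Sq').IsSkewMonoidalVFunctor → Sq' = Sq) ∧
      -- the same for `(_E M)^{T_q}` and `G^q`
      (Sq.hotForget Sqh).IsSkewMonoidalVFunctor ∧
      (∀ Sqh' : SkewMonoidalActegory V Sq.hot Sq.modUnit,
        (Sq.hotForget Sqh').IsSkewMonoidalVFunctor → Sqh' = Sqh) ∧
      -- the same for `M^T` and `G`
      (S.hotForget Sh).IsSkewMonoidalVFunctor ∧
      (∀ Sh' : SkewMonoidalActegory V S.hot S.modUnit,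
        (S.hotForget Sh').IsSkewMonoidalVFunctor → Sh' = Sh) ∧
      -- the three actegories are tensored `V`-categories
      Nonempty (Hommed V (EObj V R)) ∧ Nonempty (Hommed V Sq.Mod) ∧ Nonempty (Hommed V S.Mod) ∧
      -- `φbar` is the lift of `φ`, and the square of skew monoidal `V`-functors commutes strictly
      φbar.functor = (S.quotForget Sq).lift hφ ∧
      φbar.IsSkewMonoidalVFunctor ∧
      φbar.comp (S.hotForget Sh) = (Sq.hotForget Sqh).comp (S.quotForget Sq) ∧
      -- `φbar` is an equivalence of skew monoidal `V`-categories, in particular strong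
      φbar.IsSkewMonoidalVEquivalence ∧ φbar.IsStrong := by
  have := S.r2Exact_quotSkew
  let hφ := S.isSkewMonoidalVFunctor_quotForget
  let φbar := SkewFunctorData.liftData hφ S.quotSkew.modSkew S.modSkew
  have hφbar : φbar.IsSkewMonoidalVFunctor :=
    SkewFunctorData.isSkewMonoidalVFunctor_liftData hφ
      S.quotSkew.isSkewMonoidalVFunctor_hotForget S.isSkewMonoidalVFunctor_hotForget
  have hs : φbar.IsStrong :=
    ⟨fun A B => SkewMonoidalActegory.isIso_liftTens hφ A B,
      SkewMonoidalActegory.isIso_liftUnit hφ⟩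
  have : φbar.functor.IsEquivalence :=
    { faithful := SkewMonoidalActegory.faithful_lift_quotForget hφ
      full := SkewMonoidalActegory.full_lift_quotForget hφ
      essSurj := SkewMonoidalActegory.essSurj_lift_quotForget hφ }
  -- Tensoredness of the `E`-objects is made an instance because it is also the input for
  -- tensoredness of the modules over them.
  let := (endStrength V R).algebraHommed
  exact ⟨S.quotSkew, hφ, inferInstance, S.quotSkew.modSkew, S.modSkew, φbar, S.eq_quotSkew,
    S.quotSkew.isSkewMonoidalVFunctor_hotForget, S.quotSkew.eq_modSkew,
    S.isSkewMonoidalVFunctor_hotForget, S.eq_modSkew,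
    ⟨inferInstance⟩, ⟨S.quotSkew.canonicalStrength.algebraHommed⟩,
    ⟨S.canonicalStrength.algebraHommed⟩, rfl, hφbar,
    SkewFunctorData.liftData_comp_hotForget hφ _ _,
    hφbar.isSkewMonoidalVEquivalence
      (fun X A => SkewMonoidalActegory.isIso_liftStrength hφ X A) hs, hs⟩
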